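/- **Setting.** Let $n\ge 1$ and let $\mathcal A,\mathcal B$ be finite-dimensional complex Hilbert spaces. Label five single-qubit observables by $1,\dots,5$: $\sigma_1=\sigma_{\mathrm x}$, $\sigma_2=\sigma_{\mathrm y}$, $\sigma_3=\sigma_{\mathrm z}$, $\sigma_4=\sigma_{\mathrm x+\mathrm y}=(\sigma_{\mathrm x}+\sigma_{\mathrm y})/\sqrt2$, $\sigma_5=\sigma_{\mathrm x-\mathrm y}=(\sigma_{\mathrm x}-\sigma_{\mathrm y})/\sqrt2$, and let $|\sigma_q^{\pm}\rangle$ be unit eigenvectors for the eigenvalues $\pm1$. Let $[P]$ be $1$ if $P$ holds and $0$ otherwise. *Questions.* Let $S\subseteq\{1,\dots,5\}^n$ be a nonempty set of special questions. Alice's question set $\mathcal X$ consists of all strings that differ from some $\chi\in S$ in at most two positions. For a string $x$ let $x_{\hat\jmath}$ be $x$ with its $j$th entry removed, and let $\mathcal R^{(j)}$ be the set of strings of length $n-1$ (indexed by the positions other than $j$) that differ from $\chi_{\hat\jmath}$, for some $\chi\in S$, in at most one position. *Measurements.* Alice and Bob share a unit vector $|\psi\rangle\in\mathcal A\otimes\mathcal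 B$. On question $x\in\mathcal X$ Alice performs a projective measurement $\{\Pi_{a|x}\}_{a\in\{+,-\}^n}$ on $\mathcal A$. On question $y\in\{1,\dots,6\}$ Bob performs a projective measurement on $\mathcal B$ with answers in $\{+,-\}^n$; on question $\lozenge$ (resp. $\blacklozenge$) a projective measurement with answers in $\{1,2,3,4\}^{\lfloor n/2\rfloor}$ (resp. $\{1,2,3,4\}^{\lceil n/2\rceil-1}$). Let $A_x^{(j)}$ be the $\pm1$-valued observable for the $j$th entry of Alice's answer, and write $A^{(j)}_{q,r}=A^{(j)}_x$ when $x_j=q$, $x_{\hat\jmath}=r$. Let $D_{zx}^{(j)},E_{zx}^{(j)},D_{zy}^{(j)},E_{zy}^{(j)},D_{xy}^{(j)},E_{xy}^{(j)}$ be the $\pm1$-valued observables for the $j$th entry of Bob's answer to $y=1,\dots,6$, respectively. For $1\le j<n$ and $b\in\{1,2,3,4\}$, let $\Gamma_b^{(2k-1)}$ (resp. $\Gamma_b^{(2k)}$) be the projection for the $k$th entry of Bob's answer to $\lozenge$ (resp. $\blacklozenge$) being $b$. *Approximate saturation.* For $\varepsilon\ge0$ and a fixed $\chi^0\in S$, suppose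 that 1. for all $1\le j\le n$ and $r\in\mathcal R^{(j)}$, $\langle\psi|C_r^{(j)}|\psi\rangle\ge 6\sqrt2-\varepsilon/\sqrt2$, where $$\begin{aligned}C_r^{(j)}={}&A_{3,r}^{(j)}\otimes(D_{zx}^{(j)}+E_{zx}^{(j)})+A_{1,r}^{(j)}\otimes(D_{zx}^{(j)}-E_{zx}^{(j)})+A_{3,r}^{(j)}\otimes(D_{zy}^{(j)}+E_{zy}^{(j)})\\&+A_{2,r}^{(j)}\otimes(D_{zy}^{(j)}-E_{zy}^{(j)})+A_{1,r}^{(j)}\otimes(D_{xy}^{(j)}+E_{xy}^{(j)})+A_{2,r}^{(j)}\otimes(D_{xy}^{(j)}-E_{xy}^{(j)});\end{aligned}$$ 2. for all $\chi\in S$ and $1\le j\le n$, $\langle\psi|A_{4,\chi_{\hat\jmath}}^{(j)}\otimes D_{xy}^{(j)}|\psi\rangle\ge1-\varepsilon$ and $\langle\psi|A_{5,\chi_{\hat\jmath}}^{(j)}\otimes E_{xy}^{(j)}|\psi\rangle\ge1-\varepsilon$; 3. for all $1\le j<n$ and $q\in\{1,2,3\}$, with $w$ obtained from $\chi^0$ by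 replacing the entries at positions $j$ and $j+1$ by $q$, $$\langle\psi|A_w^{(j)}A_w^{(j+1)}\otimes\big[(-1)^{[q=2]}\Gamma_1^{(j)}+(-1)^{[q=1]}\Gamma_2^{(j)}+(-1)^{[q=3]}\Gamma_3^{(j)}-\Gamma_4^{(j)}\big]|\psi\rangle\ge1-\tfrac{\varepsilon}{2}.$$ *Bob's isometry.* For Hermitian $T$ on $\mathcal B$ let $\tilde T=T+P_{\ker T}$ and let $\tilde T\,(\tilde T^\dagger\tilde T)^{-1/2}$ be the regularization of $T$. Let $T_1^{(j)},T_2^{(j)},T_3^{(j)}$ be the regularizations of $(D_{xy}^{(j)}+E_{xy}^{(j)})/\sqrt2$, $(D_{xy}^{(j)}-E_{xy}^{(j)})/\sqrt2$, $(D_{zx}^{(j)}+E_{zx}^{(j)})/\sqrt2$. Let $V_{\mathcal B}^{(j)}$ adjoin qubits $\mathcal B'_j$ and $\mathcal B''_j$, both in state $|0\rangle$, and apply in this order: a Hadamard gate on $\mathcal B_j'$; $iT_2^{(j)}T_1^{(j)}$ on $\mathcal B$ controlled by $\mathcal B_j'$; a Hadamard gate on $\mathcal B_j'$; $T_1^{(j)}$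 controlled by $\mathcal B_j'$; a Hadamard gate on $\mathcal B_j''$; $T_3^{(j)}$ controlled by $\mathcal B_j''$; a Hadamard gate on $\mathcal B_j''$. Let $V_{\mathcal B}=V_{\mathcal B}^{(n)}\cdots V_{\mathcal B}^{(1)}\colon\mathcal B\to\mathcal B'\otimes\mathcal B''\otimes\mathcal B$, where $\mathcal B'=\bigotimes_j\mathcal B_j'$ and $\mathcal B''=\bigotimes_j\mathcal B_j''$. It depends only on Bob's measurements, not on any special question. *States.* For $\chi\in S$ and $a\in\{+,-\}^n$ let $$|e_{a|\chi}\rangle=\bigotimes_{j=1}^n|\sigma_{\chi_j}^{a_j}\rangle,\qquad |e^*_{a|\chi}\rangle=\bigotimes_{j=1}^n|\sigma_{\chi_j}^{a_j(-1)^{[\chi_j=3]}}\rangle,\qquad \rho_{\mathcal B}^{a|\chi}=\operatorname{tr}_{\mathcal A}\frac{\Pi_{a|\chi}|\psi\rangle\langle\psi|\Pi_{a|\chi}}{\langle\psi|\Pi_{a|\chi}|\psi\rangle},$$ the last for answers of nonzero probability. On $\mathcal B''$ write $|0\rangle=|0\cdots0\rangle$ and $|1\rangle=|1\cdots1\rangle$.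 **Theorem.** There is a function $\tau\colon\mathbb R_{\ge0}\times\mathbb N^*\to\mathbb R_{\ge0}$ with $\tau(0,n)=0$ for all $n$ such that in every setting as above (for every $n$, $\mathcal A$, $\mathcal B$, $S$, state, measurements, $\varepsilon\ge0$ and $\chi^0\in S$ satisfying 1–3) the map $V_{\mathcal B}$ is an isometry, and there are positive operators $\beta_0,\beta_1$ on $\mathcal B$ with $\operatorname{tr}\beta_0+\operatorname{tr}\beta_1=1$ such that for every special question $\chi\in S$, with probability at least $1-4\tau(\varepsilon,n)$ over Alice's answers $a$ to $\chi$ (answer $a$ having probability $\langle\psi|\Pi_{a|\chi}|\psi\rangle$), $$\frac12\Big\|V_{\mathcal B}\,\rho_{\mathcal B}^{a|\chi}\,V_{\mathcal B}^\dagger-\big(|e_{a|\chi}\rangle\langle e_{a|\chi}|\otimes|0\rangle\langle0|\otimes\beta_0+|e^*_{a|\chi}\rangle\langle e^*_{a|\chi}|\otimes|1\rangle\langle1|\otimes\beta_1\big)\Big\|_1\le\tau(\varepsilon,n).$$ -/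

import Mathlib

open scoped TensorProduct NNReal

universe u v

noncomputable section

namespace StatePrep

/-! ### Questions -/

/-- A question for Alice: one of five bases at each of the `n` positions.
The values `0, 1, 2, 3, 4` stand for `x`, `y`, `z`, `x + y`, `x - y`; addition is modulo `5`. -/
abbrev Question (n : ℕ) : Type := Fin n → Fin 5

/-- An answer in `{+, -}ⁿ`, with `+` and `-` represented by the units `1` and `-1` of `ℤ`. -/
abbrev Signs (n : ℕ) : Type := Fin n → ℤˣ

/-- The set `𝒟` of shifts `k eᵢ + l eⱼ`, i.e. strings with at most two nonzero entries
(for `n = 1`, all strings). -/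
def shifts (n : ℕ) : Set (Question n) :=
  {d | ∃ (k l : Fin 5) (i j : Fin n), d = Pi.single i k + Pi.single j l}

/-- The set `𝒳` of all questions that Alice may be asked, expanded from the set `S` of special
questions. -/
def aliceQuestions {n : ℕ} (S : Set (Question n)) : Set (Question n) :=
  {x | ∃ χ ∈ S, ∃ d ∈ shifts n, x = χ + d}

/-- The string `x` with its `j`th entry removed. -/
def dropAt {n : ℕ} (j : Fin n) (x : Question n) : {i : Fin n // i ≠ j} → Fin 5 :=
  fun i => x i

/-- The question with `q` at position `j` and `r` at the other positions. -/
def insertAt {n : ℕ} (j : Fin n) (q : Fin 5) (r : {i : Fin n // i ≠ j} → Fin 5) : Question n :=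
  fun i => if h : i = j then q else r ⟨i, h⟩

/-- The set `ℛ⁽ʲ⁾` of strings on the positions other than `j` which differ in at most one entry
from some special question with its `j`th entry removed. -/
def otherQuestions {n : ℕ} (S : Set (Question n)) (j : Fin n) :
    Set ({i : Fin n // i ≠ j} → Fin 5) :=
  {r | ∃ χ ∈ S, r = dropAt j χ ∨
    ∃ (k : Fin 5) (i : {i : Fin n // i ≠ j}), r = dropAt j χ + Pi.single i k}

/-! ### Measurements -/

section Measurements

variable {H : Type*} [NormedAddCommGroup H] [InnerProductSpace ℂ H] [CompleteSpace H]

/-- A projective measurement. -/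
structure IsProjectiveMeasurement {ι : Type*} [Fintype ι] (P : ι → H →L[ℂ] H) : Prop where
  isStarProjection : ∀ i, IsStarProjection (P i)
  orthogonal : ∀ i j, i ≠ j → P i * P j = 0
  sum_eq_one : ∑ i, P i = 1

/-- The operator of observing `v` at the `j`th position of the answer string. -/
def marginal {m : ℕ} {α : Type*} [Fintype α] [DecidableEq α] (P : (Fin m → α) → H →L[ℂ] H)
    (j : Fin m) (v : α) : H →L[ℂ] H :=
  ∑ a with a j = v, P a

/-- The `±1`-outcome observable for the `j`th position of the answer string. -/
def observable {n : ℕ} (P : Signs n → H →L[ℂ] H) (j : Fin n) : H →L[ℂ] H :=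
  marginal P j 1 - marginal P j (-1)

end Measurements

/-- The physical experiment: a state shared by Alice and Bob, Alice's projective measurements for
the questions in `𝒳`, and Bob's projective measurements for the questions `1, …, 6` (indexed from
`0` here), `◇` and `◆`. -/
structure Experiment {n : ℕ} (S : Set (Question n))
    (A : Type u) [NormedAddCommGroup A] [InnerProductSpace ℂ A] [CompleteSpace A]
    (B : Type v) [NormedAddCommGroup B] [InnerProductSpace ℂ B] [CompleteSpace B] where
  ψ : A ⊗[ℂ] B
  norm_ψ : ‖ψ‖ = 1
  alice : Question n → Signs n → A →L[ℂ] A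
  alice_proj : ∀ x ∈ aliceQuestions S, IsProjectiveMeasurement (alice x)
  bob : Fin 6 → Signs n → B →L[ℂ] B
  bob_proj : ∀ y, IsProjectiveMeasurement (bob y)
  bobWhite : (Fin (n / 2) → Fin 4) → B →L[ℂ] B
  bobWhite_proj : IsProjectiveMeasurement bobWhite
  bobBlack : (Fin ((n + 1) / 2 - 1) → Fin 4) → B →L[ℂ] B
  bobBlack_proj : IsProjectiveMeasurement bobBlack

/-! ### Regularization and the circuit defining Bob's isometry -/

section Circuit

variable {B : Type v} [NormedAddCommGroup B] [InnerProductSpace ℂ B] [CompleteSpace B]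

/-- The regularization `T̃ |T̃|⁻¹` of a Hermitian operator `T`, where `T̃ = T + P` with `P` the
orthogonal projection onto the kernel of `T`, and `|T̃| = (T̃† T̃)^{1/2}`. -/
def regularize [FiniteDimensional ℂ B] (T : B →L[ℂ] B) : B →L[ℂ] B :=
  let T' : B →L[ℂ] B := T + (LinearMap.ker (T : B →ₗ[ℂ] B)).starProjection
  T' * Ring.inverse (CFC.sqrt (star T' * T'))

/-- Adjoin an ancilla qubit in state `|0⟩`. A vector of `ℂ² ⊗ B` is represented by its two
components `x 0, x 1` in `B`, i.e. as `|0⟩ ⊗ x 0 + |1⟩ ⊗ x 1`. -/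
def ancilla : B →ₗ[ℂ] (Fin 2 → B) := LinearMap.single ℂ (fun _ => B) 0

/-- The Hadamard gate on the ancilla. -/
def hadamard : (Fin 2 → B) →ₗ[ℂ] (Fin 2 → B) :=
  let p : Fin 2 → (Fin 2 → B) →ₗ[ℂ] B := fun i => LinearMap.proj i
  ((Real.sqrt 2 : ℂ)⁻¹) • LinearMap.pi ![p 0 + p 1, p 0 - p 1]

/-- The operator `U` controlled by the ancilla. -/
def controlled (U : B →L[ℂ] B) : (Fin 2 → B) →ₗ[ℂ] (Fin 2 → B) :=
  LinearMap.pi ![LinearMap.proj 0, (U : B →ₗ[ℂ] B) ∘ₗ LinearMap.proj 1]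

/-- The swap stage `B → B' ⊗ B` for one position, with operators `T₁, T₂`. -/
def swapStage (T₁ T₂ : B →L[ℂ] B) : B →ₗ[ℂ] (Fin 2 → B) :=
  controlled T₁ ∘ₗ hadamard ∘ₗ controlled (Complex.I • (T₂ * T₁)) ∘ₗ hadamard ∘ₗ ancilla

/-- The phase kickback stage `B → B'' ⊗ B` for one position, with operator `T₃`. -/
def kickbackStage (T₃ : B →L[ℂ] B) : B →ₗ[ℂ] (Fin 2 → B) :=
  hadamard ∘ₗ controlled T₃ ∘ₗ hadamard ∘ₗ ancilla

/-- The component along `|s⟩ ⊗ |t⟩ ∈ B' ⊗ B''` of the swap stage followed by the phase kickback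
stage, for one position. -/
def stageComponent (T₁ T₂ T₃ : B →L[ℂ] B) (s t : Fin 2) : B →ₗ[ℂ] B :=
  LinearMap.proj t ∘ₗ kickbackStage T₃ ∘ₗ LinearMap.proj s ∘ₗ swapStage T₁ T₂

end Circuit

/-! ### Qubits, projectors, partial trace and trace norm -/

/-- The space of `n` qubits. -/
abbrev Qubits (n : ℕ) : Type := EuclideanSpace ℂ (Fin n → Fin 2)

/-- The space `B' ⊗ B'' ⊗ B`, where `B'` and `B''` consist of `n` qubits each. -/
abbrev BobSpace (n : ℕ) (B : Type v) [NormedAddCommGroup B] [InnerProductSpace ℂ B] : Type v :=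
  Qubits n ⊗[ℂ] (Qubits n ⊗[ℂ] B)

/-- The computational basis state `|s⟩`. -/
def ket {n : ℕ} (s : Fin n → Fin 2) : Qubits n := EuclideanSpace.single s 1

/-- The angle `θ` such that the observable `σ_q` is `cos θ σ_x + sin θ σ_y` (not used for
`q = z`). -/
def angle : Fin 5 → ℝ := ![0, Real.pi / 2, 0, Real.pi / 4, -(Real.pi / 4)]

/-- The unit eigenvector `|σ_q^a⟩` of `σ_q` with eigenvalue `a`: the state `|0⟩` or `|1⟩` if
`q = z`, and `(|0⟩ + a e^{iθ} |1⟩) / √2` otherwise. -/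
def sigmaKet (q : Fin 5) (a : ℤˣ) : Fin 2 → ℂ :=
  if q = 2 then (if a = 1 then ![1, 0] else ![0, 1])
  else ![(Real.sqrt 2 : ℂ)⁻¹,
    (Real.sqrt 2 : ℂ)⁻¹ * ((a : ℤ) : ℂ) * Complex.exp (Complex.I * (angle q : ℂ))]

/-- The product state `|e_{a|χ}⟩ = ⨂ⱼ |σ_{χⱼ}^{aⱼ}⟩`. -/
def idealKet {n : ℕ} (χ : Question n) (a : Signs n) : Qubits n :=
  WithLp.toLp 2 fun s => ∏ j, sigmaKet (χ j) (a j) (s j)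

/-- The product state `|e*_{a|χ}⟩`, with all qubits in the `z` basis flipped. -/
def idealKetConj {n : ℕ} (χ : Question n) (a : Signs n) : Qubits n :=
  idealKet χ fun j => if χ j = 2 then -a j else a j

/-- The operator `|v⟩⟨v|`. -/
def ketbra {H : Type*} [NormedAddCommGroup H] [InnerProductSpace ℂ H] (v : H) : H →ₗ[ℂ] H :=
  (InnerProductSpace.rankOne ℂ v v : H →L[ℂ] H)

/-- The partial trace `tr_A = tr ⊗ id`. -/
def partialTrace (A : Type u) [NormedAddCommGroup A] [InnerProductSpace ℂ A]
    [FiniteDimensional ℂ A]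
    (B : Type v) [NormedAddCommGroup B] [InnerProductSpace ℂ B] [FiniteDimensional ℂ B] :
    (A ⊗[ℂ] B →ₗ[ℂ] A ⊗[ℂ] B) →ₗ[ℂ] (B →ₗ[ℂ] B) :=
  (TensorProduct.lid ℂ (B →ₗ[ℂ] B)).toLinearMap ∘ₗ
    TensorProduct.map (LinearMap.trace ℂ A) LinearMap.id ∘ₗ
    (homTensorHomEquiv ℂ A B A B).symm.toLinearMap

/-- The Schatten `1`-norm: the sum of the singular values. -/
def traceNorm {H : Type*} [NormedAddCommGroup H] [InnerProductSpace ℂ H] [FiniteDimensional ℂ H]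
    (X : H →ₗ[ℂ] H) : ℝ :=
  X.singularValues.sum fun _ s => s

/-- The operator `V X V†`. -/
def conjBy {H K : Type*} [NormedAddCommGroup H] [InnerProductSpace ℂ H] [FiniteDimensional ℂ H]
    [NormedAddCommGroup K] [InnerProductSpace ℂ K] [FiniteDimensional ℂ K]
    (V : H →ₗ[ℂ] K) (X : H →ₗ[ℂ] H) : K →ₗ[ℂ] K :=
  V ∘ₗ X ∘ₗ LinearMap.adjoint V

/-- The trace distance `½ ‖X - Y‖₁`. -/
def traceDist {H : Type*} [NormedAddCommGroup H] [InnerProductSpace ℂ H] [FiniteDimensional ℂ H]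
    (X Y : H →ₗ[ℂ] H) : ℝ :=
  1 / 2 * traceNorm (X - Y)

/-- `(-1)^{[p]}`. -/
def iversonSign (p : Prop) [Decidable p] : ℂ := if p then -1 else 1

namespace Experiment

variable {n : ℕ} {S : Set (Question n)}
  {A : Type u} [NormedAddCommGroup A] [InnerProductSpace ℂ A] [CompleteSpace A]
  {B : Type v} [NormedAddCommGroup B] [InnerProductSpace ℂ B] [CompleteSpace B]

/-- The observable `A_x⁽ʲ⁾` of Alice. -/
def obsA (E : Experiment S A B) (x : Question n) (j : Fin n) : A →L[ℂ] A :=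
  observable (E.alice x) j

/-- The observable `A_{q, r}⁽ʲ⁾` of Alice, for input `q` at position `j` and `r` elsewhere. -/
def obsAt (E : Experiment S A B) (j : Fin n) (q : Fin 5) (r : {i : Fin n // i ≠ j} → Fin 5) :
    A →L[ℂ] A :=
  E.obsA (insertAt j q r) j

/-- The observable `D_{z,x}⁽ʲ⁾`, from Bob's first question. -/
def Dzx (E : Experiment S A B) (j : Fin n) : B →L[ℂ] B := observable (E.bob 0) j
/-- The observable `E_{z,x}⁽ʲ⁾`, from Bob's second question. -/
def Ezx (E : Experiment S A B) (j : Fin n) : B →L[ℂ] B := observable (E.bob 1) j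
/-- The observable `D_{z,y}⁽ʲ⁾`, from Bob's third question. -/
def Dzy (E : Experiment S A B) (j : Fin n) : B →L[ℂ] B := observable (E.bob 2) j
/-- The observable `E_{z,y}⁽ʲ⁾`, from Bob's fourth question. -/
def Ezy (E : Experiment S A B) (j : Fin n) : B →L[ℂ] B := observable (E.bob 3) j
/-- The observable `D_{x,y}⁽ʲ⁾`, from Bob's fifth question. -/
def Dxy (E : Experiment S A B) (j : Fin n) : B →L[ℂ] B := observable (E.bob 4) j
/-- The observable `E_{x,y}⁽ʲ⁾`, from Bob's sixth question. -/
def Exy (E : Experiment S A B) (j : Fin n) : B →L[ℂ] B := observable (E.bob 5) j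

/-- The projection `Γ_b⁽ʲ⁾`. With positions counted from `0`, the even positions `j` (with
`j + 1 < n`) are read off from the answer to `◇`, and the odd ones from the answer to `◆`, in both
cases at entry `⌊j / 2⌋`. The outcomes `1, 2, 3, 4` are indexed from `0`. -/
def Γ (E : Experiment S A B) (j : Fin n) (hj : (j : ℕ) + 1 < n) (b : Fin 4) : B →L[ℂ] B :=
  if h : (j : ℕ) % 2 = 0 then marginal E.bobWhite ⟨(j : ℕ) / 2, by omega⟩ b
  else marginal E.bobBlack ⟨(j : ℕ) / 2, by omega⟩ b

/-- The expectation value `⟨ψ| X ⊗ Y |ψ⟩` (real for the Hermitian operators it is used with). -/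
def expect (E : Experiment S A B) (X : A →L[ℂ] A) (Y : B →L[ℂ] B) : ℝ :=
  (inner ℂ E.ψ (TensorProduct.map (X : A →ₗ[ℂ] A) (Y : B →ₗ[ℂ] B) E.ψ)).re

/-- The expectation value of the triple CHSH operator at position `j`, with inputs `r` for Alice
at the other positions. -/
def tripleCHSH (E : Experiment S A B) (j : Fin n) (r : {i : Fin n // i ≠ j} → Fin 5) : ℝ :=
  E.expect (E.obsAt j 2 r) (E.Dzx j + E.Ezx j) + E.expect (E.obsAt j 0 r) (E.Dzx j - E.Ezx j)
  + E.expect (E.obsAt j 2 r) (E.Dzy j + E.Ezy j) + E.expect (E.obsAt j 1 r) (E.Dzy j - E.Ezy j)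
  + E.expect (E.obsAt j 0 r) (E.Dxy j + E.Exy j) + E.expect (E.obsAt j 1 r) (E.Dxy j - E.Exy j)

/-- The question agreeing with `χ₀`, except for `q` at both positions `j` and `j + 1`. -/
def pairQuestion (χ₀ : Question n) (j : Fin n) (hj : (j : ℕ) + 1 < n) (q : Fin 5) : Question n :=
  Function.update (Function.update χ₀ j q) ⟨(j : ℕ) + 1, hj⟩ q

/-- All requested Bell inequalities and correlations are `ε`-approximately saturated, where the
conjugation correlations are requested for the fixed special question `χ₀`. -/
structure Saturated (E : Experiment S A B) (ε : ℝ≥0) (χ₀ : Question n) : Prop where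
  triple_chsh : ∀ j, ∀ r ∈ otherQuestions S j,
    6 * Real.sqrt 2 - ε / Real.sqrt 2 ≤ E.tripleCHSH j r
  perfect_xPlusY : ∀ χ ∈ S, ∀ j, 1 - (ε : ℝ) ≤ E.expect (E.obsAt j 3 (dropAt j χ)) (E.Dxy j)
  perfect_xMinusY : ∀ χ ∈ S, ∀ j, 1 - (ε : ℝ) ≤ E.expect (E.obsAt j 4 (dropAt j χ)) (E.Exy j)
  conjugation : ∀ (j : Fin n) (hj : (j : ℕ) + 1 < n) (q : Fin 5), q = 0 ∨ q = 1 ∨ q = 2 →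
    1 - (ε : ℝ) / 2 ≤ E.expect
      (E.obsA (pairQuestion χ₀ j hj q) j * E.obsA (pairQuestion χ₀ j hj q) ⟨(j : ℕ) + 1, hj⟩)
      (iversonSign (q = 1) • E.Γ j hj 0 + iversonSign (q = 0) • E.Γ j hj 1
        + iversonSign (q = 2) • E.Γ j hj 2 - E.Γ j hj 3)

/-- The probability that Alice answers `a` to the question `χ`. -/
def prob (E : Experiment S A B) (χ : Question n) (a : Signs n) : ℝ :=
  E.expect (E.alice χ a) 1

open scoped Classical in
/-- The probability that Alice's answer to the question `χ` has the property `p`. -/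
def probOf (E : Experiment S A B) (χ : Question n) (p : Signs n → Prop) : ℝ :=
  ∑ a with p a, E.prob χ a

variable [FiniteDimensional ℂ A] [FiniteDimensional ℂ B]

/-- The reduced state of Bob after Alice has been asked `χ` and has answered `a` (only meaningful
for answers of nonzero probability). -/
def ρB (E : Experiment S A B) (χ : Question n) (a : Signs n) : B →ₗ[ℂ] B :=
  partialTrace A B ((E.prob χ a : ℂ)⁻¹ •
    ketbra (TensorProduct.map (E.alice χ a : A →ₗ[ℂ] A) LinearMap.id E.ψ))

/-- The regularized observable of Bob for `σ_x`. -/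
def T₁ (E : Experiment S A B) (j : Fin n) : B →L[ℂ] B :=
  regularize (((Real.sqrt 2 : ℂ)⁻¹) • (E.Dxy j + E.Exy j))
/-- The regularized observable of Bob for `σ_y`. -/
def T₂ (E : Experiment S A B) (j : Fin n) : B →L[ℂ] B :=
  regularize (((Real.sqrt 2 : ℂ)⁻¹) • (E.Dxy j - E.Exy j))
/-- The regularized observable of Bob for `σ_z`. -/
def T₃ (E : Experiment S A B) (j : Fin n) : B →L[ℂ] B :=
  regularize (((Real.sqrt 2 : ℂ)⁻¹) • (E.Dzx j + E.Ezx j))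

/-- The component of `V_B = V_B⁽ⁿ⁾ ⋯ V_B⁽¹⁾` along `|s⟩ ⊗ |t⟩ ∈ B' ⊗ B''`. -/
def circuitComponent (E : Experiment S A B) (s t : Fin n → Fin 2) : Module.End ℂ B :=
  (List.ofFn fun j => (stageComponent (E.T₁ j) (E.T₂ j) (E.T₃ j) (s j) (t j) :
    Module.End ℂ B)).reverse.prod

/-- The map `V_B : B → B' ⊗ B'' ⊗ B`, constructed from Bob's observables only. -/
def VB (E : Experiment S A B) : B →ₗ[ℂ] BobSpace n B :=
  ∑ s, ∑ t, TensorProduct.mk ℂ (Qubits n) (Qubits n ⊗[ℂ] B) (ket s) ∘ₗ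
    TensorProduct.mk ℂ (Qubits n) B (ket t) ∘ₗ E.circuitComponent s t

end Experiment

/-- The state `|e⟩⟨e| ⊗ |0⟩⟨0| ⊗ β₀ + |e*⟩⟨e*| ⊗ |1⟩⟨1| ⊗ β₁`, where `|0⟩ = |0…0⟩` and
`|1⟩ = |1…1⟩`. -/
def idealState {n : ℕ} {B : Type v} [NormedAddCommGroup B] [InnerProductSpace ℂ B]
    (χ : Question n) (a : Signs n) (β₀ β₁ : B →ₗ[ℂ] B) :
    BobSpace n B →ₗ[ℂ] BobSpace n B :=
  TensorProduct.map (ketbra (idealKet χ a)) (TensorProduct.map (ketbra (ket fun _ => 0)) β₀)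
  + TensorProduct.map (ketbra (idealKetConj χ a))
      (TensorProduct.map (ketbra (ket fun _ => 1)) β₁)

end StatePrep

end

open scoped ComplexConjugate

universe w

noncomputable section

namespace StatePrep

/-! ### Ordered products in a noncommutative ring -/

section OrdProd

/-- The product `f 0 * f 1 * ⋯ * f (n - 1)` in a monoid. -/
def ordProd {R : Type*} [Monoid R] {n : ℕ} (f : Fin n → R) : R := (List.ofFn f).prod

variable {R : Type*}

@[simp] theorem ordProd_zero [Monoid R] (f : Fin 0 → R) : ordProd f = 1 := by simp [ordProd]

theorem ordProd_succ [Monoid R] {n : ℕ} (f : Fin (n + 1) → R) :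
    ordProd f = f 0 * ordProd fun j => f j.succ := by simp [ordProd, List.ofFn_succ]

theorem Commute.ordProd_right [Monoid R] {n : ℕ} {f : Fin n → R} {x : R}
    (h : ∀ j, Commute x (f j)) : Commute x (ordProd f) := by
  refine Commute.list_prod_right _ _ fun y hy => ?_
  obtain ⟨j, rfl⟩ := (List.mem_ofFn' _ _).1 hy
  exact h j

theorem reverse_prod_eq_ordProd [Monoid R] {n : ℕ} {f : Fin n → R}
    (h : ∀ i j, i ≠ j → Commute (f i) (f j)) : (List.ofFn f).reverse.prod = ordProd f := by
  refine ((List.reverse_perm _).symm.prod_eq' ?_).symm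
  rw [List.pairwise_ofFn]
  exact fun i j hij => h i j hij.ne

theorem ordProd_mul [Monoid R] {n : ℕ} {f g : Fin n → R}
    (h : ∀ i j, i ≠ j → Commute (f i) (g j)) :
    ordProd f * ordProd g = ordProd fun j => f j * g j := by
  induction n with
  | zero => simp
  | succ n ih =>
    have h0 : Commute (g 0) (ordProd fun j : Fin n => f j.succ) :=
      Commute.ordProd_right fun j => (h _ _ (Fin.succ_ne_zero j)).symm
    rw [ordProd_succ, ordProd_succ g, ordProd_succ, ← ih fun i j hij => h _ _ (by simpa using hij)]
    simp only [mul_assoc]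
    rw [← mul_assoc (ordProd _) (g 0), ← h0.eq, mul_assoc]

theorem ordProd_mul_of_smul [Ring R] [Algebra ℂ R] {n : ℕ} {f : Fin n → R} {x : R} {c : ℂ}
    (j : Fin n) (h : ∀ i, i ≠ j → Commute x (f i)) (hj : f j * x = c • f j) :
    ordProd f * x = c • ordProd f := by
  induction n with
  | zero => exact j.elim0
  | succ n ih =>
    rw [ordProd_succ]
    cases j using Fin.cases with
    | zero =>
      have h0 : Commute x (ordProd fun j : Fin n => f j.succ) :=
        Commute.ordProd_right fun i => h _ (Fin.succ_ne_zero i)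
      rw [mul_assoc, ← h0.eq, ← mul_assoc, hj, smul_mul_assoc]
    | succ j =>
      rw [mul_assoc, ih j (fun i hi => h _ (by simpa using hi)) hj, mul_smul_comm]

theorem ordProd_sum [Ring R] {κ : Type*} [Fintype κ] {n : ℕ} (f : Fin n → κ → R) :
    (ordProd fun j => ∑ s, f j s) = ∑ s : Fin n → κ, ordProd fun j => f j (s j) := by
  induction n with
  | zero => simp
  | succ n ih =>
    rw [ordProd_succ, ih, Finset.sum_mul_sum, ← Finset.sum_product',
      ← (Fin.consEquiv fun _ : Fin (n + 1) => κ).sum_comp]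
    simp [ordProd_succ, Fin.consEquiv]

theorem ordProd_smul [Ring R] [Algebra ℂ R] {n : ℕ} (c : Fin n → ℂ) (f : Fin n → R) :
    (ordProd fun j => c j • f j) = (∏ j, c j) • ordProd f := by
  induction n with
  | zero => simp
  | succ n ih =>
    rw [ordProd_succ, ih, ordProd_succ f, Fin.prod_univ_succ, smul_mul_smul_comm]

theorem map_ordProd {R' F : Type*} [Monoid R] [Monoid R'] [FunLike F R R'] [MonoidHomClass F R R']
    (φ : F) {n : ℕ} (f : Fin n → R) : φ (ordProd f) = ordProd fun j => φ (f j) := by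
  simp [ordProd, map_list_prod, List.map_ofFn, Function.comp_def]

theorem ordProd_eq_zero [Ring R] {n : ℕ} {f : Fin n → R} {i j : Fin n} (hij : i < j)
    (hc : ∀ a b, a ≠ b → Commute (f a) (f b)) (h : f i * f j = 0) : ordProd f = 0 := by
  induction n with
  | zero => exact i.elim0
  | succ n ih =>
    rw [ordProd_succ]
    obtain ⟨j, rfl⟩ := Fin.exists_succ_eq.2 (Fin.ne_zero_of_lt hij)
    cases i using Fin.cases with
    | succ i =>
      rw [ih (by simpa using hij) (fun a b hab => hc _ _ (by simpa using hab)) h, mul_zero]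
    | zero =>
      clear ih hij
      suffices H : ∀ (m : ℕ) (g : Fin m → R) (k : Fin m), (∀ l, Commute (f 0) (g l)) →
          f 0 * g k = 0 → f 0 * ordProd g = 0 from
        H _ _ j (fun l => hc _ _ (Fin.succ_ne_zero l).symm) h
      intro m g k hg hk
      induction m with
      | zero => exact k.elim0
      | succ m ihm =>
        rw [ordProd_succ]
        cases k using Fin.cases with
        | zero => rw [← mul_assoc, hk, zero_mul]
        | succ k =>
          rw [← mul_assoc, (hg 0).eq, mul_assoc, ihm _ k (fun l => hg _) hk, mul_zero]

end OrdProd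

/-! ### The circuit in an abstract algebra -/

section Circuit

variable {R : Type*} [Ring R] [Algebra ℂ R]

/-- The operator extracting the computational basis state `|s⟩` after the swap stage. -/
def swapElt (T : Fin 3 → R) (s : Fin 2) : R :=
  if s = 0 then (1 / 2 : ℂ) • (1 + Complex.I • (T 1 * T 0))
  else T 0 * ((1 / 2 : ℂ) • (1 - Complex.I • (T 1 * T 0)))

/-- The operator extracting the state `|t⟩` after the phase kickback stage. -/
def kickElt (T : Fin 3 → R) (t : Fin 2) : R := (1 / 2 : ℂ) • (1 + (-1 : ℂ) ^ (t : ℕ) • T 2)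

/-- The operator extracting `|s⟩ ⊗ |t⟩` after both stages. -/
def stageElt (T : Fin 3 → R) (s t : Fin 2) : R := kickElt T t * swapElt T s

/-- The operator extracting `|s⟩ ⊗ |t⟩` after the circuit on `n` positions. -/
def circuitElt {n : ℕ} (T : Fin n → Fin 3 → R) (s t : Fin n → Fin 2) : R :=
  (List.ofFn fun j => stageElt (T j) (s j) (t j)).reverse.prod

/-- The combination of the three Pauli operators which gives `σ_q`. -/
def sigmaElt (T : Fin 3 → R) (q : Fin 5) : R :=
  ![T 0, T 1, T 2, ((Real.sqrt 2 : ℂ)⁻¹) • (T 0 + T 1), ((Real.sqrt 2 : ℂ)⁻¹) • (T 0 - T 1)] q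

section Map

variable {R' : Type*} [Ring R'] [Algebra ℂ R'] (φ : R →ₐ[ℂ] R')

theorem map_stageElt (T : Fin 3 → R) (s t : Fin 2) :
    φ (stageElt T s t) = stageElt (fun p => φ (T p)) s t := by
  unfold stageElt swapElt kickElt
  split_ifs <;> simp [map_smul]

theorem map_circuitElt {n : ℕ} (T : Fin n → Fin 3 → R) (s t : Fin n → Fin 2) :
    φ (circuitElt T s t) = circuitElt (fun j p => φ (T j p)) s t := by
  simp [circuitElt, map_list_prod, ← map_stageElt, List.map_ofFn, Function.comp_def]

theorem map_sigmaElt (T : Fin 3 → R) (q : Fin 5) :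
    φ (sigmaElt T q) = sigmaElt (fun p => φ (T p)) q := by
  fin_cases q <;> simp [sigmaElt, map_smul]

end Map

/-- The relations of the three Pauli operators, up to complex conjugation. -/
structure PauliTriple (T : Fin 3 → R) : Prop where
  sq : ∀ p, T p * T p = 1
  anti : ∀ p q, p ≠ q → T p * T q = -(T q * T p)

/-- The operator `i σ_y σ_x`, which plays the role of `σ_z` on the swapped qubit. -/
def uElt (T : Fin 3 → R) : R := Complex.I • (T 1 * T 0)

/-- The central operator which indicates complex conjugation. -/
def fElt (T : Fin 3 → R) : R := uElt T * T 2

namespace PauliTriple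

variable {T : Fin 3 → R} (hT : PauliTriple T)
include hT

omit [Algebra ℂ R] in
theorem mul_mul_self (p : Fin 3) (x : R) : T p * (T p * x) = x := by
  rw [← mul_assoc, hT.sq, one_mul]

omit [Algebra ℂ R] in
theorem mul_mul_anti {p q : Fin 3} (h : p ≠ q) (x : R) : T p * (T q * x) = -(T q * (T p * x)) := by
  rw [← mul_assoc, hT.anti p q h, neg_mul, mul_assoc]

theorem uElt_mul_uElt : uElt T * uElt T = 1 := by
  simp only [uElt, smul_mul_smul_comm, Complex.I_mul_I, mul_assoc]
  rw [hT.mul_mul_anti (show (0 : Fin 3) ≠ 1 by decide), hT.sq, mul_neg, hT.mul_mul_self]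
  simp

theorem uElt_mul_zero : uElt T * T 0 = -(T 0 * uElt T) := by
  simp only [uElt, smul_mul_assoc, mul_smul_comm, mul_assoc, ← smul_neg]
  rw [hT.mul_mul_anti (show (0 : Fin 3) ≠ 1 by decide), neg_neg]

theorem uElt_mul_one : uElt T * T 1 = -(T 1 * uElt T) := by
  simp only [uElt, smul_mul_assoc, mul_smul_comm, mul_assoc, ← smul_neg]
  rw [hT.anti 0 1 (by decide), mul_neg]

theorem uElt_mul_two : uElt T * T 2 = T 2 * uElt T := by
  simp only [uElt, smul_mul_assoc, mul_smul_comm, mul_assoc]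
  rw [hT.anti 0 2 (by decide), mul_neg, hT.mul_mul_anti (show (1 : Fin 3) ≠ 2 by decide), neg_neg]

theorem commute_fElt (p : Fin 3) : Commute (fElt T) (T p) := by
  change uElt T * T 2 * T p = T p * (uElt T * T 2)
  fin_cases p <;> simp only [Fin.zero_eta, Fin.mk_one, Fin.reduceFinMk]
  · rw [mul_assoc, hT.anti 2 0 (by decide), mul_neg, ← mul_assoc, hT.uElt_mul_zero, neg_mul,
      neg_neg, mul_assoc]
  · rw [mul_assoc, hT.anti 2 1 (by decide), mul_neg, ← mul_assoc, hT.uElt_mul_one, neg_mul,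
      neg_neg, mul_assoc]
  · rw [hT.uElt_mul_two, mul_assoc, hT.uElt_mul_two]

theorem commute_fElt_uElt : Commute (fElt T) (uElt T) :=
  ((hT.commute_fElt 1).mul_right (hT.commute_fElt 0)).smul_right _

theorem fElt_mul_fElt : fElt T * fElt T = 1 := by
  nth_rw 2 [fElt]
  rw [← mul_assoc, (hT.commute_fElt_uElt).eq, fElt, ← mul_assoc, hT.uElt_mul_uElt, one_mul, hT.sq]

theorem fElt_mul_uElt : fElt T * uElt T = T 2 := by
  rw [(hT.commute_fElt_uElt).eq, fElt, ← mul_assoc, hT.uElt_mul_uElt, one_mul]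

end PauliTriple

/-- The projector onto the eigenspace of `i σ_y σ_x` with eigenvalue `1`. -/
def projElt (T : Fin 3 → R) : R := (1 / 2 : ℂ) • (1 + uElt T)

/-- The projector onto an eigenspace of the conjugation indicator `f`. -/
def flagElt (f : R) (t : Fin 2) : R := (1 / 2 : ℂ) • (1 + (-1 : ℂ) ^ (t : ℕ) • f)

theorem flagElt_mul {f : R} (hf : f * f = 1) (t : Fin 2) :
    flagElt f t * f = (-1 : ℂ) ^ (t : ℕ) • flagElt f t := by
  fin_cases t <;> simp [flagElt, add_mul, hf, add_comm, smul_add]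

theorem flagElt_mul_flagElt {f : R} (hf : f * f = 1) (t t' : Fin 2) (h : t ≠ t') :
    flagElt f t * flagElt f t' = 0 := by
  nth_rw 2 [flagElt]
  rw [mul_smul_comm, mul_add, mul_smul_comm, flagElt_mul hf, smul_smul]
  have : (-1 : ℂ) ^ (t' : ℕ) * (-1) ^ (t : ℕ) = -1 := by
    fin_cases t <;> fin_cases t' <;> simp at h ⊢
  rw [this]; simp

namespace PauliTriple

variable {T : Fin 3 → R} (hT : PauliTriple T)
include hT

theorem projElt_mul_uElt : projElt T * uElt T = projElt T := by
  rw [projElt, smul_mul_assoc, add_mul, one_mul, hT.uElt_mul_uElt, add_comm]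

theorem two_mul_projElt : T 2 * projElt T = fElt T * projElt T := by
  have h : T 2 * uElt T = fElt T := by rw [← hT.uElt_mul_two, fElt]
  rw [projElt, mul_smul_comm, mul_smul_comm, mul_add, mul_add, hT.fElt_mul_uElt, h, mul_one,
    mul_one, add_comm]

theorem swapElt_eq (s : Fin 2) : swapElt T s = projElt T * T 0 ^ (s : ℕ) := by
  fin_cases s
  · simp [swapElt, projElt, uElt]
  · have h : T 0 * uElt T = -(uElt T * T 0) := by rw [hT.uElt_mul_zero, neg_neg]
    change T 0 * ((1 / 2 : ℂ) • (1 - uElt T)) = (1 / 2 : ℂ) • (1 + uElt T) * T 0 ^ 1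
    rw [mul_smul_comm, smul_mul_assoc, mul_sub, add_mul, h, pow_one, mul_one, one_mul, sub_neg_eq_add]

theorem stageElt_eq (s t : Fin 2) :
    stageElt T s t = flagElt (fElt T) t * (projElt T * T 0 ^ (s : ℕ)) := by
  rw [stageElt, hT.swapElt_eq, kickElt, flagElt, ← mul_assoc, ← mul_assoc]
  congr 1
  rw [smul_mul_assoc, smul_mul_assoc, add_mul, add_mul, smul_mul_assoc, smul_mul_assoc,
    hT.two_mul_projElt]

theorem commute_flagElt (t : Fin 2) (p : Fin 3) : Commute (flagElt (fElt T) t) (T p) :=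
  ((Commute.one_left _).add_left ((hT.commute_fElt p).smul_left _)).smul_left _

theorem zero_pow_mul_uElt (s : Fin 2) :
    T 0 ^ (s : ℕ) * uElt T = (-1 : ℂ) ^ (s : ℕ) • (uElt T * T 0 ^ (s : ℕ)) := by
  fin_cases s
  · simp
  · simp [hT.uElt_mul_zero]

theorem stageElt_mul_uElt (s t : Fin 2) :
    stageElt T s t * uElt T = (-1 : ℂ) ^ (s : ℕ) • stageElt T s t := by
  rw [hT.stageElt_eq, mul_assoc, mul_assoc, hT.zero_pow_mul_uElt, mul_smul_comm, mul_smul_comm,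
    ← mul_assoc (projElt T), hT.projElt_mul_uElt]

theorem stageElt_mul_fElt (s t : Fin 2) :
    stageElt T s t * fElt T = (-1 : ℂ) ^ (t : ℕ) • stageElt T s t := by
  have h : Commute (projElt T * T 0 ^ (s : ℕ)) (fElt T) :=
    (((Commute.one_left _).add_left hT.commute_fElt_uElt.symm).smul_left _).mul_left
      ((hT.commute_fElt 0).symm.pow_left _)
  rw [hT.stageElt_eq, mul_assoc, h.eq, ← mul_assoc, flagElt_mul hT.fElt_mul_fElt, smul_mul_assoc]

theorem stageElt_mul_two (s t : Fin 2) :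
    stageElt T s t * T 2 = (-1 : ℂ) ^ ((s : ℕ) + t) • stageElt T s t := by
  rw [← hT.fElt_mul_uElt, ← mul_assoc, hT.stageElt_mul_fElt, smul_mul_assoc, hT.stageElt_mul_uElt,
    smul_smul, ← pow_add, add_comm]

theorem stageElt_eq_mul_pow (s t : Fin 2) :
    stageElt T s t = stageElt T 0 t * T 0 ^ (s : ℕ) := by
  rw [hT.stageElt_eq, hT.stageElt_eq]; simp [mul_assoc]

theorem stageElt_mul_zero (s t : Fin 2) : stageElt T s t * T 0 = stageElt T (1 - s) t := by
  fin_cases s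
  · simp [hT.stageElt_eq, mul_assoc]
  · simp [hT.stageElt_eq, mul_assoc, hT.sq]

theorem stageElt_mul_one (t : Fin 2) :
    stageElt T 0 t * T 1 = (-Complex.I) • stageElt T 1 t := by
  have h : uElt T * T 1 = (-Complex.I) • T 0 := by
    rw [uElt, smul_mul_assoc, mul_assoc, hT.anti 0 1 (by decide), mul_neg, hT.mul_mul_self]
    simp
  nth_rw 1 [hT.stageElt_eq]
  rw [← hT.projElt_mul_uElt]
  simp only [Fin.val_zero, pow_zero, mul_one, mul_assoc, h]
  simp [hT.stageElt_eq]

end PauliTriple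
end Circuit

section Circuit

variable {R : Type*} [Ring R] [Algebra ℂ R]

/-! ### Phases of the eigenvectors -/

/-- The relative phase `e^{iθ}` of the two components of `|σ_q^+⟩`. -/
def phase (q : Fin 5) : ℂ := Complex.exp (Complex.I * (angle q : ℂ))

theorem phase_zero : phase 0 = 1 := by simp [phase, angle]

theorem phase_one : phase 1 = Complex.I := by
  rw [phase, mul_comm, Complex.exp_mul_I, ← Complex.ofReal_cos, ← Complex.ofReal_sin]
  simp [angle]

theorem phase_three : phase 3 = (Real.sqrt 2 : ℂ)⁻¹ * (1 + Complex.I) := by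
  have h : (Real.sqrt 2 : ℝ) / 2 = (Real.sqrt 2)⁻¹ := by rw [Real.sqrt_div_self', one_div]
  rw [phase, mul_comm, Complex.exp_mul_I, ← Complex.ofReal_cos, ← Complex.ofReal_sin]
  simp only [angle, Matrix.cons_val, Real.cos_pi_div_four, Real.sin_pi_div_four, h]
  push_cast; ring

theorem phase_four : phase 4 = (Real.sqrt 2 : ℂ)⁻¹ * (1 - Complex.I) := by
  have h : (Real.sqrt 2 : ℝ) / 2 = (Real.sqrt 2)⁻¹ := by rw [Real.sqrt_div_self', one_div]
  rw [phase, mul_comm, Complex.exp_mul_I, ← Complex.ofReal_cos, ← Complex.ofReal_sin]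
  simp only [angle, Matrix.cons_val, Real.cos_pi_div_four, Real.sin_pi_div_four, h, Real.cos_neg,
    Real.sin_neg]
  push_cast; ring

theorem phase_mul_conj (q : Fin 5) : phase q * conj (phase q) = 1 := by
  rw [Complex.mul_conj, Complex.normSq_eq_norm_sq, phase, mul_comm, Complex.norm_exp_ofReal_mul_I]
  simp

theorem inv_sqrt_two_mul_self : (Real.sqrt 2 : ℂ)⁻¹ * (Real.sqrt 2 : ℂ)⁻¹ = 1 / 2 := by
  rw [← mul_inv, ← Complex.ofReal_mul, Real.mul_self_sqrt (by norm_num)]; norm_num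

/-- The vector `|σ_q^a⟩` for `t = 0`, and its complex conjugate with respect to which `σ_z` changes
its sign for `t = 1`. -/
def flagSigmaKet (t : Fin 2) (q : Fin 5) (a : ℤˣ) : Fin 2 → ℂ :=
  sigmaKet q (if t = 1 ∧ q = 2 then -a else a)

/-- The projector `(1 + a σ_q) / 2`. -/
def sigmaProj (T : Fin 3 → R) (q : Fin 5) (a : ℤˣ) : R :=
  (1 / 2 : ℂ) • (1 + ((a : ℤ) : ℂ) • sigmaElt T q)

theorem map_sigmaProj {R' : Type*} [Ring R'] [Algebra ℂ R'] (φ : R →ₐ[ℂ] R') (T : Fin 3 → R)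
    (q : Fin 5) (a : ℤˣ) : φ (sigmaProj T q a) = sigmaProj (fun p => φ (T p)) q a := by
  simp [sigmaProj, map_smul, map_sigmaElt]

namespace PauliTriple

variable {T : Fin 3 → R} (hT : PauliTriple T)
include hT

theorem sigmaElt_mul_self (q : Fin 5) : sigmaElt T q * sigmaElt T q = 1 := by
  have h := hT.anti 0 1 (by decide)
  have h2 : ((1 / 2 : ℂ)) • (2 : R) = 1 := by
    rw [show (2 : R) = (2 : ℂ) • (1 : R) by rw [two_smul, one_add_one_eq_two], smul_smul]; norm_num
  fin_cases q <;> simp only [sigmaElt, Fin.zero_eta, Fin.mk_one, Fin.reduceFinMk, Matrix.cons_val]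
  · exact hT.sq _
  · exact hT.sq _
  · exact hT.sq _
  · rw [smul_mul_smul_comm, inv_sqrt_two_mul_self, add_mul, mul_add, mul_add, hT.sq, hT.sq, h]
    refine Eq.trans ?_ h2
    congr 1
    refine Eq.trans ?_ one_add_one_eq_two; abel
  · rw [smul_mul_smul_comm, inv_sqrt_two_mul_self, sub_mul, mul_sub, mul_sub, hT.sq, hT.sq, h]
    refine Eq.trans ?_ h2
    congr 1
    refine Eq.trans ?_ one_add_one_eq_two; abel

theorem stageElt_zero_mul_sigmaElt (t : Fin 2) {q : Fin 5} (hq : q ≠ 2) :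
    stageElt T 0 t * sigmaElt T q = conj (phase q) • stageElt T 1 t := by
  have h0 : stageElt T 0 t * T 0 = stageElt T 1 t := hT.stageElt_mul_zero 0 t
  have h1 := hT.stageElt_mul_one t
  fin_cases q <;> simp only [sigmaElt, Fin.zero_eta, Fin.mk_one, Fin.reduceFinMk, Matrix.cons_val]
  · simp [phase_zero, h0]
  · simp [phase_one, h1]
  · exact absurd rfl hq
  · rw [phase_three, mul_smul_comm, mul_add, h0, h1, show stageElt T 1 t + (-Complex.I) • stageElt T 1 t
      = (1 - Complex.I) • stageElt T 1 t by rw [sub_smul, one_smul, neg_smul, sub_eq_add_neg], smul_smul]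
    congr 1
    simp [sub_eq_add_neg]
  · rw [phase_four, mul_smul_comm, mul_sub, h0, h1, show stageElt T 1 t - (-Complex.I) • stageElt T 1 t
      = (1 + Complex.I) • stageElt T 1 t by rw [add_smul, one_smul, neg_smul, sub_neg_eq_add], smul_smul]
    congr 1
    simp

theorem stageElt_one_mul_sigmaElt (t : Fin 2) {q : Fin 5} (hq : q ≠ 2) :
    stageElt T 1 t * sigmaElt T q = phase q • stageElt T 0 t := by
  have h := congrArg (fun x => phase q • (x * sigmaElt T q)) (hT.stageElt_zero_mul_sigmaElt t hq)
  simp only [mul_assoc, hT.sigmaElt_mul_self, mul_one, smul_mul_assoc, smul_smul,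
    phase_mul_conj, one_smul] at h
  exact h.symm

theorem stageElt_mul_sigmaProj (s t : Fin 2) (q : Fin 5) (a : ℤˣ) :
    stageElt T s t * sigmaProj T q a =
      ∑ s', (flagSigmaKet t q a s * conj (flagSigmaKet t q a s')) • stageElt T s' t := by
  have ha : ((a : ℤ) : ℂ) * ((a : ℤ) : ℂ) = 1 := by
    rcases Int.units_eq_one_or a with rfl | rfl <;> simp
  rw [Fin.sum_univ_two, sigmaProj, mul_smul_comm, mul_add, mul_smul_comm, mul_one]
  by_cases hq : q = 2
  · subst hq
    have h2 : sigmaElt T 2 = T 2 := rfl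
    rw [h2, hT.stageElt_mul_two, smul_smul]
    rcases Int.units_eq_one_or a with rfl | rfl <;> fin_cases s <;> fin_cases t <;>
      simp [flagSigmaKet, sigmaKet, ← two_smul ℂ, smul_smul]
  · have hk : flagSigmaKet t q a = ![(Real.sqrt 2 : ℂ)⁻¹,
        (Real.sqrt 2 : ℂ)⁻¹ * ((a : ℤ) : ℂ) * phase q] := by
      simp [flagSigmaKet, sigmaKet, hq, phase]
    have hc : conj ((Real.sqrt 2 : ℂ)⁻¹) = (Real.sqrt 2 : ℂ)⁻¹ := by
      rw [map_inv₀, Complex.conj_ofReal]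
    have hca : conj ((a : ℤ) : ℂ) = ((a : ℤ) : ℂ) := by simp
    have hi := inv_sqrt_two_mul_self
    have hp := phase_mul_conj q
    fin_cases s
    · simp only [Fin.zero_eta, hT.stageElt_zero_mul_sigmaElt t hq, hk, Matrix.cons_val, map_mul, hc, hca,
        smul_add, smul_smul]
      congr 2
      · exact hi.symm
      · linear_combination (-((a : ℤ) : ℂ) * conj (phase q)) * hi
    · simp only [Fin.mk_one, hT.stageElt_one_mul_sigmaElt t hq, hk, Matrix.cons_val, map_mul, hc, hca,
        smul_add, smul_smul]
      rw [add_comm]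
      congr 2
      · linear_combination (-((a : ℤ) : ℂ) * phase q) * hi
      · linear_combination (-((a : ℤ) : ℂ) * (a : ℤ) * phase q * conj (phase q)) * hi
          - 1 / 2 * ha - (1 / 2) * ((a : ℤ) : ℂ) * (a : ℤ) * hp

end PauliTriple

theorem commute_stageElt {T : Fin 3 → R} {x : R} (hx : ∀ p, Commute x (T p))
    (s t : Fin 2) : Commute x (stageElt (T) s t) := by
  have hu : Commute x (Complex.I • (T 1 * T 0)) := ((hx 1).mul_right (hx 0)).smul_right _
  refine Commute.mul_right ?_ ?_
  · exact ((Commute.one_right x).add_right ((hx 2).smul_right _)).smul_right _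
  · unfold swapElt
    split_ifs
    · exact ((Commute.one_right x).add_right hu).smul_right _
    · exact (hx 0).mul_right (((Commute.one_right x).sub_right hu).smul_right _)

/-! ### The relations for all positions -/

/-- Pauli relations for each of `n` commuting systems, all of them conjugated or none. -/
structure PauliRel {n : ℕ} (T : Fin n → Fin 3 → R) : Prop where
  triple : ∀ j, PauliTriple (T j)
  comm : ∀ i j, i ≠ j → ∀ p q, Commute (T i p) (T j q)
  conj_eq : ∀ (j : Fin n) (hj : (j : ℕ) + 1 < n),
    T ⟨j + 1, hj⟩ 0 * T j 0 * (T ⟨j + 1, hj⟩ 1 * T j 1) * (T ⟨j + 1, hj⟩ 2 * T j 2) = -1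

namespace PauliRel

variable {n : ℕ} {T : Fin n → Fin 3 → R} (hT : PauliRel T)
include hT

theorem fElt_succ (j : Fin n) (hj : (j : ℕ) + 1 < n) : fElt (T ⟨j + 1, hj⟩) = fElt (T j) := by
  set k : Fin n := ⟨j + 1, hj⟩
  have hkj : k ≠ j := by simp [k, Fin.ext_iff]
  have h := hT.conj_eq j hj
  change T k 0 * T j 0 * (T k 1 * T j 1) * (T k 2 * T j 2) = -1 at h
  have hf : ∀ i, T i 0 * T i 1 * T i 2 = Complex.I • fElt (T i) := by
    intro i
    rw [fElt, uElt, smul_mul_assoc, smul_smul, Complex.I_mul_I, (hT.triple i).anti 0 1 (by decide)]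
    simp
  have h' : T k 0 * T j 0 * (T k 1 * T j 1) * (T k 2 * T j 2)
      = (T k 0 * T k 1 * T k 2) * (T j 0 * T j 1 * T j 2) := by
    have c1 := (hT.comm k j hkj 1 0).eq
    have c2 := (hT.comm k j hkj 2 0).eq
    have c3 := (hT.comm k j hkj 2 1).eq
    simp only [mul_assoc]
    rw [← mul_assoc (T j 0) (T k 1), ← c1, ← mul_assoc (T j 1) (T k 2), ← c3]
    simp only [mul_assoc]
    rw [← mul_assoc (T j 0) (T k 2), ← c2]
    simp only [mul_assoc]
  rw [h', hf, hf, smul_mul_smul_comm, Complex.I_mul_I, neg_one_smul, neg_inj] at h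
  calc fElt (T k) = fElt (T k) * (fElt (T j) * fElt (T j)) := by
        rw [(hT.triple j).fElt_mul_fElt, mul_one]
    _ = fElt (T j) := by rw [← mul_assoc, h, one_mul]

theorem fElt_eq (i j : Fin n) : fElt (T i) = fElt (T j) := by
  have h : ∀ m (hm : m < n), fElt (T ⟨m, hm⟩) = fElt (T ⟨0, by omega⟩) := by
    intro m
    induction m with
    | zero => intro _; rfl
    | succ m ih => intro hm; rw [← ih (by omega), ← hT.fElt_succ ⟨m, by omega⟩ hm]
  rw [h i i.2, h j j.2]

theorem commute_stageElt_stageElt {i j : Fin n} (hij : i ≠ j) (s t s' t' : Fin 2) :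
    Commute (stageElt (T i) s t) (stageElt (T j) s' t') :=
  commute_stageElt (fun q => (commute_stageElt (fun p => hT.comm _ _ hij.symm q p) _ _).symm) _ _

theorem circuitElt_eq (s t : Fin n → Fin 2) :
    circuitElt T s t = ordProd fun j => stageElt (T j) (s j) (t j) :=
  reverse_prod_eq_ordProd fun _ _ hij => hT.commute_stageElt_stageElt hij _ _ _ _

theorem circuitElt_eq_zero {s t : Fin n → Fin 2} {i j : Fin n} (hij : t i ≠ t j) :
    circuitElt T s t = 0 := by
  have key : ∀ i j : Fin n, i < j → t i ≠ t j → circuitElt T s t = 0 := by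
    intro i j hlt h
    rw [hT.circuitElt_eq]
    refine ordProd_eq_zero hlt (fun a b hab => hT.commute_stageElt_stageElt hab _ _ _ _) ?_
    have hc : Commute (projElt (T i) * T i 0 ^ (s i : ℕ)) (flagElt (fElt (T j)) (t j)) := by
      have hz : ∀ p, Commute (flagElt (fElt (T j)) (t j)) (T i p) := fun p => by
        rw [hT.fElt_eq j i]; exact (hT.triple i).commute_flagElt _ _
      refine (Commute.mul_right ?_ ((hz 0).pow_right _)).symm
      exact ((Commute.one_right _).add_right (((hz 1).mul_right (hz 0)).smul_right _)).smul_right _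
    rw [(hT.triple i).stageElt_eq, (hT.triple j).stageElt_eq, mul_assoc, ← mul_assoc _ (flagElt _ _),
      hc.eq, mul_assoc, ← mul_assoc, hT.fElt_eq i j,
      flagElt_mul_flagElt (hT.triple j).fElt_mul_fElt _ _ h, zero_mul]
  rcases lt_trichotomy i j with h | h | h
  · exact key i j h hij
  · exact absurd (h ▸ rfl) hij
  · exact key j i h hij.symm

theorem circuitElt_eq_mul_pow (s t : Fin n → Fin 2) :
    circuitElt T s t = circuitElt T 0 t * ordProd fun j => T j 0 ^ (s j : ℕ) := by
  rw [hT.circuitElt_eq, hT.circuitElt_eq, ordProd_mul]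
  · congr 1; funext j
    exact (hT.triple j).stageElt_eq_mul_pow _ _
  · exact fun i j hij =>
      (commute_stageElt (fun p => ((hT.comm j i hij.symm 0 p).pow_left _)) _ _).symm

theorem circuitElt_mul_uElt (s t : Fin n → Fin 2) (j : Fin n) :
    circuitElt T s t * uElt (T j) = (-1 : ℂ) ^ (s j : ℕ) • circuitElt T s t := by
  rw [hT.circuitElt_eq]
  refine ordProd_mul_of_smul j (fun i hij => ?_) ((hT.triple j).stageElt_mul_uElt _ _)
  refine commute_stageElt (fun p => ?_) _ _
  exact ((hT.comm j i hij.symm 1 p).mul_left (hT.comm j i hij.symm 0 p)).smul_left _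

theorem circuitElt_mul_two (s t : Fin n → Fin 2) (j : Fin n) :
    circuitElt T s t * T j 2 = (-1 : ℂ) ^ ((s j : ℕ) + t j) • circuitElt T s t := by
  rw [hT.circuitElt_eq]
  refine ordProd_mul_of_smul j (fun i hij => ?_) ((hT.triple j).stageElt_mul_two _ _)
  exact commute_stageElt (fun p => hT.comm j i hij.symm 2 p) _ _

theorem circuitElt_mul_sigmaProj (s t : Fin n → Fin 2) (χ : Question n) (a : Signs n) :
    circuitElt T s t * (ordProd fun j => sigmaProj (T j) (χ j) (a j)) =
      ∑ s' : Fin n → Fin 2, (∏ j, (flagSigmaKet (t j) (χ j) (a j) (s j) *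
        conj (flagSigmaKet (t j) (χ j) (a j) (s' j)))) • circuitElt T s' t := by
  rw [hT.circuitElt_eq, ordProd_mul]
  · simp_rw [(hT.triple _).stageElt_mul_sigmaProj, ordProd_sum, ordProd_smul, hT.circuitElt_eq]
  · refine fun i j hij => (commute_stageElt (fun p => ?_) _ _).symm
    have h : ∀ r, Commute (T j r) (T i p) := fun r => hT.comm j i hij.symm r p
    have hs : Commute (sigmaElt (T j) (χ j)) (T i p) := by
      generalize χ j = q
      fin_cases q
      · exact h 0
      · exact h 1
      · exact h 2
      · exact ((h 0).add_left (h 1)).smul_left _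
      · exact ((h 0).sub_left (h 1)).smul_left _
    exact ((Commute.one_left _).add_left (hs.smul_left _)).smul_left _

end PauliRel

end Circuit

/-- The product `f (n - 1) * ⋯ * f 1 * f 0` in a monoid. -/
def revProd {R : Type*} [Monoid R] {n : ℕ} (f : Fin n → R) : R := (List.ofFn f).reverse.prod

theorem revProd_succ {R : Type*} [Monoid R] {n : ℕ} (f : Fin (n + 1) → R) :
    revProd f = (revProd fun j => f j.succ) * f 0 := by simp [revProd, List.ofFn_succ]

/-- A vector together with operators `t` which approximately satisfy the Pauli relations on it, and
operators `a` and `b` of a second party whose actions on the vector approximate those of `t` and of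
the combination of `t` given by the question `χ`. -/
structure PauliModel (n : ℕ) (χ : Question n) where
  H : Type w
  [instNormedAddCommGroup : NormedAddCommGroup H]
  [instNormedSpace : NormedSpace ℂ H]
  ψ : H
  δ : ℝ
  δ_nonneg : 0 ≤ δ
  t : Fin n → Fin 3 → H →L[ℂ] H
  a : Fin n → Fin 3 → H →L[ℂ] H
  b : Fin n → H →L[ℂ] H
  norm_t_le : ∀ j p, ‖t j p‖ ≤ 1
  norm_a_le : ∀ j p, ‖a j p‖ ≤ 1
  norm_b_le : ∀ j, ‖b j‖ ≤ 1
  commute_a : ∀ j p k q, Commute (t j p) (a k q)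
  commute_b : ∀ j p k, Commute (t j p) (b k)
  t_mul_self : ∀ j p, t j p * t j p = 1
  near_a : ∀ j p, ‖a j p ψ - t j p ψ‖ ≤ δ
  near_b : ∀ j, ‖b j ψ - sigmaElt (t j) (χ j) ψ‖ ≤ δ
  anti : ∀ j p q, p ≠ q → ‖(t j p * t j q + t j q * t j p) ψ‖ ≤ δ
  comm : ∀ i j, i ≠ j → ∀ p q, ‖(t i p * t j q - t j q * t i p) ψ‖ ≤ δ
  conj_le : ∀ (j : Fin n) (hj : (j : ℕ) + 1 < n),
    ‖(t ⟨j + 1, hj⟩ 0 * t j 0 * (t ⟨j + 1, hj⟩ 1 * t j 1) * (t ⟨j + 1, hj⟩ 2 * t j 2) + 1) ψ‖ ≤ δ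

attribute [instance] PauliModel.instNormedAddCommGroup PauliModel.instNormedSpace

namespace PauliModel

variable {n : ℕ} {χ : Question n}

theorem exists_uniform {X M : Type*} [Finite X] {δ : M → ℝ} (hδ : ∀ m, 0 ≤ δ m) {f : X → M → ℝ}
    (h : ∀ x, ∃ C, ∀ m, f x m ≤ C * δ m) : ∃ C, ∀ x m, f x m ≤ C * δ m := by
  choose C hC using h
  obtain ⟨K, hK⟩ := (Set.finite_range C).bddAbove
  exact ⟨K, fun x m => (hC x m).trans
    (mul_le_mul_of_nonneg_right (hK ⟨x, rfl⟩) (hδ m))⟩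

/-- Noncommutative polynomials in the operators `t`. -/
abbrev Word (n : ℕ) : Type := FreeAlgebra ℂ (Fin n × Fin 3)

/-- The generator for the operator `t j p`. -/
def gen (j : Fin n) (p : Fin 3) : Word n := FreeAlgebra.ι ℂ (j, p)

/-- The evaluation of noncommutative polynomials at the operators `t`. -/
def rep (m : PauliModel n χ) : Word n →ₐ[ℂ] m.H →L[ℂ] m.H :=
  FreeAlgebra.lift ℂ fun x => m.t x.1 x.2

@[simp] theorem rep_gen (m : PauliModel n χ) (j : Fin n) (p : Fin 3) :
    m.rep (gen j p) = m.t j p := by simp [rep, gen]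

theorem exists_norm_rep_le (x : Word n) :
    ∃ C, 0 ≤ C ∧ ∀ m : PauliModel.{w} n χ, ‖m.rep x‖ ≤ C := by
  induction x using FreeAlgebra.induction with
  | grade0 r =>
    refine ⟨‖r‖, norm_nonneg _, fun m => ?_⟩
    rw [AlgHom.commutes, Algebra.algebraMap_eq_smul_one, norm_smul]
    exact mul_le_of_le_one_right (norm_nonneg _) ContinuousLinearMap.norm_id_le
  | grade1 x =>
    exact ⟨1, zero_le_one, fun m => by simpa [rep] using m.norm_t_le x.1 x.2⟩
  | mul x y hx hy =>
    obtain ⟨C, hC, hx⟩ := hx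
    obtain ⟨D, hD, hy⟩ := hy
    refine ⟨C * D, mul_nonneg hC hD, fun m => ?_⟩
    rw [map_mul]
    exact (norm_mul_le _ _).trans (mul_le_mul (hx m) (hy m) (norm_nonneg _) hC)
  | add x y hx hy =>
    obtain ⟨C, hC, hx⟩ := hx
    obtain ⟨D, hD, hy⟩ := hy
    refine ⟨C + D, add_nonneg hC hD, fun m => ?_⟩
    rw [map_add]
    exact (norm_add_le _ _).trans (add_le_add (hx m) (hy m))

theorem commute_rep (m : PauliModel n χ) {z : m.H →L[ℂ] m.H} (hz : ∀ j p, Commute (m.t j p) z)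
    (x : Word n) : Commute (m.rep x) z := by
  induction x using FreeAlgebra.induction with
  | grade0 r => rw [AlgHom.commutes]; exact Algebra.commutes r z
  | grade1 x => simpa [rep] using hz x.1 x.2
  | mul x y hx hy => rw [map_mul]; exact hx.mul_left hy
  | add x y hx hy => rw [map_add]; exact hx.add_left hy

/-- The polynomial `x` annihilates the vector `ψ` of all models up to an error of order `δ`. -/
def Small (χ : Question n) (x : Word n) : Prop :=
  ∃ C, ∀ m : PauliModel.{w} n χ, ‖m.rep x m.ψ‖ ≤ C * m.δ

theorem Small.add {x y : Word n} (hx : Small.{w} χ x) (hy : Small.{w} χ y) :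
    Small.{w} χ (x + y) := by
  obtain ⟨C, hx⟩ := hx
  obtain ⟨D, hy⟩ := hy
  refine ⟨C + D, fun m => ?_⟩
  rw [map_add, add_mul]
  exact (norm_add_le _ _).trans (add_le_add (hx m) (hy m))

theorem Small.mul_left {x : Word n} (hx : Small.{w} χ x) (y : Word n) : Small.{w} χ (y * x) := by
  obtain ⟨C, hx⟩ := hx
  obtain ⟨D, hD, hy⟩ := exists_norm_rep_le.{w} (χ := χ) y
  refine ⟨D * C, fun m => ?_⟩
  rw [map_mul, mul_assoc]
  exact (m.rep y).le_of_opNorm_le_of_le (hy m) (hx m)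

theorem Small.mul_right {x : Word n} (hx : Small.{w} χ x) (y : Word n) : Small.{w} χ (x * y) := by
  induction y using FreeAlgebra.induction generalizing x with
  | grade0 r => rw [← Algebra.commutes]; exact hx.mul_left _
  | grade1 y =>
    obtain ⟨C, hx⟩ := hx
    obtain ⟨D, hD, hxn⟩ := exists_norm_rep_le.{w} (χ := χ) x
    refine ⟨C + D, fun m => ?_⟩
    have h1 : m.rep (x * FreeAlgebra.ι ℂ y) m.ψ =
        m.a y.1 y.2 (m.rep x m.ψ) - m.rep x (m.a y.1 y.2 m.ψ - m.t y.1 y.2 m.ψ) := by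
      have h := congrArg (fun f => f m.ψ)
        (m.commute_rep (fun j p => m.commute_a j p y.1 y.2) x).eq
      change m.rep x (m.a y.1 y.2 m.ψ) = m.a y.1 y.2 (m.rep x m.ψ) at h
      rw [map_sub, h, map_mul]
      simp [rep]
    rw [h1, add_mul]
    refine (norm_sub_le _ _).trans (add_le_add ?_ ?_)
    · exact ((m.a y.1 y.2).le_of_opNorm_le_of_le (m.norm_a_le _ _) (hx m)).trans_eq (one_mul _)
    · exact (m.rep x).le_of_opNorm_le_of_le (hxn m) (m.near_a _ _)
  | mul y z hy hz => rw [← mul_assoc]; exact hz (hy hx)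
  | add y z hy hz => rw [mul_add]; exact (hy hx).add (hz hx)

/-- The ideal of small polynomials. -/
def smallIdeal (χ : Question n) : Ideal (Word n) where
  carrier := {x | Small.{w} χ x}
  zero_mem' := ⟨0, fun m => by simp⟩
  add_mem' := Small.add
  smul_mem' y _ hx := hx.mul_left y

instance : (smallIdeal.{w} χ).IsTwoSided := ⟨fun y hx => Small.mul_right hx y⟩

/-- The quotient map by the ideal of small polynomials. -/
def toQuot (χ : Question n) : Word n →ₐ[ℂ] Word n ⧸ smallIdeal.{w} χ :=
  Ideal.Quotient.mkₐ ℂ (smallIdeal.{w} χ)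

theorem toQuot_eq_iff {x y : Word n} : toQuot.{w} χ x = toQuot.{w} χ y ↔ Small.{w} χ (x - y) :=
  Ideal.Quotient.eq

theorem toQuot_eq_zero_iff {x : Word n} : toQuot.{w} χ x = 0 ↔ Small.{w} χ x :=
  Ideal.Quotient.eq_zero_iff_mem

theorem small_of_le {x : Word n} (h : ∀ m : PauliModel.{w} n χ, ‖m.rep x m.ψ‖ ≤ m.δ) :
    toQuot.{w} χ x = 0 := toQuot_eq_zero_iff.2 ⟨1, fun m => by simpa using h m⟩

theorem pauliRel (χ : Question n) : PauliRel fun j p => toQuot.{w} χ (gen j p) where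
  triple j :=
    { sq := fun p => by
        rw [← map_mul, ← map_one (toQuot χ), ← sub_eq_zero, ← map_sub]
        exact small_of_le fun m => by simp [m.t_mul_self, m.δ_nonneg]
      anti := fun p q hpq => by
        rw [eq_neg_iff_add_eq_zero, ← map_mul, ← map_mul, ← map_add]
        exact small_of_le fun m => by simpa using m.anti j p q hpq }
  comm i j hij p q := by
    change _ * _ = _ * _
    rw [← sub_eq_zero, ← map_mul, ← map_mul, ← map_sub]
    exact small_of_le fun m => by simpa using m.comm i j hij p q
  conj_eq j hj := by
    rw [eq_neg_iff_add_eq_zero]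
    simp only [← map_mul]
    rw [← map_one (toQuot χ), ← map_add]
    exact small_of_le fun m => by simpa using m.conj_le j hj

/-- The operators `α` of the second party act on the vector like the polynomial `x`. -/
structure IsMirror (α : ∀ m : PauliModel.{w} n χ, m.H →L[ℂ] m.H) (x : Word n) : Prop where
  bounded : ∃ C, 0 ≤ C ∧ ∀ m, ‖α m‖ ≤ C
  commute : ∀ m j p, Commute (m.t j p) (α m)
  near : ∃ C, ∀ m, ‖α m m.ψ - m.rep x m.ψ‖ ≤ C * m.δ

namespace IsMirror

variable {α β : ∀ m : PauliModel.{w} n χ, m.H →L[ℂ] m.H} {x y : Word n}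

theorem apply_rep (h : IsMirror α x) (m : PauliModel n χ) (z : Word n) (φ : m.H) :
    α m (m.rep z φ) = m.rep z (α m φ) :=
  (congrArg (fun f => f φ) (m.commute_rep (h.commute m) z).eq).symm

theorem near_of_toQuot_eq (h : IsMirror α x) {z z' : Word n} (hz : toQuot.{w} χ (z * x) = toQuot.{w} χ z') :
    ∃ C, ∀ m, ‖α m (m.rep z m.ψ) - m.rep z' m.ψ‖ ≤ C * m.δ := by
  obtain ⟨C, hC⟩ := h.near
  obtain ⟨D, hD⟩ := toQuot_eq_iff.1 hz
  obtain ⟨E, hE, hzE⟩ := exists_norm_rep_le.{w} (χ := χ) z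
  refine ⟨E * C + D, fun m => ?_⟩
  have h1 : α m (m.rep z m.ψ) - m.rep z' m.ψ =
      m.rep z (α m m.ψ - m.rep x m.ψ) + m.rep (z * x - z') m.ψ := by
    rw [h.apply_rep, map_sub, map_sub, map_mul]; simp
  rw [h1, add_mul, mul_assoc]
  exact (norm_add_le _ _).trans
    (add_le_add ((m.rep z).le_of_opNorm_le_of_le (hzE m) (hC m)) (hD m))

theorem one : IsMirror (fun _ : PauliModel.{w} n χ => 1) 1 where
  bounded := ⟨1, zero_le_one, fun _ => ContinuousLinearMap.norm_id_le⟩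
  commute _ _ _ := Commute.one_right _
  near := ⟨0, fun m => by simp⟩

theorem mul (hα : IsMirror α x) (hβ : IsMirror β y) : IsMirror (fun m => α m * β m) (y * x) where
  bounded := by
    obtain ⟨C, hC, h1⟩ := hα.bounded
    obtain ⟨D, hD, h2⟩ := hβ.bounded
    exact ⟨C * D, mul_nonneg hC hD, fun m =>
      (norm_mul_le _ _).trans (mul_le_mul (h1 m) (h2 m) (norm_nonneg _) hC)⟩
  commute m j p := (hα.commute m j p).mul_right (hβ.commute m j p)
  near := by
    obtain ⟨A, hA, h1⟩ := hα.bounded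
    obtain ⟨C, hC⟩ := hβ.near
    obtain ⟨D, hD⟩ := hα.near_of_toQuot_eq (z := y) rfl
    refine ⟨A * C + D, fun m => ?_⟩
    have h : (α m * β m) m.ψ - m.rep (y * x) m.ψ =
        α m (β m m.ψ - m.rep y m.ψ) + (α m (m.rep y m.ψ) - m.rep (y * x) m.ψ) := by
      rw [map_sub]; simp
    rw [h, add_mul, mul_assoc]
    exact (norm_add_le _ _).trans
      (add_le_add ((α m).le_of_opNorm_le_of_le (h1 m) (hC m)) (hD m))

theorem add (hα : IsMirror α x) (hβ : IsMirror β y) : IsMirror (fun m => α m + β m) (x + y) where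
  bounded := by
    obtain ⟨C, hC, h1⟩ := hα.bounded
    obtain ⟨D, hD, h2⟩ := hβ.bounded
    exact ⟨C + D, add_nonneg hC hD, fun m =>
      (norm_add_le _ _).trans (add_le_add (h1 m) (h2 m))⟩
  commute m j p := (hα.commute m j p).add_right (hβ.commute m j p)
  near := by
    obtain ⟨C, hC⟩ := hα.near
    obtain ⟨D, hD⟩ := hβ.near
    refine ⟨C + D, fun m => ?_⟩
    have h : (α m + β m) m.ψ - m.rep (x + y) m.ψ =
        (α m m.ψ - m.rep x m.ψ) + (β m m.ψ - m.rep y m.ψ) := by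
      rw [map_add]; simp only [add_apply]; abel
    rw [h, add_mul]
    exact (norm_add_le _ _).trans (add_le_add (hC m) (hD m))

theorem smul (hα : IsMirror α x) (c : ℂ) : IsMirror (fun m => c • α m) (c • x) where
  bounded := by
    obtain ⟨C, hC, h1⟩ := hα.bounded
    exact ⟨‖c‖ * C, by positivity, fun m => by rw [norm_smul]; gcongr; exact h1 m⟩
  commute m j p := (hα.commute m j p).smul_right _
  near := by
    obtain ⟨C, hC⟩ := hα.near
    refine ⟨‖c‖ * C, fun m => ?_⟩
    have h : (c • α m) m.ψ - m.rep (c • x) m.ψ = c • (α m m.ψ - m.rep x m.ψ) := by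
      rw [map_smul, smul_sub]; rfl
    rw [h, norm_smul, mul_assoc]
    gcongr; exact hC m

theorem pow (hα : IsMirror α x) (k : ℕ) : IsMirror (fun m => α m ^ k) (x ^ k) := by
  induction k with
  | zero => simpa using one
  | succ k ih => simpa only [pow_succ' x, pow_succ] using ih.mul hα

theorem revProd {k : ℕ} {α : Fin k → ∀ m : PauliModel.{w} n χ, m.H →L[ℂ] m.H}
    {x : Fin k → Word n} (h : ∀ j, IsMirror (α j) (x j)) :
    IsMirror (fun m => StatePrep.revProd fun j => α j m) (ordProd x) := by
  induction k with
  | zero => simpa [StatePrep.revProd] using one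
  | succ k ih =>
    simp only [revProd_succ, ordProd_succ]
    exact (ih fun j => h j.succ).mul (h 0)

theorem of_a (j : Fin n) (p : Fin 3) :
    IsMirror (fun m : PauliModel.{w} n χ => m.a j p) (gen j p) where
  bounded := ⟨1, zero_le_one, fun m => m.norm_a_le j p⟩
  commute m k q := m.commute_a k q j p
  near := ⟨1, fun m => by simpa using m.near_a j p⟩

theorem of_b (j : Fin n) :
    IsMirror (fun m : PauliModel.{w} n χ => m.b j) (sigmaElt (gen j) (χ j)) where
  bounded := ⟨1, zero_le_one, fun m => m.norm_b_le j⟩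
  commute m k q := m.commute_b k q j
  near := ⟨1, fun m => by simpa [map_sigmaElt] using m.near_b j⟩

end IsMirror

theorem rep_circuitElt (m : PauliModel n χ) (s t : Fin n → Fin 2) :
    m.rep (circuitElt gen s t) = circuitElt m.t s t := by
  rw [map_circuitElt]; simp

theorem toQuot_circuitElt (s t : Fin n → Fin 2) :
    toQuot.{w} χ (circuitElt gen s t) = circuitElt (fun j p => toQuot.{w} χ (gen j p)) s t :=
  map_circuitElt _ _ _ _

theorem exists_norm_circuitElt_le (χ : Question n) : ∃ C, ∀ (s t : Fin n → Fin 2)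
    (m : PauliModel.{w} n χ), (∃ i j, t i ≠ t j) → ‖circuitElt m.t s t m.ψ‖ ≤ C * m.δ := by
  have : ∀ x : {x : (Fin n → Fin 2) × (Fin n → Fin 2) // ∃ i j, x.2 i ≠ x.2 j},
      ∃ C, ∀ m : PauliModel.{w} n χ, ‖circuitElt m.t x.1.1 x.1.2 m.ψ‖ ≤ C * m.δ := by
    rintro ⟨⟨s, t⟩, i, j, hij⟩
    have h := (pauliRel.{w} χ).circuitElt_eq_zero (s := s) hij
    rw [← toQuot_circuitElt, toQuot_eq_zero_iff] at h
    simpa only [Small, rep_circuitElt] using h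
  obtain ⟨C, hC⟩ := exists_uniform (fun m => m.δ_nonneg) this
  exact ⟨C, fun s t m h => hC ⟨(s, t), h⟩ m⟩

theorem exists_norm_revProd_pow_le (χ : Question n) : ∃ C, ∀ (s t : Fin n → Fin 2)
    (m : PauliModel.{w} n χ), ‖revProd (fun j => m.a j 0 ^ (s j : ℕ)) (circuitElt m.t 0 t m.ψ) -
      circuitElt m.t s t m.ψ‖ ≤ C * m.δ := by
  have : ∀ x : (Fin n → Fin 2) × (Fin n → Fin 2), ∃ C, ∀ m : PauliModel.{w} n χ,
      ‖revProd (fun j => m.a j 0 ^ (x.1 j : ℕ)) (circuitElt m.t 0 x.2 m.ψ) -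
      circuitElt m.t x.1 x.2 m.ψ‖ ≤ C * m.δ := by
    rintro ⟨s, t⟩
    have h := (IsMirror.revProd fun j => (IsMirror.of_a (χ := χ) j 0).pow (s j)).near_of_toQuot_eq
      (z := circuitElt gen 0 t) (z' := circuitElt gen s t) (by
        rw [map_mul, toQuot_circuitElt, toQuot_circuitElt, (pauliRel.{w} χ).circuitElt_eq_mul_pow s,
          map_ordProd]
        simp)
    simpa only [rep_circuitElt] using h
  obtain ⟨C, hC⟩ := exists_uniform (fun m => m.δ_nonneg) this
  exact ⟨C, fun s t m => hC (s, t) m⟩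

theorem exists_norm_uElt_le (χ : Question n) : ∃ C, ∀ (s t : Fin n → Fin 2) (j : Fin n)
    (m : PauliModel.{w} n χ), ‖(Complex.I • (m.a j 0 * m.a j 1)) (circuitElt m.t s t m.ψ) -
      (-1 : ℂ) ^ (s j : ℕ) • circuitElt m.t s t m.ψ‖ ≤ C * m.δ := by
  have : ∀ x : (Fin n → Fin 2) × (Fin n → Fin 2) × Fin n, ∃ C, ∀ m : PauliModel.{w} n χ,
      ‖(Complex.I • (m.a x.2.2 0 * m.a x.2.2 1)) (circuitElt m.t x.1 x.2.1 m.ψ) -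
      (-1 : ℂ) ^ (x.1 x.2.2 : ℕ) • circuitElt m.t x.1 x.2.1 m.ψ‖ ≤ C * m.δ := by
    rintro ⟨s, t, j⟩
    have h := (((IsMirror.of_a (χ := χ) j 0).mul (IsMirror.of_a j 1)).smul
      Complex.I).near_of_toQuot_eq (z := circuitElt gen s t)
      (z' := (-1 : ℂ) ^ (s j : ℕ) • circuitElt gen s t) (by
        rw [map_mul, map_smul, map_smul, map_mul, toQuot_circuitElt]
        exact (pauliRel.{w} χ).circuitElt_mul_uElt s t j)
    simp only [rep_circuitElt, map_smul] at h
    exact h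
  obtain ⟨C, hC⟩ := exists_uniform (fun m => m.δ_nonneg) this
  exact ⟨C, fun s t j m => hC (s, t, j) m⟩

theorem exists_norm_two_le (χ : Question n) : ∃ C, ∀ (s t : Fin n → Fin 2) (j : Fin n)
    (m : PauliModel.{w} n χ), ‖m.a j 2 (circuitElt m.t s t m.ψ) -
      (-1 : ℂ) ^ ((s j : ℕ) + t j) • circuitElt m.t s t m.ψ‖ ≤ C * m.δ := by
  have : ∀ x : (Fin n → Fin 2) × (Fin n → Fin 2) × Fin n, ∃ C, ∀ m : PauliModel.{w} n χ,
      ‖m.a x.2.2 2 (circuitElt m.t x.1 x.2.1 m.ψ) -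
      (-1 : ℂ) ^ ((x.1 x.2.2 : ℕ) + x.2.1 x.2.2) • circuitElt m.t x.1 x.2.1 m.ψ‖ ≤ C * m.δ := by
    rintro ⟨s, t, j⟩
    have h := (IsMirror.of_a (χ := χ) j 2).near_of_toQuot_eq (z := circuitElt gen s t)
      (z' := (-1 : ℂ) ^ ((s j : ℕ) + t j) • circuitElt gen s t) (by
        rw [map_mul, map_smul, toQuot_circuitElt]
        exact (pauliRel.{w} χ).circuitElt_mul_two s t j)
    simp only [rep_circuitElt, map_smul] at h
    exact h
  obtain ⟨C, hC⟩ := exists_uniform (fun m => m.δ_nonneg) this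
  exact ⟨C, fun s t j m => hC (s, t, j) m⟩

theorem exists_norm_measure_le (χ : Question n) : ∃ C, ∀ (s t : Fin n → Fin 2) (c : Signs n)
    (m : PauliModel.{w} n χ),
    ‖revProd (fun j => (1 / 2 : ℂ) • (1 + ((c j : ℤ) : ℂ) • m.b j)) (circuitElt m.t s t m.ψ) -
      ∑ s' : Fin n → Fin 2, (∏ j, (flagSigmaKet (t j) (χ j) (c j) (s j) *
        conj (flagSigmaKet (t j) (χ j) (c j) (s' j)))) • circuitElt m.t s' t m.ψ‖ ≤ C * m.δ := by
  have : ∀ x : (Fin n → Fin 2) × (Fin n → Fin 2) × Signs n, ∃ C, ∀ m : PauliModel.{w} n χ,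
      ‖revProd (fun j => (1 / 2 : ℂ) • (1 + ((x.2.2 j : ℤ) : ℂ) • m.b j))
        (circuitElt m.t x.1 x.2.1 m.ψ) -
      ∑ s' : Fin n → Fin 2, (∏ j, (flagSigmaKet (x.2.1 j) (χ j) (x.2.2 j) (x.1 j) *
        conj (flagSigmaKet (x.2.1 j) (χ j) (x.2.2 j) (s' j)))) •
          circuitElt m.t s' x.2.1 m.ψ‖ ≤ C * m.δ := by
    rintro ⟨s, t, c⟩
    have h := (IsMirror.revProd fun j => (IsMirror.one.add
      ((IsMirror.of_b (χ := χ) j).smul ((c j : ℤ) : ℂ))).smul (1 / 2)).near_of_toQuot_eq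
      (z := circuitElt gen s t)
      (z' := ∑ s' : Fin n → Fin 2, (∏ j, (flagSigmaKet (t j) (χ j) (c j) (s j) *
        conj (flagSigmaKet (t j) (χ j) (c j) (s' j)))) • circuitElt gen s' t) (by
        simp only [map_mul, map_sum, map_smul, toQuot_circuitElt]
        rw [← (pauliRel.{w} χ).circuitElt_mul_sigmaProj s t χ c, map_ordProd]
        congr 2; funext j
        exact map_sigmaProj _ _ _ _)
    simpa only [rep_circuitElt, map_smul, map_sum, sum_apply,
      smul_apply] using h
  obtain ⟨C, hC⟩ := exists_uniform (fun m => m.δ_nonneg) this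
  exact ⟨C, fun s t c m => hC (s, t, c) m⟩

end PauliModel

/-! ### Regularization -/

section Regularize

variable {B : Type v} [NormedAddCommGroup B] [InnerProductSpace ℂ B] [CompleteSpace B]

theorem isUnit_of_injective [FiniteDimensional ℂ B] {X : B →L[ℂ] B} (h : ∀ v, X v = 0 → v = 0) :
    IsUnit X := by
  have hinj : Function.Injective (X : B →ₗ[ℂ] B) :=
    (injective_iff_map_eq_zero _).2 h
  exact ContinuousLinearMap.isUnit_iff_bijective.2
    ⟨hinj, LinearMap.injective_iff_surjective.1 hinj⟩

omit [CompleteSpace B] in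
theorem norm_le_norm_one_add {p : B →L[ℂ] B} (hp : 0 ≤ p) (v : B) : ‖v‖ ≤ ‖(1 + p) v‖ := by
  have h1 : 0 ≤ (inner ℂ v (p v)).re :=
    ((ContinuousLinearMap.nonneg_iff_isPositive p).1 hp).re_inner_nonneg_right v
  have h2 : ‖v‖ ^ 2 ≤ ‖v‖ * ‖(1 + p) v‖ := by
    refine le_trans ?_ ((Complex.re_le_norm _).trans (norm_inner_le_norm v ((1 + p) v)))
    have : (inner ℂ v ((1 + p) v)).re = ‖v‖ ^ 2 + (inner ℂ v (p v)).re := by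
      simp [← inner_self_eq_norm_sq (𝕜 := ℂ)]
    linarith
  rcases (norm_nonneg v).eq_or_lt with h | h
  · rw [← h]; exact norm_nonneg _
  · exact le_of_mul_le_mul_left (by linarith [sq ‖v‖]) h

variable [FiniteDimensional ℂ B] {T : B →L[ℂ] B}

theorem regularize_spec (hT : IsSelfAdjoint T) : IsSelfAdjoint (regularize T) ∧
    regularize T * regularize T = 1 ∧
    ∃ c : B →L[ℂ] B, ‖c‖ ≤ 1 ∧ regularize T - T = c * (1 - T * T) := by
  set P := (LinearMap.ker (T : B →ₗ[ℂ] B)).starProjection with hPdef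
  set T' := T + P with hT'def
  have hP : IsSelfAdjoint P := isSelfAdjoint_starProjection _
  have hT' : IsSelfAdjoint T' := hT.add hP
  have hTP : T * P = 0 := by
    ext v
    have h : P v ∈ LinearMap.ker (T : B →ₗ[ℂ] B) := Submodule.starProjection_apply_mem _ v
    exact LinearMap.mem_ker.1 h
  have hPT : P * T = 0 := by
    have := congrArg star hTP
    rwa [star_mul, hP.star_eq, hT.star_eq, star_zero] at this
  have hTT' : T * T' = T * T := by rw [hT'def, mul_add, hTP, add_zero]
  have hT'T : T' * T = T * T := by rw [hT'def, add_mul, hPT, add_zero]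
  have hcomm : Commute T T' := by rw [Commute, SemiconjBy, hTT', hT'T]
  have hu : IsUnit T' := by
    refine isUnit_of_injective fun v hv => ?_
    have h1 : T (T v) = 0 := by
      change (T * T) v = 0
      rw [← hTT']
      exact (congrArg T hv).trans (map_zero T)
    have h2 : T v = 0 := by
      rw [← norm_eq_zero, ← sq_eq_zero_iff, ← inner_self_eq_norm_sq (𝕜 := ℂ),
        ← ContinuousLinearMap.adjoint_inner_right, ← ContinuousLinearMap.star_eq_adjoint,
        hT.star_eq, h1]
      simp
    have h3 : P v = v := Submodule.starProjection_eq_self_iff.2 (LinearMap.mem_ker.2 h2)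
    rw [hT'def, add_apply, h2, h3, zero_add] at hv
    exact hv
  set m := CFC.sqrt (star T' * T') with hm
  have hm0 : 0 ≤ m := CFC.sqrt_nonneg _
  have hmm : m * m = T' * T' := by
    rw [hm, CFC.sqrt_mul_sqrt_self _ (star_mul_self_nonneg _), hT'.star_eq]
  have hmu : IsUnit m := by
    rw [hm, CFC.isUnit_sqrt_iff _ (star_mul_self_nonneg _), hT'.star_eq]
    exact hu.mul hu
  have hmc : ∀ X, Commute X T' → Commute X m := by
    intro X hX
    rw [hm, hT'.star_eq]
    exact ((hX.mul_right hX).symm.cfcₙ_nnreal NNReal.sqrt).symm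
  obtain ⟨μ, hμ⟩ := hmu
  have hinv : Ring.inverse m = ((μ⁻¹ : (B →L[ℂ] B)ˣ) : B →L[ℂ] B) := by
    rw [← hμ, Ring.inverse_unit]
  set k := ((μ⁻¹ : (B →L[ℂ] B)ˣ) : B →L[ℂ] B) with hk
  have hkm : k * m = 1 := by rw [← hμ]; exact μ.inv_mul
  have hmk : m * k = 1 := by rw [← hμ]; exact μ.mul_inv
  have hkc : ∀ X, Commute X m → Commute X k := by
    intro X hX
    rw [← hμ] at hX
    exact hX.units_inv_right
  have hreg : regularize T = T' * k := by rw [← hinv]; rfl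
  have hks : IsSelfAdjoint k := by
    rw [IsSelfAdjoint, ← hinv, ← Ring.inverse_star, (IsSelfAdjoint.of_nonneg hm0).star_eq]
  have hk0 : 0 ≤ k := by
    have : k = k * m * k := by rw [hkm, one_mul]
    rw [this]
    exact hks.conjugate_nonneg hm0
  have hT'k : Commute T' k := hkc _ (hmc _ (Commute.refl _))
  have hTk : Commute T k := hkc _ (hmc _ hcomm)
  have hsa : IsSelfAdjoint (regularize T) := by
    rw [IsSelfAdjoint, hreg, star_mul, hks.star_eq, hT'.star_eq, hT'k.eq]
  have hsq : regularize T * regularize T = 1 := by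
    rw [hreg]
    calc T' * k * (T' * k) = T' * (k * T') * k := by simp only [mul_assoc]
      _ = T' * T' * (k * k) := by rw [← hT'k.eq]; simp only [mul_assoc]
      _ = m * (m * k) * k := by rw [← hmm]; simp only [mul_assoc]
      _ = 1 := by rw [hmk, mul_one, hmk]
  refine ⟨hsa, hsq, ?_⟩
  set p := regularize T * T with hp
  have hp0 : 0 ≤ p := by
    have : p = T * k * T := by
      rw [hp, hreg, hT'k.eq, mul_assoc, hT'T, hTk.eq, mul_assoc]
    rw [this]
    exact hT.conjugate_nonneg hk0
  have hRT : Commute (regularize T) T := by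
    rw [hreg]; exact hcomm.symm.mul_left hTk.symm
  have hpp : p * p = T * T := by
    calc p * p = T * regularize T * (regularize T * T) := by rw [hp]; nth_rw 1 [hRT.eq]
      _ = T * (regularize T * regularize T) * T := by simp only [mul_assoc]
      _ = T * T := by rw [hsq, mul_one]
  have hu1 : IsUnit (1 + p) := isUnit_of_injective fun v hv => by
    have := norm_le_norm_one_add hp0 v
    rw [hv, norm_zero] at this
    exact norm_le_zero_iff.1 this
  obtain ⟨ν, hν⟩ := hu1
  set i := ((ν⁻¹ : (B →L[ℂ] B)ˣ) : B →L[ℂ] B)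
  have hi : (1 + p) * i = 1 := by rw [← hν]; exact ν.mul_inv
  have hi' : i * (1 + p) = 1 := by rw [← hν]; exact ν.inv_mul
  refine ⟨regularize T * i, ?_, ?_⟩
  · refine ContinuousLinearMap.opNorm_le_bound _ zero_le_one fun v => ?_
    have h1 : ‖(regularize T) (i v)‖ = ‖i v‖ := by
      have : ‖(regularize T) (i v)‖ ^ 2 = ‖i v‖ ^ 2 := by
        rw [← inner_self_eq_norm_sq (𝕜 := ℂ), ← inner_self_eq_norm_sq (𝕜 := ℂ),
          ← ContinuousLinearMap.adjoint_inner_right, ← ContinuousLinearMap.star_eq_adjoint,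
          hsa.star_eq]
        change RCLike.re (inner ℂ (i v) ((regularize T * regularize T) (i v))) = _
        rw [hsq]; rfl
      exact (sq_eq_sq₀ (norm_nonneg _) (norm_nonneg _)).1 this
    have h2 := norm_le_norm_one_add hp0 (i v)
    have h3 : (1 + p) (i v) = v := congrArg (fun f => f v) hi
    rw [h3] at h2
    rw [one_mul]
    exact h1.trans_le h2
  · have h1 : 1 - T * T = (1 + p) * (1 - p) := by
      rw [← hpp, add_mul, mul_sub, mul_sub]; simp
    rw [h1, mul_assoc, ← mul_assoc i, hi', one_mul, mul_sub, mul_one, hp, ← mul_assoc, hsq, one_mul]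

theorem isSelfAdjoint_regularize (hT : IsSelfAdjoint T) : IsSelfAdjoint (regularize T) :=
  (regularize_spec hT).1

theorem regularize_mul_self (hT : IsSelfAdjoint T) : regularize T * regularize T = 1 :=
  (regularize_spec hT).2.1

theorem exists_regularize_sub (hT : IsSelfAdjoint T) :
    ∃ c : B →L[ℂ] B, ‖c‖ ≤ 1 ∧ regularize T - T = c * (1 - T * T) :=
  (regularize_spec hT).2.2

end Regularize

/-! ### Operators which are diagonal with respect to a projective measurement -/

section Diag

variable {H : Type*} [NormedAddCommGroup H] [InnerProductSpace ℂ H] [CompleteSpace H]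

/-- The operator which is multiplication by `f i` on the range of `P i`. -/
def IsProjectiveMeasurement.diag {ι : Type*} [Fintype ι] {P : ι → H →L[ℂ] H}
    (hP : IsProjectiveMeasurement P) : (ι → ℂ) →ₐ[ℂ] H →L[ℂ] H :=
  AlgHom.ofLinearMap
    { toFun := fun f => ∑ i, f i • P i
      map_add' := fun f g => by simp [add_smul, Finset.sum_add_distrib]
      map_smul' := fun c f => by simp [Finset.smul_sum, smul_smul] }
    (by simp [hP.sum_eq_one])
    (by
      classical
      intro f g
      simp only [LinearMap.coe_mk, AddHom.coe_mk, Pi.mul_apply]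
      rw [Finset.sum_mul_sum]
      refine Finset.sum_congr rfl fun i _ => ?_
      rw [Finset.sum_eq_single i]
      · rw [smul_mul_smul_comm, (hP.isStarProjection i).isIdempotentElem.eq]
      · intro j _ hj
        rw [smul_mul_smul_comm, hP.orthogonal i j hj.symm, smul_zero]
      · simp)

namespace IsProjectiveMeasurement

variable {ι : Type*} [Fintype ι] {P : ι → H →L[ℂ] H} (hP : IsProjectiveMeasurement P)
include hP

theorem diag_apply (f : ι → ℂ) : hP.diag f = ∑ i, f i • P i := rfl

theorem star_diag (f : ι → ℂ) : star (hP.diag f) = hP.diag (star f) := by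
  simp [diag_apply, star_sum, star_smul, (hP.isStarProjection _).isSelfAdjoint.star_eq]

theorem diag_single [DecidableEq ι] (i : ι) : hP.diag (Pi.single i 1) = P i := by
  rw [diag_apply, Finset.sum_eq_single i]
  · simp
  · intro j _ hj; simp [hj]
  · simp

end IsProjectiveMeasurement

theorem norm_le_one_of_star_mul_self {X : H →L[ℂ] H} (h : star X * X = 1) : ‖X‖ ≤ 1 := by
  have h1 := CStarRing.norm_star_mul_self (x := X)
  rw [h] at h1
  have h2 : ‖(1 : H →L[ℂ] H)‖ ≤ 1 := ContinuousLinearMap.norm_id_le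
  nlinarith [norm_nonneg X]

theorem norm_le_one_of_isSelfAdjoint {X : H →L[ℂ] H} (hX : IsSelfAdjoint X) (h : X * X = 1) :
    ‖X‖ ≤ 1 := norm_le_one_of_star_mul_self (by rw [hX.star_eq, h])

theorem marginal_eq_diag {m : ℕ} {α : Type*} [Fintype α] [DecidableEq α]
    {P : (Fin m → α) → H →L[ℂ] H} (hP : IsProjectiveMeasurement P) (j : Fin m) (v : α) :
    marginal P j v = hP.diag fun a => if a j = v then 1 else 0 := by
  simp [marginal, hP.diag_apply, Finset.sum_filter]

section Observable

variable {n : ℕ} {P : Signs n → H →L[ℂ] H} (hP : IsProjectiveMeasurement P)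
include hP

theorem observable_eq_diag (j : Fin n) : observable P j = hP.diag fun a => ((a j : ℤ) : ℂ) := by
  rw [observable, marginal_eq_diag hP, marginal_eq_diag hP, ← map_sub]
  congr 1; funext a
  rcases Int.units_eq_one_or (a j) with h | h <;> simp [h]

theorem isSelfAdjoint_observable (j : Fin n) : IsSelfAdjoint (observable P j) := by
  rw [IsSelfAdjoint, observable_eq_diag hP, hP.star_diag]
  congr 1; funext a; simp

theorem observable_mul_self (j : Fin n) : observable P j * observable P j = 1 := by
  rw [observable_eq_diag hP, ← map_mul, ← map_one hP.diag]
  congr 1; funext a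
  rcases Int.units_eq_one_or (a j) with h | h <;> simp [h]

theorem commute_observable (i j : Fin n) : Commute (observable P i) (observable P j) := by
  rw [observable_eq_diag hP, observable_eq_diag hP]
  exact (Commute.all _ _).map hP.diag

theorem norm_observable_le (j : Fin n) : ‖observable P j‖ ≤ 1 :=
  norm_le_one_of_isSelfAdjoint (isSelfAdjoint_observable hP j) (observable_mul_self hP j)

theorem revProd_observable (c : Signs n) :
    (revProd fun j => (1 / 2 : ℂ) • (1 + ((c j : ℤ) : ℂ) • observable P j)) = P c := by
  have h : ∀ j, (1 / 2 : ℂ) • (1 + ((c j : ℤ) : ℂ) • observable P j) =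
      hP.diag ((1 / 2 : ℂ) • (1 + ((c j : ℤ) : ℂ) • fun a : Signs n => ((a j : ℤ) : ℂ))) := by
    intro j; rw [map_smul, map_add, map_smul, map_one, observable_eq_diag hP]
  rw [revProd, funext h]
  rw [show (fun j => hP.diag ((1 / 2 : ℂ) • (1 + ((c j : ℤ) : ℂ) •
    fun a : Signs n => ((a j : ℤ) : ℂ)))) = hP.diag ∘ fun j => ((1 / 2 : ℂ) •
    (1 + ((c j : ℤ) : ℂ) • fun a : Signs n => ((a j : ℤ) : ℂ))) from rfl, ← List.map_ofFn,
    ← List.map_reverse, ← map_list_prod, List.prod_reverse, List.prod_ofFn, ← hP.diag_single c]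
  congr 1; funext a
  rw [Finset.prod_apply]
  by_cases hac : a = c
  · subst hac
    rw [Pi.single_eq_same]
    refine Finset.prod_eq_one fun j _ => ?_
    rcases Int.units_eq_one_or (a j) with h | h <;> simp [h] <;> norm_num
  · rw [Pi.single_eq_of_ne hac]
    obtain ⟨j, hj⟩ := Function.ne_iff.1 hac
    refine Finset.prod_eq_zero (Finset.mem_univ j) ?_
    rcases Int.units_eq_one_or (a j) with h | h <;>
      rcases Int.units_eq_one_or (c j) with h' | h' <;> simp_all

end Observable

end Diag

/-! ### Approximate replacement of operators -/

section Replace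

variable {H : Type*} [NormedAddCommGroup H] [NormedSpace ℂ H] {ψ : H} {d : ℝ}

theorem norm_mul_sub_mul_le {X₁ X₂ Z₁ Z₂ : H →L[ℂ] H} {C e₁ e₂ : ℝ} (hX : ‖X₂‖ ≤ 1) (hZ : ‖Z₁‖ ≤ C)
    (hc : Commute Z₁ X₂) (h₁ : ‖X₁ ψ - Z₁ ψ‖ ≤ e₁) (h₂ : ‖X₂ ψ - Z₂ ψ‖ ≤ e₂) :
    ‖(X₂ * X₁) ψ - (Z₁ * Z₂) ψ‖ ≤ C * e₂ + e₁ := by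
  have hc' : Z₁ (X₂ ψ) = X₂ (Z₁ ψ) := congrArg (fun f => f ψ) hc.eq
  have h : (X₂ * X₁) ψ - (Z₁ * Z₂) ψ = Z₁ (X₂ ψ - Z₂ ψ) + X₂ (X₁ ψ - Z₁ ψ) := by
    rw [map_sub, map_sub, hc']
    change X₂ (X₁ ψ) - Z₁ (Z₂ ψ) = _
    abel
  rw [h]
  refine (norm_add_le _ _).trans (add_le_add (Z₁.le_of_opNorm_le_of_le hZ h₂) ?_)
  exact (X₂.le_of_opNorm_le_of_le hX h₁).trans_eq (one_mul _)

theorem norm_sub_regularize_le {X Y R c : H →L[ℂ] H} (hXX : X * X = 1) (hX : ‖X‖ ≤ 1)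
    (hXY : Commute X Y) (hY : ‖Y‖ ≤ 2) (hc : ‖c‖ ≤ 1) (hR : R - Y = c * (1 - Y * Y))
    (h : ‖X ψ - Y ψ‖ ≤ d) : ‖X ψ - R ψ‖ ≤ 4 * d := by
  have h1 : (1 - Y * Y) ψ = X (X ψ - Y ψ) + Y (X ψ - Y ψ) := by
    have hc' : X (Y ψ) = Y (X ψ) := congrArg (fun f => f ψ) hXY.eq
    have h2 : X (X ψ) = ψ := congrArg (fun f => f ψ) hXX
    rw [map_sub, map_sub, hc', h2]
    change ψ - Y (Y ψ) = _
    abel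
  have h2 : X ψ - R ψ = (X ψ - Y ψ) - c ((1 - Y * Y) ψ) := by
    have : (R - Y) ψ = c ((1 - Y * Y) ψ) := congrArg (fun f => f ψ) hR
    rw [← this]
    change _ = _ - (R ψ - Y ψ)
    abel
  have h3 : ‖(1 - Y * Y) ψ‖ ≤ 1 * d + 2 * d := by
    rw [h1]
    exact (norm_add_le _ _).trans
      (add_le_add (X.le_of_opNorm_le_of_le hX h) (Y.le_of_opNorm_le_of_le hY h))
  have h4 := c.le_of_opNorm_le_of_le hc h3
  rw [h2]
  refine (norm_sub_le _ _).trans ?_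
  linarith

theorem norm_anticommutator_le {X₁ X₂ Y₁ Y₂ T₁ T₂ : H →L[ℂ] H}
    (hX₁ : ‖X₁‖ ≤ 1) (hX₂ : ‖X₂‖ ≤ 1) (hY₁ : ‖Y₁‖ ≤ 2) (hY₂ : ‖Y₂‖ ≤ 2)
    (hT₁ : ‖T₁‖ ≤ 1) (hT₂ : ‖T₂‖ ≤ 1) (hYX₁ : Commute Y₁ X₂) (hYX₂ : Commute Y₂ X₁)
    (hTX₁ : Commute T₁ X₂) (hTX₂ : Commute T₂ X₁) (hY : Y₁ * Y₂ + Y₂ * Y₁ = 0)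
    (h₁ : ‖X₁ ψ - Y₁ ψ‖ ≤ d) (h₂ : ‖X₂ ψ - Y₂ ψ‖ ≤ d)
    (k₁ : ‖X₁ ψ - T₁ ψ‖ ≤ 4 * d) (k₂ : ‖X₂ ψ - T₂ ψ‖ ≤ 4 * d) :
    ‖(T₁ * T₂ + T₂ * T₁) ψ‖ ≤ 22 * d := by
  have a1 := norm_mul_sub_mul_le hX₂ hT₁ hTX₁ k₁ k₂
  have a2 := norm_mul_sub_mul_le hX₁ hT₂ hTX₂ k₂ k₁
  have b1 := norm_mul_sub_mul_le hX₂ hY₁ hYX₁ h₁ h₂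
  have b2 := norm_mul_sub_mul_le hX₁ hY₂ hYX₂ h₂ h₁
  have hY' : (Y₁ * Y₂) ψ + (Y₂ * Y₁) ψ = 0 := congrArg (fun f => f ψ) hY
  have h : (T₁ * T₂ + T₂ * T₁) ψ = (((X₂ * X₁) ψ - (Y₁ * Y₂) ψ) + ((X₁ * X₂) ψ - (Y₂ * Y₁) ψ)) -
      (((X₂ * X₁) ψ - (T₁ * T₂) ψ) + ((X₁ * X₂) ψ - (T₂ * T₁) ψ)) := by
    rw [← sub_eq_zero, ← hY']
    change (T₁ * T₂) ψ + (T₂ * T₁) ψ - _ = _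
    abel
  rw [h]
  refine (norm_sub_le _ _).trans ((add_le_add (norm_add_le _ _) (norm_add_le _ _)).trans ?_)
  linarith

theorem norm_commutator_le {X₁ X₂ T₁ T₂ : H →L[ℂ] H}
    (hX₁ : ‖X₁‖ ≤ 1) (hX₂ : ‖X₂‖ ≤ 1) (hT₁ : ‖T₁‖ ≤ 1) (hT₂ : ‖T₂‖ ≤ 1)
    (hTX₁ : Commute T₁ X₂) (hTX₂ : Commute T₂ X₁) (hX : Commute X₁ X₂)
    (k₁ : ‖X₁ ψ - T₁ ψ‖ ≤ 4 * d) (k₂ : ‖X₂ ψ - T₂ ψ‖ ≤ 4 * d) :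
    ‖(T₁ * T₂ - T₂ * T₁) ψ‖ ≤ 16 * d := by
  have a1 := norm_mul_sub_mul_le hX₂ hT₁ hTX₁ k₁ k₂
  have a2 := norm_mul_sub_mul_le hX₁ hT₂ hTX₂ k₂ k₁
  have h : (T₁ * T₂ - T₂ * T₁) ψ = ((X₁ * X₂) ψ - (T₂ * T₁) ψ) - ((X₂ * X₁) ψ - (T₁ * T₂) ψ) := by
    rw [hX.eq]
    change (T₁ * T₂) ψ - (T₂ * T₁) ψ = _
    abel
  rw [h]
  refine (norm_sub_le _ _).trans ?_
  linarith

theorem norm_mul_mul_sub_le {X₁ X₂ X₃ Z₁ Z₂ Z₃ : H →L[ℂ] H} {e : ℝ} (hX₂ : ‖X₂‖ ≤ 1)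
    (hX₃ : ‖X₃‖ ≤ 1) (hZ₁ : ‖Z₁‖ ≤ 1) (hZ₂ : ‖Z₂‖ ≤ 1)
    (c₂ : Commute Z₁ X₂) (c₃ : Commute Z₁ X₃) (c : Commute Z₂ X₃)
    (h₁ : ‖X₁ ψ - Z₁ ψ‖ ≤ e) (h₂ : ‖X₂ ψ - Z₂ ψ‖ ≤ e) (h₃ : ‖X₃ ψ - Z₃ ψ‖ ≤ e) :
    ‖(X₃ * X₂ * X₁) ψ - (Z₁ * Z₂ * Z₃) ψ‖ ≤ 3 * e := by
  have h := norm_mul_sub_mul_le (X₂ := X₃ * X₂) (Z₂ := Z₂ * Z₃)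
    ((norm_mul_le _ _).trans (mul_le_one₀ hX₃ (norm_nonneg _) hX₂)) hZ₁ (c₃.mul_right c₂) h₁
    (norm_mul_sub_mul_le hX₃ hZ₂ c h₂ h₃)
  rw [mul_assoc Z₁]
  linarith

end Replace

/-! ### Operators of one party -/

section Local

variable {A : Type u} [NormedAddCommGroup A] [InnerProductSpace ℂ A]
  {B : Type v} [NormedAddCommGroup B] [InnerProductSpace ℂ B]

variable (A B) in
/-- The tensor product of two inner product spaces, with the scalar multiplication coming from the
inner product space structure. -/
def Joint : Type (max u v) := A ⊗[ℂ] B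

instance : NormedAddCommGroup (Joint A B) := inferInstanceAs (NormedAddCommGroup (A ⊗[ℂ] B))

instance : InnerProductSpace ℂ (Joint A B) := inferInstanceAs (InnerProductSpace ℂ (A ⊗[ℂ] B))

/-- An operator on the tensor product, as an operator on the type synonym. -/
def Joint.ofOp (X : A ⊗[ℂ] B →L[ℂ] A ⊗[ℂ] B) : Joint A B →L[ℂ] Joint A B where
  toFun := fun w => X w
  map_add' := fun x y => X.map_add x y
  map_smul' := fun c x => X.map_smul c x
  cont := X.cont

/-- The action of Alice's operators on the shared space. -/
def opA : (A →L[ℂ] A) →ₐ[ℂ] (Joint A B →L[ℂ] Joint A B) :=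
  AlgHom.ofLinearMap
    { toFun := fun X => Joint.ofOp (X.rTensor B)
      map_add' := fun X Y => by
        ext w; exact congrArg (fun f => f w) (ContinuousLinearMap.rTensor_add B X Y)
      map_smul' := fun c X => by
        ext w; exact congrArg (fun f => f w) (ContinuousLinearMap.rTensor_smul B c X) }
    (by ext w; exact congrArg (fun f => f w) (ContinuousLinearMap.rTensor_one (E := A) B))
    (fun X Y => by ext w; exact congrArg (fun f => f w) (ContinuousLinearMap.rTensor_mul B X Y))

/-- The action of Bob's operators on the shared space. -/
def opB : (B →L[ℂ] B) →ₐ[ℂ] (Joint A B →L[ℂ] Joint A B) :=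
  AlgHom.ofLinearMap
    { toFun := fun X => Joint.ofOp (X.lTensor A)
      map_add' := fun X Y => by
        ext w; exact congrArg (fun f => f w) (ContinuousLinearMap.lTensor_add A X Y)
      map_smul' := fun c X => by
        ext w; exact congrArg (fun f => f w) (ContinuousLinearMap.lTensor_smul A c X) }
    (by ext w; exact congrArg (fun f => f w) (ContinuousLinearMap.lTensor_one (E := B) A))
    (fun X Y => by ext w; exact congrArg (fun f => f w) (ContinuousLinearMap.lTensor_mul A X Y))

theorem opA_opB (X : A →L[ℂ] A) (Y : B →L[ℂ] B) (w : A ⊗[ℂ] B) :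
    opA X (opB Y w) = TensorProduct.map (X : A →ₗ[ℂ] A) (Y : B →ₗ[ℂ] B) w := by
  change X.rTensor B (Y.lTensor A w) = _
  induction w with
  | zero => simp
  | add x y hx hy => rw [map_add, map_add, hx, hy, map_add]
  | tmul a b => rfl

theorem commute_opB_opA (X : A →L[ℂ] A) (Y : B →L[ℂ] B) :
    Commute (opB Y : Joint A B →L[ℂ] Joint A B) (opA X) := by
  ext w
  exact congrArg (fun f => f w) ((ContinuousLinearMap.lTensor_comp_rTensor Y X).trans
    (ContinuousLinearMap.rTensor_comp_lTensor X Y).symm)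

theorem Joint.norm_ofOp (X : A ⊗[ℂ] B →L[ℂ] A ⊗[ℂ] B) : ‖Joint.ofOp X‖ ≤ ‖X‖ :=
  ContinuousLinearMap.opNorm_le_bound _ (norm_nonneg X) fun w => X.le_opNorm w

theorem norm_opA_le (X : A →L[ℂ] A) : ‖(opA X : Joint A B →L[ℂ] Joint A B)‖ ≤ ‖X‖ :=
  (Joint.norm_ofOp _).trans (ContinuousLinearMap.norm_rTensor_le _ X)

theorem norm_opB_le (Y : B →L[ℂ] B) : ‖(opB Y : Joint A B →L[ℂ] Joint A B)‖ ≤ ‖Y‖ :=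
  (Joint.norm_ofOp _).trans (ContinuousLinearMap.norm_lTensor_le _ Y)

variable [CompleteSpace A] [CompleteSpace B]

omit [CompleteSpace B] in
theorem inner_rTensor (X : A →L[ℂ] A) (x y : A ⊗[ℂ] B) :
    inner ℂ (X.rTensor B x) y = inner ℂ x ((star X).rTensor B y) := by
  induction x with
  | zero => simp
  | add x x' hx hx' => rw [map_add, inner_add_left, hx, hx', inner_add_left]
  | tmul a b =>
    induction y with
    | zero => simp
    | add y y' hy hy' => rw [map_add, inner_add_right, hy, hy', inner_add_right]
    | tmul c d =>
      simp [ContinuousLinearMap.star_eq_adjoint, ContinuousLinearMap.adjoint_inner_right]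

omit [CompleteSpace A] in
theorem inner_lTensor (Y : B →L[ℂ] B) (x y : A ⊗[ℂ] B) :
    inner ℂ (Y.lTensor A x) y = inner ℂ x ((star Y).lTensor A y) := by
  induction x with
  | zero => simp
  | add x x' hx hx' => rw [map_add, inner_add_left, hx, hx', inner_add_left]
  | tmul a b =>
    induction y with
    | zero => simp
    | add y y' hy hy' => rw [map_add, inner_add_right, hy, hy', inner_add_right]
    | tmul c d =>
      simp [ContinuousLinearMap.star_eq_adjoint, ContinuousLinearMap.adjoint_inner_right]

omit [CompleteSpace B] in
theorem inner_opA (X : A →L[ℂ] A) (x y : Joint A B) :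
    inner ℂ (opA X x) y = inner ℂ x (opA (star X) y) := inner_rTensor X _ _

omit [CompleteSpace A] in
theorem inner_opB (Y : B →L[ℂ] B) (x y : Joint A B) :
    inner ℂ (opB Y x) y = inner ℂ x (opB (star Y) y) := inner_lTensor Y _ _

theorem norm_map_of_star_mul_self {K H : Type*} [NormedAddCommGroup K]
    [InnerProductSpace ℂ K] [CompleteSpace K] [NormedAddCommGroup H] [InnerProductSpace ℂ H]
    (φ : (K →L[ℂ] K) →ₐ[ℂ] H →L[ℂ] H)
    (hφ : ∀ X x y, inner ℂ (φ X x) y = inner ℂ x (φ (star X) y)) {X : K →L[ℂ] K}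
    (hX : star X * X = 1)     (w : H) : ‖φ X w‖ = ‖w‖ := by
  have h : ‖φ X w‖ ^ 2 = ‖w‖ ^ 2 := by
    rw [← inner_self_eq_norm_sq (𝕜 := ℂ), ← inner_self_eq_norm_sq (𝕜 := ℂ), hφ]
    change RCLike.re (inner ℂ w ((φ (star X) * φ X) w)) = _
    rw [← map_mul, hX, map_one]; rfl
  exact (sq_eq_sq₀ (norm_nonneg _) (norm_nonneg _)).1 h

omit [CompleteSpace B] in
theorem norm_opA_of_star_mul_self {X : A →L[ℂ] A} (hX : star X * X = 1) (w : Joint A B) :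
    ‖opA X w‖ = ‖w‖ := norm_map_of_star_mul_self opA inner_opA hX w

omit [CompleteSpace A] in
theorem norm_opB_of_star_mul_self {Y : B →L[ℂ] B} (hY : star Y * Y = 1) (w : Joint A B) :
    ‖opB Y w‖ = ‖w‖ := norm_map_of_star_mul_self opB inner_opB hY w

end Local

/-! ### Questions -/

section Questions

variable {n : ℕ} {S : Set (Question n)}

theorem insertAt_dropAt (j : Fin n) (χ : Question n) : insertAt j (χ j) (dropAt j χ) = χ := by
  funext i
  by_cases h : i = j
  · subst h; simp [insertAt]
  · simp [insertAt, dropAt, h]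

theorem dropAt_mem_otherQuestions {χ : Question n} (h : χ ∈ S) (j : Fin n) :
    dropAt j χ ∈ otherQuestions S j := ⟨χ, h, Or.inl rfl⟩

theorem dropAt_update_mem_otherQuestions {χ : Question n} (h : χ ∈ S) (j i : Fin n) (q : Fin 5) :
    dropAt j (Function.update χ i q) ∈ otherQuestions S j := by
  by_cases hij : i = j
  · refine ⟨χ, h, Or.inl ?_⟩
    funext k
    have hk : (k : Fin n) ≠ i := hij ▸ k.2
    simp [dropAt, hk]
  · refine ⟨χ, h, Or.inr ⟨q - χ i, ⟨i, hij⟩, ?_⟩⟩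
    funext k
    by_cases hk : k = ⟨i, hij⟩
    · subst hk; simp [dropAt]
    · have : (k : Fin n) ≠ i := fun h => hk (Subtype.ext h)
      simp [dropAt, this, hk]

theorem insertAt_mem_aliceQuestions {j : Fin n} {r : {i : Fin n // i ≠ j} → Fin 5}
    (hr : r ∈ otherQuestions S j) (q : Fin 5) : insertAt j q r ∈ aliceQuestions S := by
  obtain ⟨χ, hχ, h⟩ := hr
  refine ⟨χ, hχ, ?_⟩
  rcases h with rfl | ⟨k, i, rfl⟩
  · refine ⟨_, ⟨q - χ j, 0, j, j, rfl⟩, ?_⟩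
    funext i
    by_cases h : i = j
    · subst h; simp [insertAt]
    · simp [insertAt, dropAt, h]
  · refine ⟨_, ⟨q - χ j, k, j, i, rfl⟩, ?_⟩
    funext l
    by_cases h : l = j
    · subst h; simp [insertAt, Pi.single_eq_of_ne i.2.symm]
    · by_cases hl : l = i
      · subst hl; simp [insertAt, dropAt, h]
      · have : (⟨l, h⟩ : {i : Fin n // i ≠ j}) ≠ i := fun h => hl (congrArg Subtype.val h)
        simp [insertAt, dropAt, h, hl, this]

theorem mem_aliceQuestions (hn : 0 < n) {χ : Question n} (h : χ ∈ S) : χ ∈ aliceQuestions S := by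
  rw [← insertAt_dropAt ⟨0, hn⟩ χ]
  exact insertAt_mem_aliceQuestions (dropAt_mem_otherQuestions h _) _

/-- The question with `p` at position `i` and `q` at position `j`. -/
def twoQuestion (χ : Question n) (i j : Fin n) (p q : Fin 5) : Question n :=
  Function.update (Function.update χ i p) j q

theorem twoQuestion_eq_insertAt_right (χ : Question n) (i j : Fin n) (p q : Fin 5) :
    twoQuestion χ i j p q = insertAt j q (dropAt j (Function.update χ i p)) := by
  funext k
  by_cases h : k = j
  · subst h; simp [twoQuestion, insertAt]
  · simp [twoQuestion, insertAt, dropAt, h]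

theorem twoQuestion_eq_insertAt_left (χ : Question n) {i j : Fin n} (hij : i ≠ j) (p q : Fin 5) :
    twoQuestion χ i j p q = insertAt i p (dropAt i (Function.update χ j q)) := by
  rw [twoQuestion, Function.update_comm hij]
  exact twoQuestion_eq_insertAt_right χ j i q p

end Questions

/-! ### Consequences of saturated correlations -/

namespace Experiment

variable {n : ℕ} {S : Set (Question n)}
  {A : Type u} [NormedAddCommGroup A] [InnerProductSpace ℂ A] [CompleteSpace A]
  {B : Type v} [NormedAddCommGroup B] [InnerProductSpace ℂ B] [CompleteSpace B]
  (E : Experiment S A B)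

/-- The shared state. -/
def state : Joint A B := E.ψ

theorem norm_state : ‖E.state‖ = 1 := E.norm_ψ

theorem expect_eq (X : A →L[ℂ] A) (Y : B →L[ℂ] B) :
    E.expect X Y = (inner ℂ E.state (opA X (opB Y E.state))).re :=
  (congrArg (fun w => (inner ℂ E.ψ w).re) (opA_opB X Y E.ψ)).symm

theorem norm_sub_sq {X : A →L[ℂ] A} (hX : IsSelfAdjoint X) (hXX : X * X = 1) (Y : B →L[ℂ] B) :
    ‖opA X E.state - opB Y E.state‖ ^ 2 = 1 - 2 * E.expect X Y + ‖opB Y E.state‖ ^ 2 := by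
  rw [_root_.norm_sub_sq (𝕜 := ℂ), norm_opA_of_star_mul_self (by rw [hX.star_eq, hXX]),
    E.norm_state, inner_opA, hX.star_eq, E.expect_eq]
  simp

theorem expect_ofReal_smul (X : A →L[ℂ] A) (c : ℝ) (Y : B →L[ℂ] B) :
    E.expect X ((c : ℂ) • Y) = c * E.expect X Y := by
  rw [expect_eq, expect_eq, map_smul, smul_apply, map_smul, inner_smul_right]
  exact Complex.re_ofReal_mul _ _

/-- The operator `(D + E) / √2`. -/
def plus (D E : B →L[ℂ] B) : B →L[ℂ] B := ((Real.sqrt 2 : ℂ)⁻¹) • (D + E)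

/-- The operator `(D - E) / √2`. -/
def minus (D E : B →L[ℂ] B) : B →L[ℂ] B := ((Real.sqrt 2 : ℂ)⁻¹) • (D - E)

section PlusMinus

variable {D E : B →L[ℂ] B}

theorem isSelfAdjoint_plus (hD : IsSelfAdjoint D) (hE : IsSelfAdjoint E) :
    IsSelfAdjoint (plus D E) := by
  rw [IsSelfAdjoint, plus, star_smul, (hD.add hE).star_eq]; simp

theorem isSelfAdjoint_minus (hD : IsSelfAdjoint D) (hE : IsSelfAdjoint E) :
    IsSelfAdjoint (minus D E) := by
  rw [IsSelfAdjoint, minus, star_smul, (hD.sub hE).star_eq]; simp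

theorem norm_inv_sqrt_two_le : ‖(Real.sqrt 2 : ℂ)⁻¹‖ ≤ 1 := by
  rw [norm_inv, Complex.norm_real, Real.norm_of_nonneg (Real.sqrt_nonneg _)]
  exact inv_le_one_of_one_le₀ (Real.one_le_sqrt.2 one_le_two)

theorem norm_plus_le (hD : ‖D‖ ≤ 1) (hE : ‖E‖ ≤ 1) : ‖plus D E‖ ≤ 2 := by
  rw [plus, norm_smul]
  nlinarith [norm_add_le D E, norm_inv_sqrt_two_le, norm_nonneg (D + E)]

theorem norm_minus_le (hD : ‖D‖ ≤ 1) (hE : ‖E‖ ≤ 1) : ‖minus D E‖ ≤ 2 := by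
  rw [minus, norm_smul]
  nlinarith [norm_sub_le D E, norm_inv_sqrt_two_le, norm_nonneg (D - E)]

omit [CompleteSpace B] in
theorem plus_mul_minus (hD : D * D = 1) (hE : E * E = 1) :
    plus D E * minus D E + minus D E * plus D E = 0 := by
  rw [plus, minus, smul_mul_smul_comm, smul_mul_smul_comm, ← smul_add, add_mul, sub_mul, mul_sub,
    mul_sub, mul_add, mul_add, hD, hE]
  rw [show (1 - D * E + (E * D - 1) + (1 + D * E - (E * D + 1)) : B →L[ℂ] B) = 0 by abel, smul_zero]

omit [CompleteSpace B] in
theorem plus_plus_minus : plus (plus D E) (minus D E) = D := by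
  rw [plus, plus, minus, ← smul_add, smul_smul, inv_sqrt_two_mul_self,
    show D + E + (D - E) = (2 : ℂ) • D by rw [two_smul]; abel, smul_smul]
  norm_num

omit [CompleteSpace B] in
theorem minus_plus_minus : minus (plus D E) (minus D E) = E := by
  rw [minus, plus, minus, ← smul_sub, smul_smul, inv_sqrt_two_mul_self,
    show D + E - (D - E) = (2 : ℂ) • E by rw [two_smul]; abel, smul_smul]
  norm_num

omit [CompleteSpace A] in
theorem norm_plus_sq_add_norm_minus_sq (hD : IsSelfAdjoint D) (hE : IsSelfAdjoint E)
    (hDD : D * D = 1) (hEE : E * E = 1) (w : Joint A B) :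
    ‖opB (plus D E) w‖ ^ 2 + ‖opB (minus D E) w‖ ^ 2 = 2 * ‖w‖ ^ 2 := by
  have h1 := norm_opB_of_star_mul_self (A := A) (by rw [hD.star_eq, hDD]) w
  have h2 := norm_opB_of_star_mul_self (A := A) (by rw [hE.star_eq, hEE]) w
  have h3 := parallelogram_law_with_norm ℂ (opB D w) (opB E w)
  have h4 : ‖(Real.sqrt 2 : ℂ)⁻¹‖ ^ 2 = 1 / 2 := by
    rw [norm_inv, Complex.norm_real, Real.norm_of_nonneg (Real.sqrt_nonneg _), inv_pow,
      Real.sq_sqrt zero_le_two, one_div]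
  have h5 : ∀ (Y : B →L[ℂ] B), ‖opB ((Real.sqrt 2 : ℂ)⁻¹ • Y) w‖ ^ 2 = 1 / 2 * ‖opB Y w‖ ^ 2 := by
    intro Y
    rw [map_smul]
    change ‖(Real.sqrt 2 : ℂ)⁻¹ • opB Y w‖ ^ 2 = _
    rw [norm_smul, mul_pow, h4]
  rw [plus, minus, h5, h5, map_add, map_sub]
  change 1 / 2 * ‖opB D w + opB E w‖ ^ 2 + 1 / 2 * ‖opB D w - opB E w‖ ^ 2 = _
  rw [h1, h2] at h3
  linarith

theorem expect_plus (F : Experiment S A B) (X : A →L[ℂ] A) :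
    F.expect X (plus D E) = (Real.sqrt 2)⁻¹ * F.expect X (D + E) := by
  rw [plus, ← expect_ofReal_smul]; simp

theorem expect_minus (F : Experiment S A B) (X : A →L[ℂ] A) :
    F.expect X (minus D E) = (Real.sqrt 2)⁻¹ * F.expect X (D - E) := by
  rw [minus, ← expect_ofReal_smul]; simp

end PlusMinus

end Experiment

theorem norm_mul_mul_add_one_le {H : Type*} [NormedAddCommGroup H] [NormedSpace ℂ H] {ψ : H}
    {X T W : Fin 3 → H →L[ℂ] H} {d e : ℝ} (hX : ∀ p, ‖X p‖ ≤ 1) (hT : ∀ p, ‖T p‖ ≤ 1)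
    (hW : ∀ p, ‖W p‖ ≤ 1) (cT : ∀ p q, Commute (T p) (X q)) (cW : ∀ p q, Commute (W p) (X q))
    (mul : W 0 * W 1 * W 2 = -1) (h : ∀ p, ‖X p ψ - T p ψ‖ ≤ d) (h' : ∀ p, ‖X p ψ - W p ψ‖ ≤ e) :
    ‖(T 0 * T 1 * T 2 + 1) ψ‖ ≤ 3 * e + 3 * d := by
  have e1 := norm_mul_mul_sub_le (hX 1) (hX 2) (hT 0) (hT 1) (cT 0 1) (cT 0 2) (cT 1 2)
    (h 0) (h 1) (h 2)
  have e2 := norm_mul_mul_sub_le (hX 1) (hX 2) (hW 0) (hW 1) (cW 0 1) (cW 0 2) (cW 1 2)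
    (h' 0) (h' 1) (h' 2)
  rw [mul] at e2
  have h : (T 0 * T 1 * T 2 + 1) ψ = ((X 2 * X 1 * X 0) ψ - (-1 : H →L[ℂ] H) ψ) -
      ((X 2 * X 1 * X 0) ψ - (T 0 * T 1 * T 2) ψ) := by
    change (T 0 * T 1 * T 2) ψ + ψ = (X 2 * X 1 * X 0) ψ - -ψ - _
    abel
  rw [h]
  exact (norm_sub_le _ _).trans (add_le_add e2 e1)

/-! ### Signed sums of projections -/

section SignedSum

variable {H : Type*} [NormedAddCommGroup H] [InnerProductSpace ℂ H] [CompleteSpace H]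
  {m : ℕ} {P : (Fin m → Fin 4) → H →L[ℂ] H} (hP : IsProjectiveMeasurement P) (k : Fin m)

/-- The operator with eigenvalue `(-1)^{[q = 1]}, (-1)^{[q = 0]}, (-1)^{[q = 2]}, -1` for the
results `0, 1, 2, 3`. -/
def signedSum (Γ : Fin 4 → H →L[ℂ] H) (q : Fin 5) : H →L[ℂ] H :=
  iversonSign (q = 1) • Γ 0 + iversonSign (q = 0) • Γ 1 + iversonSign (q = 2) • Γ 2 - Γ 3

include hP

theorem signedSum_marginal (q : Fin 5) : signedSum (marginal P k) q =
    hP.diag fun a => ![iversonSign (q = 1), iversonSign (q = 0), iversonSign (q = 2), -1] (a k) := by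
  simp only [signedSum, marginal_eq_diag hP, ← map_smul, ← map_add, ← map_sub]
  congr 1; funext a
  simp only [Pi.add_apply, Pi.sub_apply, Pi.smul_apply]
  generalize a k = b
  fin_cases b <;> simp

theorem isSelfAdjoint_signedSum (q : Fin 5) : IsSelfAdjoint (signedSum (marginal P k) q) := by
  rw [IsSelfAdjoint, signedSum_marginal hP, hP.star_diag]
  congr 1; funext a
  rw [Pi.star_apply]
  generalize a k = b
  fin_cases b <;> simp [iversonSign] <;> split_ifs <;> simp

theorem signedSum_mul_self (q : Fin 5) :
    signedSum (marginal P k) q * signedSum (marginal P k) q = 1 := by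
  rw [signedSum_marginal hP, ← map_mul, ← map_one hP.diag]
  congr 1; funext a
  rw [Pi.mul_apply]
  generalize a k = b
  fin_cases b <;> simp [iversonSign] <;> split_ifs <;> simp

theorem signedSum_mul_mul : signedSum (marginal P k) 0 * signedSum (marginal P k) 1 *
    signedSum (marginal P k) 2 = -1 := by
  rw [signedSum_marginal hP, signedSum_marginal hP, signedSum_marginal hP, ← map_mul, ← map_mul,
    ← map_one hP.diag, ← map_neg]
  congr 1; funext a
  rw [Pi.mul_apply, Pi.mul_apply]
  generalize a k = b
  fin_cases b <;> simp [iversonSign]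

end SignedSum

namespace Experiment

variable {n : ℕ} {S : Set (Question n)}
  {A : Type u} [NormedAddCommGroup A] [InnerProductSpace ℂ A] [CompleteSpace A]
  {B : Type v} [NormedAddCommGroup B] [InnerProductSpace ℂ B] [CompleteSpace B]
  (E : Experiment S A B)

theorem Γ_spec (j : Fin n) (hj : (j : ℕ) + 1 < n) :
    (∀ q, IsSelfAdjoint (signedSum (E.Γ j hj) q)) ∧
    (∀ q, signedSum (E.Γ j hj) q * signedSum (E.Γ j hj) q = 1) ∧
    signedSum (E.Γ j hj) 0 * signedSum (E.Γ j hj) 1 * signedSum (E.Γ j hj) 2 = -1 := by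
  by_cases h : (j : ℕ) % 2 = 0
  · have : E.Γ j hj = marginal E.bobWhite ⟨(j : ℕ) / 2, by omega⟩ := by
      funext b; simp [Γ, h]
    rw [this]
    exact ⟨isSelfAdjoint_signedSum E.bobWhite_proj _, signedSum_mul_self E.bobWhite_proj _,
      signedSum_mul_mul E.bobWhite_proj _⟩
  · have : E.Γ j hj = marginal E.bobBlack ⟨(j : ℕ) / 2, by omega⟩ := by
      funext b; simp [Γ, h]
    rw [this]
    exact ⟨isSelfAdjoint_signedSum E.bobBlack_proj _, signedSum_mul_self E.bobBlack_proj _,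
      signedSum_mul_mul E.bobBlack_proj _⟩

theorem norm_sub_le_of_expect {X : A →L[ℂ] A} {Y : B →L[ℂ] B} (hX : IsSelfAdjoint X)
    (hXX : X * X = 1) (hY : IsSelfAdjoint Y) (hYY : Y * Y = 1) {e : ℝ}
    (h : 1 - e / 2 ≤ E.expect X Y) : ‖opA X E.state - opB Y E.state‖ ≤ √e := by
  refine Real.le_sqrt_of_sq_le ?_
  rw [E.norm_sub_sq hX hXX, norm_opB_of_star_mul_self (by rw [hY.star_eq, hYY]), E.norm_state]
  linarith

theorem norm_sub_le_of_expect_add {D F : B →L[ℂ] B} (hD : IsSelfAdjoint D) (hF : IsSelfAdjoint F)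
    (hDD : D * D = 1) (hFF : F * F = 1) {X₁ X₂ : A →L[ℂ] A} (h₁ : IsSelfAdjoint X₁)
    (h₁' : X₁ * X₁ = 1) (h₂ : IsSelfAdjoint X₂) (h₂' : X₂ * X₂ = 1) :
    ‖opA X₁ E.state - opB (plus D F) E.state‖ ^ 2 + ‖opA X₂ E.state - opB (minus D F) E.state‖ ^ 2
      = 4 - √2 * (E.expect X₁ (D + F) + E.expect X₂ (D - F)) := by
  have h := norm_plus_sq_add_norm_minus_sq hD hF hDD hFF E.state
  have h2 : √2 = 2 * (√2)⁻¹ := by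
    rw [eq_mul_inv_iff_mul_eq₀ (by positivity)]; exact Real.mul_self_sqrt zero_le_two
  rw [E.norm_sub_sq h₁ h₁', E.norm_sub_sq h₂ h₂', expect_plus, expect_minus]
  rw [E.norm_state] at h
  linear_combination h + h2 * (E.expect X₁ (D + F) + E.expect X₂ (D - F))

variable {E} {ε : ℝ≥0} {χ₀ : Question n}

theorem isSelfAdjoint_obsA {x : Question n} (hx : x ∈ aliceQuestions S) (j : Fin n) :
    IsSelfAdjoint (E.obsA x j) := isSelfAdjoint_observable (E.alice_proj x hx) j

theorem obsA_mul_self {x : Question n} (hx : x ∈ aliceQuestions S) (j : Fin n) :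
    E.obsA x j * E.obsA x j = 1 := observable_mul_self (E.alice_proj x hx) j

theorem Saturated.norm_obsAt_sub_le (hE : E.Saturated ε χ₀) {j : Fin n}
    {r : {i : Fin n // i ≠ j} → Fin 5} (hr : r ∈ otherQuestions S j) :
    (‖opA (E.obsAt j 2 r) E.state - opB (plus (E.Dzx j) (E.Ezx j)) E.state‖ ≤ √ε ∧
     ‖opA (E.obsAt j 0 r) E.state - opB (minus (E.Dzx j) (E.Ezx j)) E.state‖ ≤ √ε) ∧
    (‖opA (E.obsAt j 2 r) E.state - opB (plus (E.Dzy j) (E.Ezy j)) E.state‖ ≤ √ε ∧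
     ‖opA (E.obsAt j 1 r) E.state - opB (minus (E.Dzy j) (E.Ezy j)) E.state‖ ≤ √ε) ∧
    (‖opA (E.obsAt j 0 r) E.state - opB (plus (E.Dxy j) (E.Exy j)) E.state‖ ≤ √ε ∧
     ‖opA (E.obsAt j 1 r) E.state - opB (minus (E.Dxy j) (E.Exy j)) E.state‖ ≤ √ε) := by
  have sa : ∀ q, IsSelfAdjoint (E.obsAt j q r) := fun q =>
    isSelfAdjoint_obsA (insertAt_mem_aliceQuestions hr q) j
  have sq : ∀ q, E.obsAt j q r * E.obsAt j q r = 1 := fun q =>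
    obsA_mul_self (insertAt_mem_aliceQuestions hr q) j
  have sb := fun y => isSelfAdjoint_observable (E.bob_proj y) j
  have sqb := fun y => observable_mul_self (E.bob_proj y) j
  have h₁ := E.norm_sub_le_of_expect_add (sb 0) (sb 1) (sqb 0) (sqb 1) (sa 2) (sq 2) (sa 0) (sq 0)
  have h₂ := E.norm_sub_le_of_expect_add (sb 2) (sb 3) (sqb 2) (sqb 3) (sa 2) (sq 2) (sa 1) (sq 1)
  have h₃ := E.norm_sub_le_of_expect_add (sb 4) (sb 5) (sqb 4) (sqb 5) (sa 0) (sq 0) (sa 1) (sq 1)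
  have h := hE.triple_chsh j r hr
  have hs : √2 * E.tripleCHSH j r ≥ 12 - ε := by
    have h2 : √2 * √2 = 2 := Real.mul_self_sqrt zero_le_two
    have h3 : √2 * (6 * √2 - ε / √2) = 12 - ε := by
      rw [mul_sub, mul_div_cancel₀ _ (by positivity)]; linear_combination 6 * h2
    rw [← h3]
    exact mul_le_mul_of_nonneg_left h (Real.sqrt_nonneg _)
  rw [tripleCHSH] at hs
  change _ = 4 - √2 * (E.expect _ (E.Dzx j + E.Ezx j) + E.expect _ (E.Dzx j - E.Ezx j)) at h₁
  change _ = 4 - √2 * (E.expect _ (E.Dzy j + E.Ezy j) + E.expect _ (E.Dzy j - E.Ezy j)) at h₂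
  change _ = 4 - √2 * (E.expect _ (E.Dxy j + E.Exy j) + E.expect _ (E.Dxy j - E.Exy j)) at h₃
  refine ⟨⟨?_, ?_⟩, ⟨?_, ?_⟩, ?_, ?_⟩ <;> refine Real.le_sqrt_of_sq_le ?_
  all_goals
    simp only [← Dzx.eq_1, ← Ezx.eq_1, ← Dzy.eq_1, ← Ezy.eq_1, ← Dxy.eq_1, ← Exy.eq_1] at h₁ h₂ h₃
    linarith [sq_nonneg ‖opA (E.obsAt j 2 r) E.state - opB (plus (E.Dzx j) (E.Ezx j)) E.state‖,
      sq_nonneg ‖opA (E.obsAt j 0 r) E.state - opB (minus (E.Dzx j) (E.Ezx j)) E.state‖,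
      sq_nonneg ‖opA (E.obsAt j 2 r) E.state - opB (plus (E.Dzy j) (E.Ezy j)) E.state‖,
      sq_nonneg ‖opA (E.obsAt j 1 r) E.state - opB (minus (E.Dzy j) (E.Ezy j)) E.state‖,
      sq_nonneg ‖opA (E.obsAt j 0 r) E.state - opB (plus (E.Dxy j) (E.Exy j)) E.state‖,
      sq_nonneg ‖opA (E.obsAt j 1 r) E.state - opB (minus (E.Dxy j) (E.Exy j)) E.state‖]

variable [FiniteDimensional ℂ B]

variable (E) in
/-- Bob's regularized observables for `σ_x, σ_y, σ_z`. -/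
def paulis (j : Fin n) : Fin 3 → B →L[ℂ] B := ![E.T₁ j, E.T₂ j, E.T₃ j]

theorem isSelfAdjoint_paulis (j : Fin n) (p : Fin 3) : IsSelfAdjoint (E.paulis j p) := by
  have sb := fun y => isSelfAdjoint_observable (E.bob_proj y) j
  fin_cases p
  · exact isSelfAdjoint_regularize (isSelfAdjoint_plus (sb 4) (sb 5))
  · exact isSelfAdjoint_regularize (isSelfAdjoint_minus (sb 4) (sb 5))
  · exact isSelfAdjoint_regularize (isSelfAdjoint_plus (sb 0) (sb 1))

theorem paulis_mul_self (j : Fin n) (p : Fin 3) : E.paulis j p * E.paulis j p = 1 := by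
  have sb := fun y => isSelfAdjoint_observable (E.bob_proj y) j
  fin_cases p
  · exact regularize_mul_self (isSelfAdjoint_plus (sb 4) (sb 5))
  · exact regularize_mul_self (isSelfAdjoint_minus (sb 4) (sb 5))
  · exact regularize_mul_self (isSelfAdjoint_plus (sb 0) (sb 1))

variable (E) in
/-- Bob's regularized observables on the shared space. -/
abbrev opPauli (j : Fin n) (p : Fin 3) : Joint A B →L[ℂ] Joint A B := opB (E.paulis j p)

theorem norm_paulis_le (j : Fin n) (p : Fin 3) : ‖E.opPauli j p‖ ≤ 1 :=
  (norm_opB_le _).trans (norm_le_one_of_isSelfAdjoint (isSelfAdjoint_paulis j p)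
    (paulis_mul_self j p))

omit [FiniteDimensional ℂ B] in
theorem norm_obsA_le {x : Question n} (hx : x ∈ aliceQuestions S) (j : Fin n) :
    ‖(opA (E.obsA x j) : Joint A B →L[ℂ] Joint A B)‖ ≤ 1 :=
  (norm_opA_le _).trans (norm_observable_le (E.alice_proj x hx) j)

theorem norm_opA_sub_opB_regularize_le {X : A →L[ℂ] A} {Y : B →L[ℂ] B}
    (hX : IsSelfAdjoint X) (hXX : X * X = 1) (hY : IsSelfAdjoint Y) (hY2 : ‖Y‖ ≤ 2) {d : ℝ}
    {w : Joint A B} (h : ‖opA X w - opB Y w‖ ≤ d) :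
    ‖opA X w - opB (regularize Y) w‖ ≤ 4 * d := by
  obtain ⟨c, hc, h'⟩ := exists_regularize_sub hY
  refine norm_sub_regularize_le (c := opB c) ?_ ((norm_opA_le X).trans
    (norm_le_one_of_isSelfAdjoint hX hXX)) (Commute.symm (commute_opB_opA X Y)) ((norm_opB_le Y).trans hY2)
    ((norm_opB_le c).trans hc) ?_ h
  · rw [← map_mul, hXX, map_one]
  · rw [← map_sub, h', map_mul, map_sub, map_mul, map_one]

/-- The labels of the three Pauli observables. -/
def pauliLabel : Fin 3 → Fin 5 := ![0, 1, 2]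

theorem Saturated.norm_obsAt_sub_paulis_le (hE : E.Saturated ε χ₀) {j : Fin n}
    {r : {i : Fin n // i ≠ j} → Fin 5} (hr : r ∈ otherQuestions S j) (p : Fin 3) :
    ‖opA (E.obsAt j (pauliLabel p) r) E.state - opB (E.paulis j p) E.state‖ ≤ 4 * √ε := by
  have sa : ∀ q, IsSelfAdjoint (E.obsAt j q r) := fun q =>
    isSelfAdjoint_obsA (insertAt_mem_aliceQuestions hr q) j
  have sq : ∀ q, E.obsAt j q r * E.obsAt j q r = 1 := fun q =>
    obsA_mul_self (insertAt_mem_aliceQuestions hr q) j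
  have sb := fun y => isSelfAdjoint_observable (E.bob_proj y) j
  have nb := fun y => norm_observable_le (E.bob_proj y) j
  obtain ⟨⟨h1, -⟩, -, h2, h3⟩ := hE.norm_obsAt_sub_le hr
  fin_cases p
  · exact norm_opA_sub_opB_regularize_le (sa _) (sq _) (isSelfAdjoint_plus (sb 4) (sb 5))
      (norm_plus_le (nb 4) (nb 5)) h2
  · exact norm_opA_sub_opB_regularize_le (sa _) (sq _) (isSelfAdjoint_minus (sb 4) (sb 5))
      (norm_minus_le (nb 4) (nb 5)) h3
  · exact norm_opA_sub_opB_regularize_le (sa _) (sq _) (isSelfAdjoint_plus (sb 0) (sb 1))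
      (norm_plus_le (nb 0) (nb 1)) h1

theorem Saturated.norm_anticommutator_paulis_le (hE : E.Saturated ε χ₀) (hS : S.Nonempty)
    (j : Fin n) {p q : Fin 3} (hpq : p ≠ q) :
    ‖(E.opPauli j p * E.opPauli j q + E.opPauli j q * E.opPauli j p)
      E.state‖ ≤ 22 * √ε := by
  obtain ⟨χ, hχ⟩ := hS
  have hr := dropAt_mem_otherQuestions hχ j
  have key : ∀ (p q : Fin 3) (y y' : Fin 6),
      ‖opA (E.obsAt j (pauliLabel p) (dropAt j χ)) E.state -
        opB (plus (observable (E.bob y) j) (observable (E.bob y') j)) E.state‖ ≤ √ε →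
      ‖opA (E.obsAt j (pauliLabel q) (dropAt j χ)) E.state -
        opB (minus (observable (E.bob y) j) (observable (E.bob y') j)) E.state‖ ≤ √ε →
      ‖(E.opPauli j p * E.opPauli j q + E.opPauli j q * E.opPauli j p)
        E.state‖ ≤ 22 * √ε := by
    intro p q y y' h h'
    refine norm_anticommutator_le
      (norm_obsA_le (insertAt_mem_aliceQuestions hr _) j)
      (norm_obsA_le (insertAt_mem_aliceQuestions hr _) j)
      ((norm_opB_le _).trans (norm_plus_le (norm_observable_le (E.bob_proj y) j)
        (norm_observable_le (E.bob_proj y') j)))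
      ((norm_opB_le _).trans (norm_minus_le (norm_observable_le (E.bob_proj y) j)
        (norm_observable_le (E.bob_proj y') j)))
      (norm_paulis_le j p) (norm_paulis_le j q) (commute_opB_opA _ _) (commute_opB_opA _ _)
      (commute_opB_opA _ _) (commute_opB_opA _ _) ?_ h h' (hE.norm_obsAt_sub_paulis_le hr p)
      (hE.norm_obsAt_sub_paulis_le hr q)
    rw [← map_mul, ← map_mul, ← map_add, plus_mul_minus (observable_mul_self (E.bob_proj y) j)
        (observable_mul_self (E.bob_proj y') j), map_zero]
  obtain ⟨⟨h1, h2⟩, ⟨h3, h4⟩, h5, h6⟩ := hE.norm_obsAt_sub_le hr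
  have k01 := key 0 1 4 5 h5 h6
  have k20 := key 2 0 0 1 h1 h2
  have k21 := key 2 1 2 3 h3 h4
  have cm : ∀ x y : Joint A B →L[ℂ] Joint A B, x * y + y * x = y * x + x * y :=
    fun x y => add_comm _ _
  fin_cases p <;> fin_cases q
  · exact absurd rfl hpq
  · exact k01
  · rw [cm]; exact k20
  · rw [cm]; exact k01
  · exact absurd rfl hpq
  · rw [cm]; exact k21
  · exact k20
  · exact k21
  · exact absurd rfl hpq

omit [CompleteSpace A] [CompleteSpace B] [FiniteDimensional ℂ B] in
theorem commute_opA {X Y : A →L[ℂ] A} (h : Commute X Y) :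
    Commute (opA X : Joint A B →L[ℂ] Joint A B) (opA Y) := h.map opA

theorem Saturated.norm_twoQuestion_left_sub_le (hE : E.Saturated ε χ₀) {χ : Question n}
    (hχ : χ ∈ S) {i j : Fin n} (hij : i ≠ j) (p q : Fin 3) :
    ‖opA (E.obsA (twoQuestion χ i j (pauliLabel p) (pauliLabel q)) i) E.state -
      opB (E.paulis i p) E.state‖ ≤ 4 * √ε := by
  rw [twoQuestion_eq_insertAt_left χ hij]
  exact hE.norm_obsAt_sub_paulis_le (dropAt_update_mem_otherQuestions hχ _ _ _) p

theorem Saturated.norm_twoQuestion_right_sub_le (hE : E.Saturated ε χ₀) {χ : Question n}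
    (hχ : χ ∈ S) (i j : Fin n) (p q : Fin 3) :
    ‖opA (E.obsA (twoQuestion χ i j (pauliLabel p) (pauliLabel q)) j) E.state -
      opB (E.paulis j q) E.state‖ ≤ 4 * √ε := by
  rw [twoQuestion_eq_insertAt_right χ]
  exact hE.norm_obsAt_sub_paulis_le (dropAt_update_mem_otherQuestions hχ _ _ _) q

omit [FiniteDimensional ℂ B] in
theorem twoQuestion_mem {χ : Question n} (hχ : χ ∈ S) (i j : Fin n) (p q : Fin 5) :
    twoQuestion χ i j p q ∈ aliceQuestions S := by
  rw [twoQuestion_eq_insertAt_right χ]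
  exact insertAt_mem_aliceQuestions (dropAt_update_mem_otherQuestions hχ _ _ _) _

theorem Saturated.norm_commutator_paulis_le (hE : E.Saturated ε χ₀) (hS : S.Nonempty)
    {i j : Fin n} (hij : i ≠ j) (p q : Fin 3) :
    ‖(E.opPauli i p * E.opPauli j q - E.opPauli j q * E.opPauli i p)
      E.state‖ ≤ 16 * √ε := by
  obtain ⟨χ, hχ⟩ := hS
  have hx := twoQuestion_mem hχ i j (pauliLabel p) (pauliLabel q)
  exact norm_commutator_le (norm_obsA_le hx i) (norm_obsA_le hx j) (norm_paulis_le i p)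
    (norm_paulis_le j q) (commute_opB_opA _ _) (commute_opB_opA _ _)
    (commute_opA (commute_observable (E.alice_proj _ hx) i j))
    (hE.norm_twoQuestion_left_sub_le hχ hij p q) (hE.norm_twoQuestion_right_sub_le hχ i j p q)

theorem Saturated.norm_conjugation_paulis_le (hE : E.Saturated ε χ₀) (h₀ : χ₀ ∈ S)
    (j : Fin n) (hj : (j : ℕ) + 1 < n) :
    ‖(E.opPauli ⟨j + 1, hj⟩ 0 * E.opPauli j 0 *
      (E.opPauli ⟨j + 1, hj⟩ 1 * E.opPauli j 1) *
      (E.opPauli ⟨j + 1, hj⟩ 2 * E.opPauli j 2) + 1) E.state‖ ≤ 27 * √ε := by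
  set k : Fin n := ⟨j + 1, hj⟩ with hk
  have hjk : j ≠ k := fun h => by simpa [hk] using congrArg Fin.val h
  obtain ⟨sa, sq, mul⟩ := E.Γ_spec j hj
  set x : Fin 3 → Question n := fun p => twoQuestion χ₀ j k (pauliLabel p) (pauliLabel p)
  have hx : ∀ p, x p ∈ aliceQuestions S := fun p => twoQuestion_mem h₀ j k _ _
  set α : Fin 3 → A →L[ℂ] A := fun p => E.obsA (x p) j * E.obsA (x p) k
  have hcomm : ∀ p, Commute (E.obsA (x p) j) (E.obsA (x p) k) := fun p =>
    commute_observable (E.alice_proj _ (hx p)) j k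
  have saα : ∀ p, IsSelfAdjoint (α p) := fun p => by
    change star (E.obsA (x p) j * E.obsA (x p) k) = E.obsA (x p) j * E.obsA (x p) k
    rw [star_mul, (isSelfAdjoint_obsA (hx p) j).star_eq,
      (isSelfAdjoint_obsA (hx p) k).star_eq, (hcomm p).eq]
  have sqα : ∀ p, α p * α p = 1 := fun p => by
    change E.obsA (x p) j * E.obsA (x p) k * (E.obsA (x p) j * E.obsA (x p) k) = 1
    rw [← mul_assoc, mul_assoc (E.obsA (x p) j), ← (hcomm p).eq, ← mul_assoc,
      obsA_mul_self (hx p), one_mul, obsA_mul_self (hx p)]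
  have nα : ∀ p, ‖(opA (α p) : Joint A B →L[ℂ] Joint A B)‖ ≤ 1 := fun p =>
    (norm_opA_le _).trans (norm_le_one_of_isSelfAdjoint (saα p) (sqα p))
  have hW : ∀ p, ‖opA (α p) E.state - opB (signedSum (E.Γ j hj) (pauliLabel p)) E.state‖ ≤ √ε := by
    intro p
    refine E.norm_sub_le_of_expect (saα p) (sqα p) (sa _) (sq _) ?_
    exact hE.conjugation j hj (pauliLabel p) (by fin_cases p <;> simp [pauliLabel])
  have nW : ∀ q, ‖(opB (signedSum (E.Γ j hj) q) : Joint A B →L[ℂ] Joint A B)‖ ≤ 1 := fun q =>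
    (norm_opB_le _).trans (norm_le_one_of_isSelfAdjoint (sa q) (sq q))
  have hT : ∀ p, ‖opA (α p) E.state - (E.opPauli k p * E.opPauli j p) E.state‖
      ≤ 8 * √ε := by
    intro p
    have : ‖opA (α p) E.state - (E.opPauli k p * E.opPauli j p) E.state‖ ≤
        1 * (4 * √ε) + 4 * √ε := by
      rw [show (opA (α p) : Joint A B →L[ℂ] Joint A B) =
        opA (E.obsA (x p) j) * opA (E.obsA (x p) k) from map_mul _ _ _]
      exact norm_mul_sub_mul_le (norm_obsA_le (hx p) j) (norm_paulis_le k p)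
        (commute_opB_opA _ _) (hE.norm_twoQuestion_right_sub_le h₀ j k p p)
        (hE.norm_twoQuestion_left_sub_le h₀ hjk p p)
    linarith
  have nT : ∀ p, ‖(E.opPauli k p * E.opPauli j p)‖ ≤ 1 :=
    fun p => (norm_mul_le _ _).trans
      (mul_le_one₀ (norm_paulis_le k p) (norm_nonneg _) (norm_paulis_le j p))
  have cT : ∀ p q, Commute (E.opPauli k p * E.opPauli j p)
      (opA (α q)) := fun p q => (commute_opB_opA _ _).mul_left (commute_opB_opA _ _)
  refine (norm_mul_mul_add_one_le (X := fun p => opA (α p))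
    (T := fun p => E.opPauli k p * E.opPauli j p)
    (W := fun p => opB (signedSum (E.Γ j hj) (pauliLabel p))) nα nT (fun p => nW _) cT
    (fun _ _ => commute_opB_opA _ _) ?_ hT hW).trans_eq (by ring)
  rw [← map_mul, ← map_mul, ← map_one opB, ← map_neg]
  exact congrArg opB mul

theorem Saturated.norm_obsA_sub_sigmaElt_le (hE : E.Saturated ε χ₀) {χ : Question n}
    (hχ : χ ∈ S) (j : Fin n) :
    ‖opA (E.obsA χ j) E.state - opB (sigmaElt (E.paulis j) (χ j)) E.state‖ ≤ 12 * √ε := by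
  have hr := dropAt_mem_otherQuestions hχ j
  have hs := Real.sqrt_nonneg ε
  have key : ∀ q, ‖opA (E.obsAt j q (dropAt j χ)) E.state -
      opB (sigmaElt (E.paulis j) q) E.state‖ ≤ 12 * √ε := by
    have h0 := fun p => hE.norm_obsAt_sub_paulis_le hr p
    obtain ⟨-, -, h1, h2⟩ := hE.norm_obsAt_sub_le hr
    have near : ∀ p Y, ‖opA (E.obsAt j (pauliLabel p) (dropAt j χ)) E.state - opB Y E.state‖ ≤ √ε →
        ‖opB Y E.state - opB (E.paulis j p) E.state‖ ≤ 5 * √ε := by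
      intro p Y h
      rw [← sub_sub_sub_cancel_left _ _ (opA (E.obsAt j (pauliLabel p) (dropAt j χ)) E.state)]
      exact (norm_sub_le _ _).trans ((add_le_add (h0 p) h).trans_eq (by ring))
    have n1 := near 0 _ h1
    have n2 := near 1 _ h2
    have half : ∀ w w' : Joint A B, ‖w‖ ≤ 5 * √ε → ‖w'‖ ≤ 5 * √ε →
        ‖(Real.sqrt 2 : ℂ)⁻¹ • (w + w')‖ ≤ 10 * √ε := by
      intro w w' h h'
      rw [norm_smul]
      have := norm_add_le w w'
      nlinarith [norm_inv_sqrt_two_le, norm_nonneg (w + w')]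
    have hsq : √(2 * (ε : ℝ)) ≤ 2 * √ε := by
      rw [Real.sqrt_mul zero_le_two]
      refine mul_le_mul_of_nonneg_right ?_ hs
      rw [Real.sqrt_le_left zero_le_two]; norm_num
    intro q
    fin_cases q
    · exact (h0 0).trans (by linarith)
    · exact (h0 1).trans (by linarith)
    · exact (h0 2).trans (by linarith)
    · have h3 := E.norm_sub_le_of_expect (e := 2 * ε)
        (isSelfAdjoint_obsA (insertAt_mem_aliceQuestions hr 3) j)
        (obsA_mul_self (insertAt_mem_aliceQuestions hr 3) j)
        (isSelfAdjoint_observable (E.bob_proj 4) j) (observable_mul_self (E.bob_proj 4) j)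
        (le_of_eq_of_le (by ring) (hE.perfect_xPlusY χ hχ j))
      have h4 := half _ _ n1 n2
      have h5 : opB (E.Dxy j) E.state - opB (sigmaElt (E.paulis j) 3) E.state =
          (Real.sqrt 2 : ℂ)⁻¹ • (opB (plus (E.Dxy j) (E.Exy j)) E.state -
            opB (E.paulis j 0) E.state + (opB (minus (E.Dxy j) (E.Exy j)) E.state -
            opB (E.paulis j 1) E.state)) := by
        conv_lhs => rw [← plus_plus_minus (D := E.Dxy j) (E := E.Exy j)]
        change opB ((Real.sqrt 2 : ℂ)⁻¹ • (plus (E.Dxy j) (E.Exy j) +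
          minus (E.Dxy j) (E.Exy j))) E.state -
          opB ((Real.sqrt 2 : ℂ)⁻¹ • (E.paulis j 0 + E.paulis j 1)) E.state = _
        rw [map_smul, map_smul, map_add, map_add]
        simp only [smul_apply, add_apply, smul_add, smul_sub]
        abel
      rw [← sub_add_sub_cancel _ (opB (E.Dxy j) E.state)]
      refine (norm_add_le _ _).trans ((add_le_add (h3.trans hsq) (h5 ▸ h4)).trans_eq (by ring))
    · have h3 := E.norm_sub_le_of_expect (e := 2 * ε)
        (isSelfAdjoint_obsA (insertAt_mem_aliceQuestions hr 4) j)
        (obsA_mul_self (insertAt_mem_aliceQuestions hr 4) j)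
        (isSelfAdjoint_observable (E.bob_proj 5) j) (observable_mul_self (E.bob_proj 5) j)
        (le_of_eq_of_le (by ring) (hE.perfect_xMinusY χ hχ j))
      have h4 := half _ _ n1 ((norm_neg _).trans_le n2)
      have h5 : opB (E.Exy j) E.state - opB (sigmaElt (E.paulis j) 4) E.state =
          (Real.sqrt 2 : ℂ)⁻¹ • (opB (plus (E.Dxy j) (E.Exy j)) E.state -
            opB (E.paulis j 0) E.state + -(opB (minus (E.Dxy j) (E.Exy j)) E.state -
            opB (E.paulis j 1) E.state)) := by
        conv_lhs => rw [← minus_plus_minus (D := E.Dxy j) (E := E.Exy j)]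
        change opB ((Real.sqrt 2 : ℂ)⁻¹ • (plus (E.Dxy j) (E.Exy j) -
          minus (E.Dxy j) (E.Exy j))) E.state -
          opB ((Real.sqrt 2 : ℂ)⁻¹ • (E.paulis j 0 - E.paulis j 1)) E.state = _
        rw [map_smul, map_smul, map_sub, map_sub]
        simp only [smul_apply, sub_apply, smul_add, smul_sub, neg_sub]
        abel
      rw [← sub_add_sub_cancel _ (opB (E.Exy j) E.state)]
      refine (norm_add_le _ _).trans ((add_le_add (h3.trans hsq) (h5 ▸ h4)).trans_eq (by ring))
  have := key (χ j)
  rwa [obsAt, insertAt_dropAt] at this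

/-- Bob's regularized observables and Alice's observables for a special question, as an approximate
model of the Pauli relations. -/
def Saturated.model (hE : E.Saturated ε χ₀) (h₀ : χ₀ ∈ S) (hn : 0 < n) {χ : Question n}
    (hχ : χ ∈ S) : PauliModel n χ where
  H := Joint A B
  ψ := E.state
  δ := 100 * √ε
  δ_nonneg := by positivity
  t := fun j p => opB (E.paulis j p)
  a := fun j p => opA (E.obsAt j (pauliLabel p) (dropAt j χ))
  b := fun j => opA (E.obsA χ j)
  norm_t_le := norm_paulis_le
  norm_a_le := fun j _ =>
    norm_obsA_le (insertAt_mem_aliceQuestions (dropAt_mem_otherQuestions hχ j) _) j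
  norm_b_le := norm_obsA_le (mem_aliceQuestions hn hχ)
  commute_a := fun _ _ _ _ => commute_opB_opA _ _
  commute_b := fun _ _ _ => commute_opB_opA _ _
  t_mul_self := fun j p => by rw [← map_mul, paulis_mul_self, map_one]
  near_a := fun j p => (hE.norm_obsAt_sub_paulis_le (dropAt_mem_otherQuestions hχ j) p).trans
    (by linarith [Real.sqrt_nonneg ε])
  near_b := fun j => by
    have h := map_sigmaElt (opB : (B →L[ℂ] B) →ₐ[ℂ] Joint A B →L[ℂ] Joint A B) (E.paulis j) (χ j)
    refine h ▸ (hE.norm_obsA_sub_sigmaElt_le hχ j).trans (by linarith [Real.sqrt_nonneg ε])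
  anti := fun j p q hpq => (hE.norm_anticommutator_paulis_le ⟨_, hχ⟩ j hpq).trans
    (by linarith [Real.sqrt_nonneg ε])
  comm := fun i j hij p q => (hE.norm_commutator_paulis_le ⟨_, hχ⟩ hij p q).trans
    (by linarith [Real.sqrt_nonneg ε])
  conj_le := fun j hj => (hE.norm_conjugation_paulis_le h₀ j hj).trans
    (by linarith [Real.sqrt_nonneg ε])

end Experiment

/-! ### Trace norm and partial trace -/

section TraceNorm

variable {H : Type*} [NormedAddCommGroup H] [InnerProductSpace ℂ H] [FiniteDimensional ℂ H]

theorem traceNorm_le {X : H →ₗ[ℂ] H} {c : ℝ}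
    (h : ∀ Y : H →ₗ[ℂ] H, (∀ v, ‖Y v‖ ≤ ‖v‖) → ‖LinearMap.trace ℂ H (Y ∘ₗ X)‖ ≤ c) :
    traceNorm X ≤ c := by
  set hS := X.isPositive_adjoint_comp_self.isSymmetric
  set b := hS.eigenvectorBasis rfl
  set σ : Fin (Module.finrank ℂ H) → ℝ := fun i => X.singularValues i
  have hσ : ∀ i, 0 ≤ σ i := fun i => X.singularValues_nonneg i
  have hinner : ∀ i j, inner ℂ (X (b i)) (X (b j)) = if i = j then ((σ i ^ 2 : ℝ) : ℂ) else 0 := by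
    intro i j
    rw [← LinearMap.adjoint_inner_right]
    have h1 : LinearMap.adjoint X (X (b j)) = ((σ j ^ 2 : ℝ) : ℂ) • b j := by
      rw [X.sq_singularValues_fin rfl]
      exact hS.apply_eigenvectorBasis rfl j
    rw [h1, inner_smul_right, orthonormal_iff_ite.1 b.orthonormal]
    split_ifs with hij
    · rw [hij, mul_one]
    · rw [mul_zero]
  set w : Fin (Module.finrank ℂ H) → H := fun i => ((σ i : ℂ)⁻¹) • X (b i)
  have hw : Orthonormal ℂ fun i : {i // σ i ≠ 0} => w i := by
    rw [orthonormal_iff_ite]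
    intro i j
    simp only [w, inner_smul_left, inner_smul_right, hinner, Subtype.ext_iff]
    split_ifs with hij
    · have := i.2
      rw [hij]
      have := j.2
      rw [Complex.conj_inv, Complex.conj_ofReal]
      push_cast
      have h2 : (σ j : ℂ) ≠ 0 := by exact_mod_cast this
      field_simp
    · simp
  have hw0 : ∀ i, σ i = 0 → w i = 0 := fun i hi => by simp [w, hi]
  set Y : H →ₗ[ℂ] H := ∑ i, (InnerProductSpace.rankOne ℂ (b i) (w i) : H →L[ℂ] H).toLinearMap
  have hYv : ∀ v, Y v = ∑ i, inner ℂ (w i) v • b i := fun v => by simp [Y]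
  have hY : ∀ v, ‖Y v‖ ≤ ‖v‖ := by
    intro v
    have h1 : ‖Y v‖ ^ 2 = ∑ i, ‖inner ℂ (w i) v‖ ^ 2 := by
      rw [← b.sum_sq_norm_inner_right (Y v)]
      refine Finset.sum_congr rfl fun i _ => ?_
      rw [hYv, b.orthonormal.inner_right_fintype]
    have h2 : ∑ i, ‖inner ℂ (w i) v‖ ^ 2 ≤ ‖v‖ ^ 2 := by
      refine le_trans (le_of_eq ?_) (hw.sum_inner_products_le v (s := Finset.univ))
      have h3 := Finset.sum_subtype_eq_sum_filter (s := Finset.univ)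
        (fun i => ‖inner ℂ (w i) v‖ ^ 2) (p := fun i => σ i ≠ 0)
      rw [Finset.subtype_univ] at h3
      rw [h3]
      refine (Finset.sum_filter_of_ne (p := fun i => σ i ≠ 0) fun i _ hi hi' => hi ?_).symm
      simp [hw0 i hi']
    exact (sq_le_sq₀ (norm_nonneg _) (norm_nonneg _)).1 (h1.trans_le h2)
  have htr : LinearMap.trace ℂ H (Y ∘ₗ X) = ((∑ i, σ i : ℝ) : ℂ) := by
    rw [LinearMap.trace_eq_sum_inner _ b, Complex.ofReal_sum]
    refine Finset.sum_congr rfl fun i _ => ?_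
    rw [LinearMap.comp_apply, hYv, b.orthonormal.inner_right_fintype, inner_smul_left, hinner,
      if_pos rfl, Complex.conj_inv, Complex.conj_ofReal]
    by_cases hi : σ i = 0
    · simp [hi]
    · have h2 : (σ i : ℂ) ≠ 0 := by exact_mod_cast hi
      push_cast
      field_simp
  have hsum : traceNorm X = ∑ i, σ i := by
    rw [traceNorm, Finsupp.sum_of_support_subset _ (s := Finset.range (Module.finrank ℂ H)) _ _
      (by simp), Finset.sum_range]
    intro i hi
    by_contra h
    rw [Finset.mem_range, not_lt] at h
    exact (Finsupp.mem_support_iff.1 hi) (X.singularValues_of_finrank_le h)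
  have := h Y hY
  rw [htr, Complex.norm_real, ← hsum] at this
  exact (le_abs_self _).trans this

theorem trace_comp_ketbra (Y : H →ₗ[ℂ] H) (v : H) :
    LinearMap.trace ℂ H (Y ∘ₗ ketbra v) = inner ℂ v (Y v) := by
  rw [ketbra, ← InnerProductSpace.trace_rankOne]
  congr 1
  ext x
  simp

variable {K : Type*} [NormedAddCommGroup K] [InnerProductSpace ℂ K] [FiniteDimensional ℂ K]

theorem trace_comp_conjBy (Y : K →ₗ[ℂ] K) (V : H →ₗ[ℂ] K) (X : H →ₗ[ℂ] H) :
    LinearMap.trace ℂ K (Y ∘ₗ conjBy V X) =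
      LinearMap.trace ℂ H ((LinearMap.adjoint V ∘ₗ Y ∘ₗ V) ∘ₗ X) := by
  rw [conjBy, ← LinearMap.comp_assoc, ← LinearMap.comp_assoc, LinearMap.trace_comp_comm']
  simp only [LinearMap.comp_assoc]

end TraceNorm

section PartialTrace

variable {A : Type u} [NormedAddCommGroup A] [InnerProductSpace ℂ A] [FiniteDimensional ℂ A]
  {B : Type v} [NormedAddCommGroup B] [InnerProductSpace ℂ B] [FiniteDimensional ℂ B]

theorem trace_comp_partialTrace (Z : B →ₗ[ℂ] B) (F : A ⊗[ℂ] B →ₗ[ℂ] A ⊗[ℂ] B) :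
    LinearMap.trace ℂ B (Z ∘ₗ partialTrace A B F) =
      LinearMap.trace ℂ (A ⊗[ℂ] B) (Z.lTensor A ∘ₗ F) := by
  obtain ⟨x, rfl⟩ := (homTensorHomEquiv ℂ A B A B).surjective F
  induction x with
  | zero => simp
  | add x y hx hy => simp only [map_add, LinearMap.comp_add, hx, hy]
  | tmul f g =>
    have h : partialTrace A B (homTensorHomEquiv ℂ A B A B (f ⊗ₜ g)) =
        LinearMap.trace ℂ A f • g := by
      change TensorProduct.lid ℂ _ (TensorProduct.map _ _
        ((homTensorHomEquiv ℂ A B A B).symm (homTensorHomEquiv ℂ A B A B (f ⊗ₜ g)))) = _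
      rw [LinearEquiv.symm_apply_apply]; simp
    rw [h, LinearMap.comp_smul, map_smul, homTensorHomEquiv_apply,
      TensorProduct.homTensorHomMap_apply, LinearMap.lTensor_comp_map,
      LinearMap.trace_tensorProduct', smul_eq_mul]

theorem trace_comp_partialTrace_ketbra (Z : B →L[ℂ] B) (φ : Joint A B) :
    LinearMap.trace ℂ B ((Z : B →ₗ[ℂ] B) ∘ₗ partialTrace A B (ketbra (H := A ⊗[ℂ] B) φ)) =
      inner ℂ φ (opB Z φ) := by
  rw [trace_comp_partialTrace]
  refine (trace_comp_ketbra (H := A ⊗[ℂ] B) ((Z : B →ₗ[ℂ] B).lTensor A) φ).trans ?_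
  exact congrArg (inner ℂ (show A ⊗[ℂ] B from φ)) (ContinuousLinearMap.lTensor_apply Z φ).symm

theorem isPositive_partialTrace_ketbra (φ : Joint A B) :
    (partialTrace A B (ketbra (H := A ⊗[ℂ] B) φ)).IsPositive := by
  have := FiniteDimensional.complete ℂ B
  have key : ∀ x : B, ∃ r : ℝ, 0 ≤ r ∧
      inner ℂ (partialTrace A B (ketbra (H := A ⊗[ℂ] B) φ) x) x = (r : ℂ) := by
    intro x
    by_cases hx : x = 0
    · exact ⟨0, le_rfl, by simp [hx]⟩
    set R : B →L[ℂ] B := InnerProductSpace.rankOne ℂ x x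
    set P := partialTrace A B (ketbra (H := A ⊗[ℂ] B) φ)
    have h1 : LinearMap.trace ℂ B ((R : B →ₗ[ℂ] B) ∘ₗ P) = inner ℂ x (P x) := by
      rw [LinearMap.trace_comp_comm', ← trace_comp_ketbra]; rfl
    have h2 := trace_comp_partialTrace_ketbra R φ
    have h3 : star R * R = ((‖x‖ ^ 2 : ℝ) : ℂ) • R := by
      ext y
      simp [R, ContinuousLinearMap.star_eq_adjoint, inner_self_eq_norm_sq_to_K, smul_smul, mul_comm]
    have h4 : ((‖x‖ ^ 2 : ℝ) : ℂ) * inner ℂ φ (opB R φ) = ((‖opB R φ‖ ^ 2 : ℝ) : ℂ) := by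
      have := inner_opB R φ (opB R φ)
      rw [inner_self_eq_norm_sq_to_K] at this
      rw [← inner_smul_right]
      have h5 : opB (star R) (opB R φ) = ((‖x‖ ^ 2 : ℝ) : ℂ) • opB R φ := by
        change (opB (star R) * opB R : Joint A B →L[ℂ] Joint A B) φ = _
        rw [← map_mul, h3, map_smul]; rfl
      rw [← h5, ← this]; push_cast; rfl
    have hx' : ((‖x‖ ^ 2 : ℝ) : ℂ) ≠ 0 := by
      exact_mod_cast (pow_pos (norm_pos_iff.2 hx) 2).ne'
    have h5 : inner ℂ x (P x) = ((‖opB R φ‖ ^ 2 / ‖x‖ ^ 2 : ℝ) : ℂ) := by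
      rw [← h1, h2, Complex.ofReal_div, eq_div_iff hx', mul_comm, h4]
    refine ⟨‖opB R φ‖ ^ 2 / ‖x‖ ^ 2, by positivity, ?_⟩
    rw [← inner_conj_symm, h5, Complex.conj_ofReal]
  rw [LinearMap.isPositive_iff_complex]
  intro x
  obtain ⟨r, hr, h⟩ := key x
  rw [h]
  exact ⟨by simp, by simpa using hr⟩

end PartialTrace

/-! ### The circuit -/

section Circuit

variable {B : Type v} [NormedAddCommGroup B] [InnerProductSpace ℂ B] [CompleteSpace B]

omit [CompleteSpace B] in
theorem stageComponent_eq (T : Fin 3 → B →L[ℂ] B) (s t : Fin 2) :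
    stageComponent (T 0) (T 1) (T 2) s t = (stageElt T s t : B →L[ℂ] B) := by
  have h2 := inv_sqrt_two_mul_self
  have swap : ∀ w, swapStage (T 0) (T 1) w s = swapElt T s w := by
    intro w
    fin_cases s
    · simp [swapStage, controlled, hadamard, ancilla, swapElt, smul_smul, h2]
    · simp [swapStage, controlled, hadamard, ancilla, swapElt, smul_smul, h2]
  have kick : ∀ w, kickbackStage (T 2) w t = kickElt T t w := by
    intro w
    fin_cases t
    · simp [kickbackStage, controlled, hadamard, ancilla, kickElt, smul_smul, h2]
    · simp [kickbackStage, controlled, hadamard, ancilla, kickElt, smul_smul, h2,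
        ← sub_eq_add_neg]
  ext w
  change kickbackStage (T 2) (swapStage (T 0) (T 1) w s) t = kickElt T t (swapElt T s w)
  rw [kick, swap]

theorem Experiment.circuitComponent_eq [FiniteDimensional ℂ B] {n : ℕ} {S : Set (Question n)}
    {A : Type u} [NormedAddCommGroup A] [InnerProductSpace ℂ A] [CompleteSpace A]
    (E : Experiment S A B) (s t : Fin n → Fin 2) :
    E.circuitComponent s t = (circuitElt E.paulis s t : B →L[ℂ] B) := by
  have h : ∀ X : B →L[ℂ] B, (X : B →ₗ[ℂ] B) = ContinuousLinearMap.toLinearMapRingHom X :=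
    fun _ => rfl
  rw [circuitComponent, circuitElt, h, map_list_prod, List.map_reverse, List.map_ofFn]
  congr 3
  funext j
  exact stageComponent_eq (E.paulis j) (s j) (t j)

variable {T : Fin 3 → B →L[ℂ] B}

theorem sum_star_kickElt_mul (hT : ∀ p, IsSelfAdjoint (T p)) (hT2 : ∀ p, T p * T p = 1) :
    ∑ t, star (kickElt T t) * kickElt T t = 1 := by
  have hs : ∀ t, star (kickElt T t) = kickElt T t := fun t => by
    simp [kickElt, star_smul, (hT 2).star_eq]
  rw [Fin.sum_univ_two, hs, hs, kickElt, kickElt, smul_mul_smul_comm, smul_mul_smul_comm,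
    ← smul_add]
  simp only [Fin.val_zero, Fin.val_one, pow_zero, pow_one, one_smul, neg_smul, add_mul, mul_add,
    neg_mul, mul_neg, one_mul, mul_one, hT2]
  rw [show 1 + T 2 + (T 2 + 1) + (1 + -T 2 + -(T 2 + -1)) = (4 : ℂ) • (1 : B →L[ℂ] B) by
    rw [show (4 : ℂ) = 1 + 1 + 1 + 1 by norm_num]; simp only [add_smul, one_smul]; abel, smul_smul]
  norm_num

theorem star_mul_self_I_smul (hT : ∀ p, IsSelfAdjoint (T p)) (hT2 : ∀ p, T p * T p = 1) :
    star (Complex.I • (T 1 * T 0)) * (Complex.I • (T 1 * T 0)) = 1 := by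
  rw [star_smul, star_mul, (hT 0).star_eq, (hT 1).star_eq, smul_mul_smul_comm, mul_assoc,
    ← mul_assoc (T 1), hT2, one_mul, hT2]
  simp

theorem sum_star_swapElt_mul (hT : ∀ p, IsSelfAdjoint (T p)) (hT2 : ∀ p, T p * T p = 1) :
    ∑ s, star (swapElt T s) * swapElt T s = 1 := by
  have hu := star_mul_self_I_smul hT hT2
  set u := Complex.I • (T 1 * T 0) with hudef
  have h0 : swapElt T 0 = (1 / 2 : ℂ) • (1 + u) := by simp [swapElt, u]
  have h1 : swapElt T 1 = T 0 * ((1 / 2 : ℂ) • (1 - u)) := by simp [swapElt, u]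
  rw [Fin.sum_univ_two, h0, h1, star_mul (T 0), (hT 0).star_eq, mul_assoc, ← mul_assoc (T 0), hT2,
    one_mul, star_smul, star_smul, smul_mul_smul_comm, smul_mul_smul_comm, ← smul_add, star_add,
    star_sub, star_one]
  simp only [add_mul, mul_add, sub_mul, mul_sub, one_mul, mul_one, hu]
  rw [show 1 + star u + (u + 1) + (1 - star u - (u - 1)) = (4 : ℂ) • (1 : B →L[ℂ] B) by
    rw [show (4 : ℂ) = 1 + 1 + 1 + 1 by norm_num]; simp only [add_smul, one_smul]; abel, smul_smul]
  norm_num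

theorem sum_star_stageElt_mul (hT : ∀ p, IsSelfAdjoint (T p)) (hT2 : ∀ p, T p * T p = 1) :
    ∑ s, ∑ t, star (stageElt T s t) * stageElt T s t = 1 := by
  have h : ∀ s t, star (stageElt T s t) * stageElt T s t =
      star (swapElt T s) * (star (kickElt T t) * kickElt T t) * swapElt T s := by
    intro s t
    rw [stageElt, star_mul]; simp only [mul_assoc]
  simp only [h, ← Finset.sum_mul, ← Finset.mul_sum, sum_star_kickElt_mul hT hT2, mul_one,
    sum_star_swapElt_mul hT hT2]

theorem sum_star_circuitElt_mul {n : ℕ} {T : Fin n → Fin 3 → B →L[ℂ] B}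
    (hT : ∀ j p, IsSelfAdjoint (T j p)) (hT2 : ∀ j p, T j p * T j p = 1) :
    ∑ s, ∑ t, star (circuitElt T s t) * circuitElt T s t = 1 := by
  induction n with
  | zero => simp [circuitElt]
  | succ n ih =>
    have h : ∀ s t, circuitElt T s t = circuitElt (fun j => T j.succ) (fun j => s j.succ)
        (fun j => t j.succ) * stageElt (T 0) (s 0) (t 0) := by
      intro s t
      simp [circuitElt, List.ofFn_succ]
    have h' : ∀ (x y : Fin 2) (s t : Fin n → Fin 2),
        star (circuitElt T (Fin.cons x s) (Fin.cons y t)) *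
          circuitElt T (Fin.cons x s) (Fin.cons y t) =
        star (stageElt (T 0) x y) * (star (circuitElt (fun j => T j.succ) s t) *
          circuitElt (fun j => T j.succ) s t) * stageElt (T 0) x y := by
      intro x y s t
      rw [h, star_mul]
      simp only [Fin.cons_succ, Fin.cons_zero, mul_assoc]
    have e : ∀ f : (Fin (n + 1) → Fin 2) → B →L[ℂ] B,
        ∑ s, f s = ∑ x : Fin 2, ∑ s : Fin n → Fin 2, f (Fin.cons x s) := by
      intro f
      rw [← (Fin.consEquiv fun _ => Fin 2).sum_comp, Fintype.sum_prod_type]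
      rfl
    rw [e]
    simp only [e]
    rw [← sum_star_stageElt_mul (hT 0) (hT2 0)]
    refine Finset.sum_congr rfl fun x _ => ?_
    rw [Finset.sum_comm]
    refine Finset.sum_congr rfl fun y _ => ?_
    simp only [h', ← Finset.sum_mul, ← Finset.mul_sum, ih (fun j => hT j.succ) fun j => hT2 j.succ,
      mul_one]

end Circuit

/-! ### Orthogonal embeddings -/

section Embedding

variable {n : ℕ} {B : Type v} [NormedAddCommGroup B] [InnerProductSpace ℂ B]

/-- The embedding `w ↦ e ⊗ k ⊗ w`. -/
def embed (e k : Qubits n) : B →ₗ[ℂ] BobSpace n B :=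
  TensorProduct.mk ℂ (Qubits n) (Qubits n ⊗[ℂ] B) e ∘ₗ TensorProduct.mk ℂ (Qubits n) B k

theorem inner_embed (e k e' k' : Qubits n) (w w' : B) :
    inner ℂ (embed e k w) (embed e' k' w') = inner ℂ e e' * inner ℂ k k' * inner ℂ w w' := by
  simp [embed, mul_assoc]

theorem inner_ket (s s' : Fin n → Fin 2) : inner ℂ (ket s) (ket s') = if s = s' then (1 : ℂ) else 0 := by
  rw [ket, ket, EuclideanSpace.inner_single_left]
  simp

variable [FiniteDimensional ℂ B]

theorem adjoint_embed (e k u v : Qubits n) (w : B) :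
    LinearMap.adjoint (𝕜 := ℂ) (E := B) (F := BobSpace n B) (embed e k) (u ⊗ₜ (v ⊗ₜ w)) =
      (inner ℂ e u * inner ℂ k v) • w := by
  refine ext_inner_left ℂ fun x => ?_
  rw [LinearMap.adjoint_inner_right, inner_smul_right]
  simp [embed, mul_assoc]

theorem map_ketbra_eq_conjBy (e k : Qubits n) (β : B →ₗ[ℂ] B) :
    TensorProduct.map (ketbra e) (TensorProduct.map (ketbra k) β) =
      conjBy (K := BobSpace n B) (embed e k) β := by
  refine TensorProduct.ext' fun u x => ?_
  induction x with
  | zero => simp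
  | add x y hx hy => rw [TensorProduct.tmul_add, map_add, map_add, hx, hy]
  | tmul v w =>
    rw [conjBy, LinearMap.comp_apply, LinearMap.comp_apply, adjoint_embed]
    simp [ketbra, embed, ← TensorProduct.smul_tmul', TensorProduct.tmul_smul, smul_smul, mul_comm]

end Embedding

/-! ### Summation of the branches -/

section Branches

/-- The labels `(s, t)` of the computational basis vectors `|s⟩ ⊗ |t⟩`. -/
abbrev Branch (n : ℕ) : Type := (Fin n → Fin 2) × (Fin n → Fin 2)

variable {n : ℕ}

/-- The string all of whose entries are `f`. -/
def constString (n : ℕ) (f : Fin 2) : Fin n → Fin 2 := fun _ => f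

theorem constString_injective (hn : 0 < n) : Function.Injective (constString n) :=
  fun _ _ h => congrFun h ⟨0, hn⟩

theorem eq_constString_or (hn : 0 < n) (t : Fin n → Fin 2) :
    (∃ f, t = constString n f) ∨ ∃ i j, t i ≠ t j := by
  by_cases h : ∃ i j, t i ≠ t j
  · exact Or.inr h
  · push Not at h
    exact Or.inl ⟨t ⟨0, hn⟩, funext fun i => h i _⟩

/-- The coefficients of the vector `G f ⊗ |f⋯f⟩`. -/
def branchCoeff (G : Fin 2 → (Fin n → Fin 2) → ℂ) (f : Fin 2) (x : Branch n) : ℂ :=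
  if x.2 = constString n f then G f x.1 else 0

/-- The branches whose second string is attributed to the flag value `f`. -/
def flagBranches (n : ℕ) (f : Fin 2) : Finset (Branch n) :=
  {x | x.2 = constString n 0 ↔ f = 0}

/-- Approximations, up to an error `e`, to the matrix elements between the branches of an operator,
with (`q`) and without (`g`) an additional measurement. -/
structure IsNearIdeal (G : Fin 2 → (Fin n → Fin 2) → ℂ) (e : ℝ) (q g : Branch n → Branch n → ℂ) :
    Prop where
  norm_G_le : ∀ f s, ‖G f s‖ ≤ 1
  q_le : ∀ x y, (∃ i j, y.2 i ≠ y.2 j) → ‖q x y‖ ≤ e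
  q_sub_le : ∀ x f s, ‖q x (s, constString n f) -
    ∑ s', G f s * conj (G f s') * g x (s', constString n f)‖ ≤ e
  g_le : ∀ x y, (∃ i j, x.2 i ≠ x.2 j) → ‖g x y‖ ≤ e
  g_sub_le : ∀ f f' s s', ‖g (s, constString n f) (s', constString n f') -
    if s = s' ∧ f = f' then g (0, constString n f) (0, constString n f) else 0‖ ≤ e

namespace IsNearIdeal

variable {G : Fin 2 → (Fin n → Fin 2) → ℂ} {e : ℝ} {q g : Branch n → Branch n → ℂ}
  (h : IsNearIdeal G e q g)
include h

theorem norm_q_sub_le (hn : 0 < n) (x y : Branch n) :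
    ‖q x y - ∑ f, conj (branchCoeff G f x) * branchCoeff G f y *
      g (0, constString n f) (0, constString n f)‖ ≤ (1 + 2 ^ n) * e := by
  have he : 0 ≤ e := (norm_nonneg _).trans (h.g_sub_le 0 0 0 0)
  have inj := constString_injective hn
  have hm : ∀ f s s', ‖G f s * conj (G f s')‖ ≤ 1 := fun f s s' => by
    rw [norm_mul, RCLike.norm_conj]
    exact mul_le_one₀ (h.norm_G_le _ _) (norm_nonneg _) (h.norm_G_le _ _)
  have card : (Finset.univ : Finset (Fin n → Fin 2)).card = 2 ^ n := by simp
  obtain ⟨s, t⟩ := y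
  rcases eq_constString_or hn t with ⟨f', rfl⟩ | ht
  · obtain ⟨s₀, t₀⟩ := x
    have hq := h.q_sub_le (s₀, t₀) f' s
    rw [← sub_add_sub_cancel _ (∑ s', G f' s * conj (G f' s') *
      g (s₀, t₀) (s', constString n f'))]
    refine (norm_add_le _ _).trans ?_
    rw [add_mul, one_mul]
    refine add_le_add hq ?_
    suffices H : ∃ r : (Fin n → Fin 2) → ℂ, (∑ f, conj (branchCoeff G f (s₀, t₀)) *
        branchCoeff G f (s, constString n f') * g (0, constString n f) (0, constString n f)) =
        (∑ s', G f' s * conj (G f' s') * r s') ∧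
        ∀ s', ‖g (s₀, t₀) (s', constString n f') - r s'‖ ≤ e by
      obtain ⟨r, hr, hr'⟩ := H
      rw [hr, ← Finset.sum_sub_distrib]
      refine (norm_sum_le_of_le _ (f := fun s' => G f' s * conj (G f' s') *
        g (s₀, t₀) (s', constString n f') - G f' s * conj (G f' s') * r s')
        (n := fun _ => e) fun s' _ => ?_).trans ?_
      · rw [← mul_sub, norm_mul]
        exact (mul_le_mul (hm _ _ _) (hr' s') (norm_nonneg _) zero_le_one).trans_eq (one_mul _)
      · rw [Finset.sum_const, card, nsmul_eq_mul]; push_cast; rfl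
    rcases eq_constString_or hn t₀ with ⟨f, rfl⟩ | ht₀
    · refine ⟨fun s' => if s₀ = s' ∧ f = f' then g (0, constString n f) (0, constString n f)
        else 0, ?_, fun s' => h.g_sub_le _ _ _ _⟩
      by_cases hf : f = f'
      · subst hf
        rw [Finset.sum_eq_single f, Finset.sum_eq_single s₀]
        · simp [branchCoeff, mul_comm]
        · intro b _ hb; simp [hb.symm]
        · simp
        · intro b _ hb; simp [branchCoeff, inj.eq_iff, hb.symm]
        · simp
      · rw [Finset.sum_eq_zero, eq_comm, Finset.sum_eq_zero]
        · intro s' _; simp [hf]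
        · intro b _
          by_cases hb : f = b
          · subst hb; simp [branchCoeff, inj.eq_iff, Ne.symm hf]
          · simp [branchCoeff, inj.eq_iff, hb]
    · refine ⟨fun _ => 0, ?_, fun s' => by rw [sub_zero]; exact h.g_le _ _ ht₀⟩
      rw [Finset.sum_eq_zero, eq_comm, Finset.sum_eq_zero]
      · intro s' _; rw [mul_zero]
      · intro b _
        have : t₀ ≠ constString n b := by
          rintro rfl
          obtain ⟨i, j, hij⟩ := ht₀
          exact hij rfl
        simp [branchCoeff, this]
  · rw [Finset.sum_eq_zero, sub_zero]
    · refine (h.q_le x (s, t) ht).trans ?_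
      nlinarith [pow_pos (zero_lt_two : (0 : ℝ) < 2) n]
    · intro b _
      have : t ≠ constString n b := by
        rintro rfl
        obtain ⟨i, j, hij⟩ := ht
        exact hij rfl
      simp [branchCoeff, this]

theorem norm_sum_flagBranches_sub_le (hn : 0 < n) (f : Fin 2) :
    ‖∑ z ∈ flagBranches n f, g z z -
      2 ^ n * g (0, constString n f) (0, constString n f)‖ ≤ 4 ^ n * e := by
  have he : 0 ≤ e := (norm_nonneg _).trans (h.g_sub_le 0 0 0 0)
  have inj := constString_injective hn
  have h1 : (2 ^ n * g (0, constString n f) (0, constString n f) : ℂ) =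
      ∑ z ∈ flagBranches n f, if z.2 = constString n f then
        g (0, constString n f) (0, constString n f) else 0 := by
    rw [flagBranches, Finset.sum_filter, Fintype.sum_prod_type]
    have : ∀ s : Fin n → Fin 2, (∑ t, if (s, t).2 = constString n 0 ↔ f = 0 then
        (if (s, t).2 = constString n f then g (0, constString n f) (0, constString n f) else 0)
        else 0) = g (0, constString n f) (0, constString n f) := by
      intro s
      rw [Finset.sum_eq_single (constString n f)]
      · simp [inj.eq_iff]
      · intro t _ ht; simp [ht]
      · simp
    rw [Finset.sum_congr rfl fun s _ => this s]
    simp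
  rw [h1, ← Finset.sum_sub_distrib]
  refine (norm_sum_le_of_le _ (f := fun z => g z z - if z.2 = constString n f then
    g (0, constString n f) (0, constString n f) else 0) (n := fun _ => e) fun z hz => ?_).trans ?_
  · obtain ⟨s, t⟩ := z
    rcases eq_constString_or hn t with ⟨f', rfl⟩ | ht
    · have hf : f' = f := by
        have : f' = 0 ↔ f = 0 := by simpa [flagBranches, inj.eq_iff] using hz
        omega
      subst hf
      simpa using h.g_sub_le f' f' s s
    · have : t ≠ constString n f := by
        rintro rfl
        obtain ⟨i, j, hij⟩ := ht
        exact hij rfl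
      simp only [this, if_false, sub_zero]
      exact h.g_le _ _ ht
  · rw [Finset.sum_const, nsmul_eq_mul]
    refine mul_le_mul_of_nonneg_right ?_ he
    have := Finset.card_le_univ (flagBranches n f)
    rw [Fintype.card_prod, Fintype.card_fun, Fintype.card_fin, Fintype.card_fin, ← mul_pow] at this
    exact_mod_cast this

end IsNearIdeal

end Branches

/-! ### The ideal vectors -/

section IdealVectors

theorem sum_norm_sq_sigmaKet (q : Fin 5) (a : ℤˣ) : ∑ s, ‖sigmaKet q a s‖ ^ 2 = 1 := by
  have h4 : ‖(Real.sqrt 2 : ℂ)⁻¹‖ ^ 2 = 1 / 2 := by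
    rw [norm_inv, Complex.norm_real, Real.norm_of_nonneg (Real.sqrt_nonneg _), inv_pow,
      Real.sq_sqrt zero_le_two, one_div]
  have h5 : ‖Complex.exp (Complex.I * (angle q : ℂ))‖ = 1 := by
    rw [mul_comm, Complex.norm_exp_ofReal_mul_I]
  have h6 : ‖((a : ℤ) : ℂ)‖ = 1 := by rcases Int.units_eq_one_or a with h | h <;> simp [h]
  rw [Fin.sum_univ_two, sigmaKet]
  split_ifs
  · simp
  · simp
  · simp only [Matrix.cons_val_zero, Matrix.cons_val_one, norm_mul, h5, h6, mul_one, h4]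
    norm_num

variable {n : ℕ}

/-- The components of the vectors `|e_{a|χ}⟩` (for `f = 0`) and `|e*_{a|χ}⟩` (for `f = 1`). -/
def idealCoeff (χ : Question n) (a : Signs n) (f : Fin 2) (s : Fin n → Fin 2) : ℂ :=
  ∏ j, flagSigmaKet f (χ j) (a j) (s j)

theorem sum_norm_sq_idealCoeff (χ : Question n) (a : Signs n) (f : Fin 2) :
    ∑ s, ‖idealCoeff χ a f s‖ ^ 2 = 1 := by
  have h := Finset.prod_univ_sum (fun _ : Fin n => (Finset.univ : Finset (Fin 2)))
    (fun j s => ‖flagSigmaKet f (χ j) (a j) s‖ ^ 2)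
  rw [Fintype.piFinset_univ] at h
  simp only [idealCoeff, norm_prod, ← Finset.prod_pow]
  rw [← h]
  exact Finset.prod_eq_one fun j _ => sum_norm_sq_sigmaKet _ _

theorem norm_idealCoeff_le (χ : Question n) (a : Signs n) (f : Fin 2) (s : Fin n → Fin 2) :
    ‖idealCoeff χ a f s‖ ≤ 1 := by
  have h := Finset.single_le_sum (f := fun s => ‖idealCoeff χ a f s‖ ^ 2)
    (fun _ _ => sq_nonneg _) (Finset.mem_univ s)
  rw [sum_norm_sq_idealCoeff] at h
  exact (sq_le_one_iff₀ (norm_nonneg _)).1 h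

theorem idealCoeff_zero (χ : Question n) (a : Signs n) (s : Fin n → Fin 2) :
    idealCoeff χ a 0 s = idealKet χ a s := by
  simp [idealCoeff, flagSigmaKet, idealKet]

theorem idealCoeff_one (χ : Question n) (a : Signs n) (s : Fin n → Fin 2) :
    idealCoeff χ a 1 s = idealKetConj χ a s := by
  simp [idealCoeff, flagSigmaKet, idealKetConj, idealKet]

end IdealVectors

/-! ### Matrix elements between the branches -/

theorem map_revProd {R R' F : Type*} [Monoid R] [Monoid R'] [FunLike F R R'] [MonoidHomClass F R R']
    (φ : F) {n : ℕ} (f : Fin n → R) : φ (revProd f) = revProd fun j => φ (f j) := by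
  simp [revProd, map_list_prod, List.map_ofFn, Function.comp_def]


theorem inner_map_map_of_star_mul_self {A : Type u} [NormedAddCommGroup A] [InnerProductSpace ℂ A]
    [CompleteSpace A] {B : Type v} [NormedAddCommGroup B] [InnerProductSpace ℂ B]
    {X : A →L[ℂ] A} (hX : star X * X = 1) (w w' : Joint A B) :
    inner ℂ (opA X w) (opA X w') = inner ℂ w w' := by
  rw [inner_opA]
  congr 1
  change (opA (star X) * opA X : Joint A B →L[ℂ] Joint A B) w' = _
  rw [← map_mul, hX, map_one]; rfl

theorem neg_one_pow_mul_of_ne {a b : Fin 2} (h : a ≠ b) :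
    (-1 : ℂ) ^ (a : ℕ) * (-1 : ℂ) ^ (b : ℕ) = -1 := by
  revert h
  fin_cases a <;> fin_cases b <;> simp

theorem norm_inner_sub_inner_le {A : Type u} [NormedAddCommGroup A] [InnerProductSpace ℂ A]
    [CompleteSpace A] {B : Type v} [NormedAddCommGroup B] [InnerProductSpace ℂ B]
    {X : A →L[ℂ] A} (hX : star X * X = 1) {Z : B →L[ℂ] B} (hZ : ‖Z‖ ≤ 1)
    {x x' y y' : Joint A B} {e : ℝ} (hx : ‖x‖ ≤ 1) (hy' : ‖y'‖ ≤ 1) (h : ‖opA X x - y‖ ≤ e)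
    (h' : ‖opA X x' - y'‖ ≤ e) :
    ‖inner ℂ x (opB Z x') - inner ℂ y (opB Z y')‖ ≤ 2 * e := by
  have hZ' := (norm_opB_le (A := A) Z).trans hZ
  have h1 : inner ℂ x (opB Z x') = inner ℂ (opA X x) (opB Z (opA X x')) := by
    rw [← inner_map_map_of_star_mul_self hX]
    congr 1
    exact (congrArg (fun f => f x') (commute_opB_opA X Z).eq).symm
  have h2 : inner ℂ x (opB Z x') - inner ℂ y (opB Z y') =
      inner ℂ (opA X x) (opB Z (opA X x' - y')) + inner ℂ (opA X x - y) (opB Z y') := by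
    rw [h1, map_sub, inner_sub_right, inner_sub_left]
    ring
  rw [h2]
  have e1 : ‖inner ℂ (opA X x) (opB Z (opA X x' - y'))‖ ≤ 1 * (1 * e) :=
    (norm_inner_le_norm _ _).trans (mul_le_mul
      ((norm_opA_of_star_mul_self hX x).trans_le hx)
      ((opB Z).le_of_opNorm_le_of_le hZ' h') (norm_nonneg _) zero_le_one)
  have e2 : ‖inner ℂ (opA X x - y) (opB Z y')‖ ≤ e * (1 * 1) :=
    (norm_inner_le_norm _ _).trans (mul_le_mul h
      ((opB Z).le_of_opNorm_le_of_le hZ' hy') (norm_nonneg _) ((norm_nonneg _).trans h))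
  exact (norm_add_le _ _).trans ((add_le_add e1 e2).trans_eq (by ring))

namespace Experiment

variable {n : ℕ} {S : Set (Question n)}
  {A : Type u} [NormedAddCommGroup A] [InnerProductSpace ℂ A] [CompleteSpace A]
  {B : Type v} [NormedAddCommGroup B] [InnerProductSpace ℂ B] [CompleteSpace B]
  [FiniteDimensional ℂ B] (E : Experiment S A B)

/-- The branch of the shared state, after Bob has applied his isometry, along a computational basis
vector of his ancillas. -/
def branch (x : Branch n) : Joint A B := opB (circuitElt E.paulis x.1 x.2) E.state

theorem sum_norm_sq_opB_circuitElt (w : Joint A B) :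
    ∑ x : Branch n, ‖opB (circuitElt E.paulis x.1 x.2) w‖ ^ 2 = ‖w‖ ^ 2 := by
  have h : ∀ X : B →L[ℂ] B, ((‖opB X w‖ ^ 2 : ℝ) : ℂ) = inner ℂ w (opB (star X * X) w) := by
    intro X
    rw [map_mul]
    change _ = inner ℂ w (opB (star X) (opB X w))
    rw [← inner_opB, inner_self_eq_norm_sq_to_K]; push_cast; rfl
  have h' := sum_star_circuitElt_mul (T := E.paulis) isSelfAdjoint_paulis paulis_mul_self
  rw [← Fintype.sum_prod_type' (f := fun s t =>
    star (circuitElt E.paulis s t) * circuitElt E.paulis s t)] at h'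
  apply Complex.ofReal_injective
  rw [Complex.ofReal_sum, Finset.sum_congr rfl fun x _ => h _, ← inner_sum, ← sum_apply, ← map_sum,
    h', map_one]
  change inner ℂ w w = _
  rw [inner_self_eq_norm_sq_to_K]; push_cast; rfl

theorem sum_norm_sq_branch : ∑ x, ‖E.branch x‖ ^ 2 = 1 := by
  simp only [branch, sum_norm_sq_opB_circuitElt, E.norm_state, one_pow]

theorem norm_branch_le (x : Branch n) : ‖E.branch x‖ ≤ 1 := by
  have h := Finset.single_le_sum (f := fun x => ‖E.branch x‖ ^ 2)
    (fun _ _ => sq_nonneg _) (Finset.mem_univ x)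
  rw [sum_norm_sq_branch] at h
  exact (sq_le_one_iff₀ (norm_nonneg _)).1 h

variable {E} {ε : ℝ≥0} {χ₀ : Question n}

theorem Saturated.circuitElt_model (hE : E.Saturated ε χ₀) (h₀ : χ₀ ∈ S) (hn : 0 < n)
    {χ : Question n} (hχ : χ ∈ S) (x : Branch n) :
    circuitElt (hE.model h₀ hn hχ).t x.1 x.2 (hE.model h₀ hn hχ).ψ = E.branch x := by
  rw [branch, map_circuitElt]; rfl

omit [FiniteDimensional ℂ B] in
theorem opA_mem_unitary {x : Question n} (hx : x ∈ aliceQuestions S) (j : Fin n) :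
    E.obsA x j ∈ unitary (A →L[ℂ] A) := by
  have h1 := (isSelfAdjoint_obsA (E := E) hx j).star_eq
  have h2 := obsA_mul_self (E := E) hx j
  exact ⟨by rw [h1, h2], by rw [h1, h2]⟩

theorem exists_isNearIdeal (hn : 0 < n) (χ : Question n) (c : Signs n) : ∃ C : ℝ, 0 ≤ C ∧
    ∀ (A : Type u) [NormedAddCommGroup A] [InnerProductSpace ℂ A] [CompleteSpace A]
      (B : Type v) [NormedAddCommGroup B] [InnerProductSpace ℂ B] [CompleteSpace B]
      [FiniteDimensional ℂ B] (S : Set (Question n)) (E : Experiment S A B)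
      (ε : ℝ≥0) (χ₀ : Question n), χ₀ ∈ S → χ ∈ S → E.Saturated ε χ₀ →
      ∀ Z : B →L[ℂ] B, ‖Z‖ ≤ 1 → IsNearIdeal (idealCoeff χ c) (C * √ε)
        (fun x y => inner ℂ (E.branch x) (opB Z (opA (E.alice χ c) (E.branch y))))
        (fun x y => inner ℂ (E.branch x) (opB Z (E.branch y))) := by
  obtain ⟨C₁, h₁⟩ := PauliModel.exists_norm_circuitElt_le.{max u v} χ
  obtain ⟨C₂, h₂⟩ := PauliModel.exists_norm_revProd_pow_le.{max u v} χ
  obtain ⟨C₃, h₃⟩ := PauliModel.exists_norm_uElt_le.{max u v} χ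
  obtain ⟨C₄, h₄⟩ := PauliModel.exists_norm_two_le.{max u v} χ
  obtain ⟨C₅, h₅⟩ := PauliModel.exists_norm_measure_le.{max u v} χ
  refine ⟨100 * (|C₁| + 2 * |C₂| + |C₃| + |C₄| + |C₅|), by positivity, ?_⟩
  intro A _ _ _ B _ _ _ _ S E ε χ₀ h₀ hχ hE Z hZ
  set d := √(ε : ℝ)
  have hd : 0 ≤ d := Real.sqrt_nonneg _
  set e := 100 * (|C₁| + 2 * |C₂| + |C₃| + |C₄| + |C₅|) * d with he
  have a₁ : 0 ≤ |C₁| * d := by positivity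
  have a₂ : 0 ≤ |C₂| * d := by positivity
  have a₃ : 0 ≤ |C₃| * d := by positivity
  have a₄ : 0 ≤ |C₄| * d := by positivity
  have a₅ : 0 ≤ |C₅| * d := by positivity
  have b : ∀ C : ℝ, C * (100 * d) ≤ 100 * (|C| * d) := fun C => by
    nlinarith [mul_le_mul_of_nonneg_right (le_abs_self C) hd]
  set m := hE.model h₀ hn hχ
  have hm : ∀ x, circuitElt m.t x.1 x.2 m.ψ = E.branch x := hE.circuitElt_model h₀ hn hχ
  have hm' : ∀ s t, circuitElt m.t s t m.ψ = E.branch (s, t) := fun s t => hm (s, t)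
  have hZ' := (norm_opB_le (A := A) Z).trans hZ
  have hinner : ∀ x y : Joint A B, ‖inner ℂ x (opB Z y)‖ ≤ ‖x‖ * ‖y‖ := fun x y =>
    (norm_inner_le_norm _ _).trans (mul_le_mul_of_nonneg_left
      (((opB Z).le_of_opNorm_le_of_le hZ' le_rfl).trans_eq (one_mul _)) (norm_nonneg _))
  have hP := E.alice_proj χ (mem_aliceQuestions hn hχ)
  have k₁ : ∀ x : Branch n, (∃ i j, x.2 i ≠ x.2 j) → ‖E.branch x‖ ≤ e := fun x hx => by
    have := h₁ x.1 x.2 m hx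
    rw [hm] at this
    exact this.trans ((b C₁).trans (by rw [he]; linarith))
  have hobs : ∀ j p, insertAt j p (dropAt j χ) ∈ aliceQuestions S := fun j p =>
    insertAt_mem_aliceQuestions (dropAt_mem_otherQuestions hχ j) p
  have k₃ : ∀ s t j, ‖opA (Complex.I • (E.obsAt j 0 (dropAt j χ) * E.obsAt j 1 (dropAt j χ)))
      (E.branch (s, t)) - (-1 : ℂ) ^ (s j : ℕ) • E.branch (s, t)‖ ≤ e := fun s t j => by
    have := h₃ s t j m
    rw [hm (s, t)] at this
    rw [map_smul, map_mul]
    exact this.trans ((b C₃).trans (by rw [he]; linarith))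
  have k₄ : ∀ s t j, ‖opA (E.obsAt j 2 (dropAt j χ)) (E.branch (s, t)) -
      (-1 : ℂ) ^ ((s j : ℕ) + t j) • E.branch (s, t)‖ ≤ e := fun s t j => by
    have := h₄ s t j m
    rw [hm (s, t)] at this
    exact this.trans ((b C₄).trans (by rw [he]; linarith))
  refine ⟨fun f s => norm_idealCoeff_le χ c f s, ?_, ?_, ?_, ?_⟩
  · intro x y hy
    refine (hinner _ _).trans ?_
    have h1 : ‖opA (E.alice χ c) (E.branch y)‖ ≤ 1 * e :=
      (opA (E.alice χ c)).le_of_opNorm_le_of_le ((norm_opA_le _).trans ?_) (k₁ y hy)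
    · exact (mul_le_mul (E.norm_branch_le x) h1 (norm_nonneg _) zero_le_one).trans_eq (by ring)
    · have h1 := hP.isStarProjection c
      have h2 := CStarRing.norm_star_mul_self (x := E.alice χ c)
      rw [h1.isSelfAdjoint.star_eq, h1.isIdempotentElem.eq] at h2
      nlinarith [norm_nonneg (E.alice χ c)]
  · intro x f s
    have h := h₅ s (constString n f) c m
    have hrev : (revProd fun j => (1 / 2 : ℂ) • (1 + ((c j : ℤ) : ℂ) •
        (opA (E.obsA χ j) : Joint A B →L[ℂ] Joint A B))) = opA (E.alice χ c) := by
      rw [← revProd_observable hP c, map_revProd]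
      simp only [map_smul, map_add, map_one]
      rfl
    have h : ‖opA (E.alice χ c) (E.branch (s, constString n f)) - ∑ s', (∏ j,
        (flagSigmaKet (constString n f j) (χ j) (c j) (s j) *
          conj (flagSigmaKet (constString n f j) (χ j) (c j) (s' j)))) •
        E.branch (s', constString n f)‖ ≤ C₅ * (100 * d) := by
      rw [← hrev]
      simp only [hm'] at h
      exact h
    rw [Finset.sum_congr rfl fun s' _ => (inner_smul_right _ _ _).symm, ← inner_sum]
    simp only [← map_smul]
    rw [← map_sum, ← inner_sub_right, ← map_sub]
    refine (hinner _ _).trans ((mul_le_mul (E.norm_branch_le x) ?_ (norm_nonneg _)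
      zero_le_one).trans_eq (one_mul e))
    have h6 : ∀ s', idealCoeff χ c f s * conj (idealCoeff χ c f s') =
        ∏ j, (flagSigmaKet (constString n f j) (χ j) (c j) (s j) *
          conj (flagSigmaKet (constString n f j) (χ j) (c j) (s' j))) := fun s' => by
      rw [Finset.prod_mul_distrib, idealCoeff, idealCoeff, map_prod]; rfl
    simp only [h6]
    exact h.trans ((b C₅).trans (by rw [he]; linarith))
  · intro x y hx
    exact (hinner _ _).trans ((mul_le_mul (k₁ x hx) (E.norm_branch_le y) (norm_nonneg _)
      ((norm_nonneg _).trans (k₁ x hx))).trans_eq (mul_one _))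
  · intro f f' s s'
    have sign : ∀ (X : A →L[ℂ] A) (k k' : ℕ), X ∈ unitary (A →L[ℂ] A) →
        (-1 : ℂ) ^ k * (-1 : ℂ) ^ k' = -1 → ∀ x y,
        ‖opA X (E.branch x) - (-1 : ℂ) ^ k • E.branch x‖ ≤ e →
        ‖opA X (E.branch y) - (-1 : ℂ) ^ k' • E.branch y‖ ≤ e →
        ‖inner ℂ (E.branch x) (opB Z (E.branch y))‖ ≤ e := by
      intro X k k' hX hk x y hx hy
      have := norm_inner_sub_inner_le hX.1 hZ (E.norm_branch_le x)
        (by rw [norm_smul]; simpa using E.norm_branch_le y) hx hy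
      rw [map_smul, inner_smul_left, inner_smul_right, ← mul_assoc, map_pow, map_neg, map_one, hk,
        neg_one_mul, sub_neg_eq_add, ← two_mul, norm_mul] at this
      norm_num at this
      exact this
    by_cases hs : s = s'
    · subst hs
      by_cases hf : f = f'
      · subst hf
        rw [if_pos ⟨rfl, rfl⟩, norm_sub_rev]
        have h := h₂ s (constString n f) m
        rw [hm (s, constString n f), hm (0, constString n f)] at h
        have hrev : (revProd fun j => m.a j 0 ^ (s j : ℕ)) =
            opA (revProd fun j => E.obsAt j 0 (dropAt j χ) ^ (s j : ℕ)) := by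
          rw [map_revProd]; simp only [map_pow]; rfl
        have hu : (revProd fun j => E.obsAt j 0 (dropAt j χ) ^ (s j : ℕ)) ∈
            unitary (A →L[ℂ] A) := by
          refine list_prod_mem fun X hX => ?_
          obtain ⟨j, rfl⟩ := (List.mem_ofFn' _ _).1 (List.mem_reverse.1 hX)
          exact pow_mem (opA_mem_unitary (hobs j 0) j) _
        rw [hrev] at h
        have h' := h.trans (b C₂)
        refine (norm_inner_sub_inner_le hu.1 hZ (E.norm_branch_le _) (E.norm_branch_le _)
          h' h').trans ?_
        rw [he]; linarith
      · rw [if_neg fun h => hf h.2, sub_zero]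
        refine sign _ (s ⟨0, hn⟩ + f) (s ⟨0, hn⟩ + f') (opA_mem_unitary (hobs ⟨0, hn⟩ 2) _) ?_
          _ _ (k₄ s (constString n f) ⟨0, hn⟩) (k₄ s (constString n f') ⟨0, hn⟩)
        rw [pow_add, pow_add, mul_mul_mul_comm, neg_one_pow_mul_of_ne hf, ← mul_pow]
        simp
    · rw [if_neg fun h => hs h.1, sub_zero]
      obtain ⟨j, hj⟩ := Function.ne_iff.1 hs
      refine sign _ (s j) (s' j) ?_ (neg_one_pow_mul_of_ne hj) _ _ (k₃ s (constString n f) j)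
        (k₃ s' (constString n f') j)
      have h1 := mul_mem (opA_mem_unitary (E := E) (hobs j 0) j)
        (opA_mem_unitary (E := E) (hobs j 1) j)
      refine ⟨?_, ?_⟩
      · rw [star_smul, smul_mul_smul_comm]
        exact (congrArg _ h1.1).trans (by simp)
      · rw [star_smul, smul_mul_smul_comm]
        exact (congrArg _ h1.2).trans (by simp)

end Experiment

/-! ### Traces of conjugated reduced states -/

section Blocks

variable {A : Type u} [NormedAddCommGroup A] [InnerProductSpace ℂ A] [FiniteDimensional ℂ A]
  {B : Type v} [NormedAddCommGroup B] [InnerProductSpace ℂ B] [FiniteDimensional ℂ B]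
  {W : Type*} [NormedAddCommGroup W] [InnerProductSpace ℂ W]
  {ι : Type*} [Fintype ι]

omit [FiniteDimensional ℂ B] in
theorem norm_sum_sq_of_orthogonal [DecidableEq ι] {J : ι → B →ₗ[ℂ] W}
    (hJ : ∀ x y w w', inner ℂ (J x w) (J y w') = if x = y then inner ℂ w w' else 0) (b : ι → B) :
    ‖∑ x, J x (b x)‖ ^ 2 = ∑ x, ‖b x‖ ^ 2 := by
  apply Complex.ofReal_injective
  have h : ∀ {V : Type _} [NormedAddCommGroup V] [InnerProductSpace ℂ V] (v : V),
      ((‖v‖ ^ 2 : ℝ) : ℂ) = inner ℂ v v := fun v => by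
    rw [inner_self_eq_norm_sq_to_K]; push_cast; rfl
  rw [h, Complex.ofReal_sum, sum_inner]
  refine Finset.sum_congr rfl fun x _ => ?_
  rw [inner_sum, Finset.sum_eq_single x]
  · rw [hJ, if_pos rfl, inner_self_eq_norm_sq_to_K]; push_cast; rfl
  · intro y _ hy; rw [hJ, if_neg hy.symm]
  · simp

omit [FiniteDimensional ℂ B] in
theorem norm_eq_of_inner_self {x : W} {w : B} (h : inner ℂ x x = (inner ℂ w w : ℂ)) :
    ‖x‖ = ‖w‖ := by
  rw [inner_self_eq_norm_sq_to_K, inner_self_eq_norm_sq_to_K] at h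
  have h' : ‖x‖ ^ 2 = ‖w‖ ^ 2 := by exact_mod_cast h
  exact (sq_eq_sq₀ (norm_nonneg _) (norm_nonneg _)).1 h'

variable [FiniteDimensional ℂ W]

/-- The block of `Y` between two embedded copies of `B`. -/
def block (Y : W →ₗ[ℂ] W) (J J' : B →ₗ[ℂ] W) : B →L[ℂ] B :=
  (LinearMap.adjoint J ∘ₗ Y ∘ₗ J').toContinuousLinearMap

theorem inner_block (Y : W →ₗ[ℂ] W) (J J' : B →ₗ[ℂ] W) (w w' : B) :
    inner ℂ w (block Y J J' w') = inner ℂ (J w) (Y (J' w')) :=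
  LinearMap.adjoint_inner_right J w (Y (J' w'))

theorem norm_block_le {Y : W →ₗ[ℂ] W} (hY : ∀ w, ‖Y w‖ ≤ ‖w‖) {J J' : B →ₗ[ℂ] W}
    (hJ : ∀ w, ‖J w‖ = ‖w‖) (hJ' : ∀ w, ‖J' w‖ = ‖w‖) : ‖block Y J J'‖ ≤ 1 := by
  refine ContinuousLinearMap.opNorm_le_bound _ zero_le_one fun w => ?_
  rw [one_mul]
  set v := block Y J J' w with hv
  have h1 : ‖v‖ ^ 2 ≤ ‖v‖ * ‖w‖ := by
    have h2 := inner_block Y J J' v w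
    rw [← hv, inner_self_eq_norm_sq_to_K] at h2
    have h3 := congrArg norm h2
    rw [norm_pow, RCLike.norm_ofReal, abs_norm] at h3
    rw [h3]
    refine (norm_inner_le_norm _ _).trans ?_
    rw [hJ]
    exact mul_le_mul_of_nonneg_left ((hY _).trans_eq (hJ' w)) (norm_nonneg _)
  by_contra! h
  nlinarith [norm_nonneg w]

theorem trace_comp_conjBy_sum (Y : W →ₗ[ℂ] W) (J : ι → B →ₗ[ℂ] W) (C : ι → B →L[ℂ] B)
    (φ : Joint A B) :
    LinearMap.trace ℂ W (Y ∘ₗ conjBy (∑ x, J x ∘ₗ (C x : B →ₗ[ℂ] B))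
      (partialTrace A B (ketbra (H := A ⊗[ℂ] B) φ))) =
    ∑ x, ∑ y, inner ℂ (opB (C x) φ) (opB (block Y (J x) (J y)) (opB (C y) φ)) := by
  have := FiniteDimensional.complete ℂ B
  set V : B →ₗ[ℂ] W := ∑ x, J x ∘ₗ (C x : B →ₗ[ℂ] B) with hV
  have hVw : ∀ w, V w = ∑ x, J x (C x w) := fun w => by simp [V]
  have h : LinearMap.adjoint V ∘ₗ Y ∘ₗ V =
      ((∑ x, ∑ y, star (C x) * block Y (J x) (J y) * C y : B →L[ℂ] B) : B →ₗ[ℂ] B) := by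
    ext w
    refine ext_inner_left ℂ fun v => ?_
    rw [LinearMap.comp_apply, LinearMap.comp_apply, LinearMap.adjoint_inner_right, hVw, hVw,
      map_sum, sum_inner, ContinuousLinearMap.coe_coe, sum_apply, inner_sum]
    refine Finset.sum_congr rfl fun x _ => ?_
    rw [inner_sum, sum_apply, inner_sum]
    refine Finset.sum_congr rfl fun y _ => ?_
    rw [← inner_block]
    change _ = inner ℂ v (star (C x) (block Y (J x) (J y) (C y w)))
    rw [ContinuousLinearMap.star_eq_adjoint, ContinuousLinearMap.adjoint_inner_right]
  rw [trace_comp_conjBy, h, trace_comp_partialTrace_ketbra, map_sum, sum_apply, inner_sum]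
  refine Finset.sum_congr rfl fun x _ => ?_
  rw [map_sum, sum_apply, inner_sum]
  refine Finset.sum_congr rfl fun y _ => ?_
  rw [map_mul, map_mul]
  change inner ℂ φ (opB (star (C x)) (opB (block Y (J x) (J y)) (opB (C y) φ))) = _
  rw [← inner_opB]

end Blocks

/-! ### Bob's isometry and the extracted states -/

section Isometry

variable {n : ℕ} {B : Type v} [NormedAddCommGroup B] [InnerProductSpace ℂ B]

/-- The embedding of `B` along the computational basis vector with a given label. -/
def branchEmbed (x : Branch n) : B →ₗ[ℂ] BobSpace n B := embed (ket x.1) (ket x.2)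

theorem inner_branchEmbed (x y : Branch n) (w w' : B) :
    inner ℂ (branchEmbed x w) (branchEmbed y w') = if x = y then inner ℂ w w' else 0 := by
  rw [branchEmbed, branchEmbed, inner_embed, inner_ket, inner_ket]
  by_cases h : x = y
  · simp [h]
  · rw [if_neg h]
    rw [Prod.ext_iff, not_and_or] at h
    rcases h with h | h <;> simp [h]

theorem norm_branchEmbed (x : Branch n) (w : B) :
    ‖(branchEmbed x w : BobSpace n B)‖ = ‖w‖ :=
  norm_eq_of_inner_self (W := BobSpace n B) ((inner_branchEmbed x x w w).trans (if_pos rfl))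

theorem embed_eq_sum (G : Fin 2 → (Fin n → Fin 2) → ℂ) (f : Fin 2) {e : Qubits n}
    (he : ∀ s, G f s = e s) :
    (embed e (ket fun _ => f) : B →ₗ[ℂ] BobSpace n B) =
      ∑ x, branchEmbed x ∘ₗ ((branchCoeff G f x • (1 : B →L[ℂ] B) : B →L[ℂ] B) : B →ₗ[ℂ] B) := by
  have h : e = ∑ s, G f s • ket s := by
    ext s
    simp [he, ket, Finset.sum_apply, Pi.single_apply]
  ext w
  rw [Fintype.sum_prod_type, LinearMap.sum_apply]
  conv_lhs => rw [h]
  simp only [embed, LinearMap.comp_apply, TensorProduct.mk_apply, TensorProduct.sum_tmul]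
  refine Finset.sum_congr rfl fun s _ => ?_
  rw [LinearMap.sum_apply, Finset.sum_eq_single (constString n f)]
  · simp [branchEmbed, branchCoeff, embed, ← TensorProduct.smul_tmul',
      show (fun _ => f) = constString n f from rfl]
  · intro t _ ht; simp [branchCoeff, ht]
  · simp

end Isometry

namespace Experiment

variable {n : ℕ} {S : Set (Question n)}
  {A : Type u} [NormedAddCommGroup A] [InnerProductSpace ℂ A] [CompleteSpace A]
  {B : Type v} [NormedAddCommGroup B] [InnerProductSpace ℂ B] [CompleteSpace B]
  [FiniteDimensional ℂ B] (E : Experiment S A B)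

theorem VB_eq : E.VB =
    ∑ x : Branch n, branchEmbed x ∘ₗ (circuitElt E.paulis x.1 x.2 : B →L[ℂ] B).toLinearMap := by
  rw [VB, Fintype.sum_prod_type]
  simp only [E.circuitComponent_eq]
  rfl

theorem norm_VB (w : B) : ‖E.VB w‖ = ‖w‖ := by
  have h : E.VB w = ∑ x : Branch n, branchEmbed x (circuitElt E.paulis x.1 x.2 w) := by
    rw [VB_eq, LinearMap.sum_apply]; rfl
  have h1 : ‖E.VB w‖ ^ 2 = ∑ x : Branch n, ‖circuitElt E.paulis x.1 x.2 w‖ ^ 2 := by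
    rw [h]
    exact norm_sum_sq_of_orthogonal (W := BobSpace n B) inner_branchEmbed _
  have h2 : ∑ x : Branch n, ‖circuitElt E.paulis x.1 x.2 w‖ ^ 2 = ‖w‖ ^ 2 := by
    have h3 : ∀ X : B →L[ℂ] B, ((‖X w‖ ^ 2 : ℝ) : ℂ) = inner ℂ w ((star X * X) w) := by
      intro X
      change _ = inner ℂ w (star X (X w))
      rw [ContinuousLinearMap.star_eq_adjoint, ContinuousLinearMap.adjoint_inner_right,
        inner_self_eq_norm_sq_to_K]
      push_cast; rfl
    have h' := sum_star_circuitElt_mul (T := E.paulis) isSelfAdjoint_paulis paulis_mul_self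
    rw [← Fintype.sum_prod_type' (f := fun s t =>
      star (circuitElt E.paulis s t) * circuitElt E.paulis s t)] at h'
    apply Complex.ofReal_injective
    rw [Complex.ofReal_sum, Finset.sum_congr rfl fun x _ => h3 _, ← inner_sum, ← sum_apply, h']
    change inner ℂ w w = _
    rw [inner_self_eq_norm_sq_to_K]; push_cast; rfl
  exact (sq_eq_sq₀ (norm_nonneg _) (norm_nonneg _)).1 (h1.trans h2)

variable [FiniteDimensional ℂ A]

/-- The operators `β₀` and `β₁`. -/
def flagState (f : Fin 2) : B →ₗ[ℂ] B :=
  ∑ z ∈ flagBranches n f, partialTrace A B (ketbra (H := A ⊗[ℂ] B) (E.branch z))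

theorem isPositive_flagState (f : Fin 2) : (E.flagState f).IsPositive := by
  rw [flagState]
  induction flagBranches n f using Finset.induction_on with
  | empty => simp
  | insert z s hz ih =>
    rw [Finset.sum_insert hz]
    exact (isPositive_partialTrace_ketbra _).add ih

omit [FiniteDimensional ℂ A] in
theorem sum_flagBranches (g : Branch n → ℂ) :
    ∑ z ∈ flagBranches n 0, g z + ∑ z ∈ flagBranches n 1, g z = ∑ z, g z := by
  rw [flagBranches, flagBranches]
  simp only [iff_true, one_ne_zero, iff_false]
  exact Finset.sum_filter_add_sum_filter_not _ _ _

theorem trace_flagState_add :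
    LinearMap.trace ℂ B (E.flagState 0) + LinearMap.trace ℂ B (E.flagState 1) = 1 := by
  have h : ∀ φ : Joint A B, LinearMap.trace ℂ B (partialTrace A B (ketbra (H := A ⊗[ℂ] B) φ)) =
      ((‖φ‖ ^ 2 : ℝ) : ℂ) := by
    intro φ
    have := trace_comp_partialTrace_ketbra (1 : B →L[ℂ] B) φ
    rw [map_one] at this
    refine this.trans ?_
    change inner ℂ φ φ = _
    rw [inner_self_eq_norm_sq_to_K]; push_cast; rfl
  rw [flagState, flagState, map_sum, map_sum]
  simp only [h]
  rw [sum_flagBranches, ← Complex.ofReal_sum, E.sum_norm_sq_branch, Complex.ofReal_one]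

end Experiment

theorem IsNearIdeal.mono {n : ℕ} {G : Fin 2 → (Fin n → Fin 2) → ℂ} {e e' : ℝ}
    {q g : Branch n → Branch n → ℂ} (h : IsNearIdeal G e q g) (he : e ≤ e') :
    IsNearIdeal G e' q g where
  norm_G_le := h.norm_G_le
  q_le x y hy := (h.q_le x y hy).trans he
  q_sub_le x f s := (h.q_sub_le x f s).trans he
  g_le x y hx := (h.g_le x y hx).trans he
  g_sub_le f f' s s' := (h.g_sub_le f f' s s').trans he

theorem norm_branchCoeff_le {n : ℕ} {G : Fin 2 → (Fin n → Fin 2) → ℂ} (hG : ∀ f s, ‖G f s‖ ≤ 1)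
    (f : Fin 2) (x : Branch n) : ‖branchCoeff G f x‖ ≤ 1 := by
  rw [branchCoeff]
  split_ifs
  · exact hG _ _
  · simp

theorem sum_conj_branchCoeff_mul {n : ℕ} (χ : Question n) (a : Signs n) (f : Fin 2) :
    ∑ x, conj (branchCoeff (idealCoeff χ a) f x) * branchCoeff (idealCoeff χ a) f x = 1 := by
  have h := sum_norm_sq_idealCoeff χ a f
  rw [Fintype.sum_prod_type, ← Complex.ofReal_one, ← h, Complex.ofReal_sum]
  refine Finset.sum_congr rfl fun s _ => ?_
  rw [Finset.sum_eq_single (constString n f)]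
  · simp [branchCoeff, Complex.conj_mul']
  · intro t _ ht; simp [branchCoeff, ht]
  · simp

namespace Experiment

variable {n : ℕ} {S : Set (Question n)}
  {A : Type u} [NormedAddCommGroup A] [InnerProductSpace ℂ A] [CompleteSpace A]
  {B : Type v} [NormedAddCommGroup B] [InnerProductSpace ℂ B] [CompleteSpace B]
  (E : Experiment S A B)

/-! ### Probabilities -/

section Prob

variable {E} {χ : Question n}

theorem prob_eq (hχ : χ ∈ aliceQuestions S) (a : Signs n) :
    (E.prob χ a : ℂ) = inner ℂ (opA (E.alice χ a) E.state) (opA (E.alice χ a) E.state) := by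
  have hP := (E.alice_proj χ hχ).isStarProjection a
  have h : inner ℂ (opA (E.alice χ a) E.state) (opA (E.alice χ a) E.state) =
      inner ℂ E.state (opA (E.alice χ a) E.state) := by
    rw [inner_opA, hP.isSelfAdjoint.star_eq]
    congr 1
    change (opA (E.alice χ a) * opA (E.alice χ a) : Joint A B →L[ℂ] Joint A B) E.state = _
    rw [← map_mul, hP.isIdempotentElem.eq]
  have h' : E.prob χ a = (inner ℂ E.state (opA (E.alice χ a) E.state)).re := by
    rw [prob, expect_eq, map_one]; rfl
  rw [h', ← h, inner_self_eq_norm_sq_to_K]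
  norm_cast

theorem prob_nonneg (hχ : χ ∈ aliceQuestions S) (a : Signs n) : 0 ≤ E.prob χ a := by
  have h := prob_eq (E := E) hχ a
  rw [inner_self_eq_norm_sq_to_K] at h
  have h' : E.prob χ a = ‖opA (E.alice χ a) E.state‖ ^ 2 := by
    apply Complex.ofReal_injective
    exact h.trans (Complex.ofReal_pow _ _).symm
  rw [h']; positivity

theorem sum_prob (hχ : χ ∈ aliceQuestions S) : ∑ a, E.prob χ a = 1 := by
  have h : ∀ a, E.prob χ a = (inner ℂ E.state (opA (E.alice χ a) E.state)).re := fun a => by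
    rw [prob, expect_eq, map_one]; rfl
  simp only [h]
  rw [← Complex.re_sum, ← inner_sum, ← sum_apply, ← map_sum, (E.alice_proj χ hχ).sum_eq_one,
    map_one]
  change (inner ℂ E.state E.state).re = 1
  rw [inner_self_eq_norm_sq_to_K, E.norm_state]; simp

theorem prob_le_one (hχ : χ ∈ aliceQuestions S) (a : Signs n) : E.prob χ a ≤ 1 := by
  rw [← sum_prob (E := E) hχ]
  exact Finset.single_le_sum (fun a _ => prob_nonneg hχ a) (Finset.mem_univ a)

theorem probOf_nonneg (hχ : χ ∈ aliceQuestions S) (p : Signs n → Prop) : 0 ≤ E.probOf χ p :=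
  Finset.sum_nonneg fun a _ => prob_nonneg hχ a

theorem probOf_eq_one (hχ : χ ∈ aliceQuestions S) {p : Signs n → Prop} (hp : ∀ a, p a) :
    E.probOf χ p = 1 := by
  classical
  rw [probOf, Finset.filter_true_of_mem fun a _ => hp a, sum_prob hχ]

end Prob

/-! ### The trace distance -/

variable [FiniteDimensional ℂ B]

/-- The matrix elements of Bob's operator `Z` between branches, after Alice's answer. -/
def measuredElt (χ : Question n) (a : Signs n) (Z : B →L[ℂ] B) (x y : Branch n) : ℂ :=
  inner ℂ (E.branch x) (opB Z (opA (E.alice χ a) (E.branch y)))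

/-- The matrix elements of Bob's operator `Z` between branches. -/
def branchElt (Z : B →L[ℂ] B) (x y : Branch n) : ℂ := inner ℂ (E.branch x) (opB Z (E.branch y))

theorem measuredElt_eq {χ : Question n} (hχ : χ ∈ aliceQuestions S) (a : Signs n) (Z : B →L[ℂ] B)
    (x y : Branch n) : inner ℂ (opB (circuitElt E.paulis x.1 x.2) (opA (E.alice χ a) E.state))
      (opB Z (opB (circuitElt E.paulis y.1 y.2) (opA (E.alice χ a) E.state))) =
      E.measuredElt χ a Z x y := by
  have hP := (E.alice_proj χ hχ).isStarProjection a
  have h : ∀ (Y : B →L[ℂ] B) (w : Joint A B),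
      opB Y (opA (E.alice χ a) w) = opA (E.alice χ a) (opB Y w) := fun Y w =>
    congrArg (fun f => f w) (commute_opB_opA (E.alice χ a) Y).eq
  have hb : ∀ x : Branch n, opB (circuitElt E.paulis x.1 x.2) (opA (E.alice χ a) E.state) =
      opA (E.alice χ a) (E.branch x) := fun x => h _ _
  have hi : opA (E.alice χ a) (opA (E.alice χ a) (E.branch y)) =
      opA (E.alice χ a) (E.branch y) := by
    change (opA (E.alice χ a) * opA (E.alice χ a) : Joint A B →L[ℂ] Joint A B) _ = _
    rw [← map_mul, hP.isIdempotentElem.eq]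
  rw [hb, hb, inner_opA, hP.isSelfAdjoint.star_eq, ← h, hi, measuredElt]

section Traces

variable {W : Type*} [NormedAddCommGroup W] [InnerProductSpace ℂ W] [FiniteDimensional ℂ W]

omit [FiniteDimensional ℂ W] in
theorem trace_comp_sub_add (Y X X₀ X₁ : W →ₗ[ℂ] W) :
    LinearMap.trace ℂ W (Y ∘ₗ (X - (X₀ + X₁))) = LinearMap.trace ℂ W (Y ∘ₗ X) -
      (LinearMap.trace ℂ W (Y ∘ₗ X₀) + LinearMap.trace ℂ W (Y ∘ₗ X₁)) := by
  rw [LinearMap.comp_sub, LinearMap.comp_add, map_sub, map_add]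

variable [FiniteDimensional ℂ A]

theorem trace_comp_conjBy_flagState (Y : W →ₗ[ℂ] W) (J : Branch n → B →ₗ[ℂ] W) (c : Branch n → ℂ)
    (f : Fin 2) : LinearMap.trace ℂ W (Y ∘ₗ
      conjBy (∑ x, J x ∘ₗ ((c x • (1 : B →L[ℂ] B) : B →L[ℂ] B) : B →ₗ[ℂ] B)) (E.flagState f)) =
    ∑ x, ∑ y, conj (c x) * c y *
      ∑ z ∈ flagBranches n f, E.branchElt (block Y (J x) (J y)) z z := by
  have h : ∀ (c : ℂ) (w : Joint A B), opB (c • (1 : B →L[ℂ] B)) w = c • w := fun c w => by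
    rw [map_smul, map_one]; rfl
  rw [trace_comp_conjBy, flagState, ← Module.End.mul_eq_comp (_ ∘ₗ _), Finset.mul_sum, map_sum]
  simp only [Module.End.mul_eq_comp, ← trace_comp_conjBy, trace_comp_conjBy_sum]
  rw [Finset.sum_comm]
  refine Finset.sum_congr rfl fun x _ => ?_
  rw [Finset.sum_comm]
  refine Finset.sum_congr rfl fun y _ => ?_
  rw [Finset.mul_sum]
  exact Finset.sum_congr rfl fun z _ => by
    rw [h, h, map_smul, inner_smul_left, inner_smul_right, ← mul_assoc, branchElt]

theorem ρB_eq (χ : Question n) (a : Signs n) : E.ρB χ a = (E.prob χ a : ℂ)⁻¹ •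
    partialTrace A B (ketbra (H := A ⊗[ℂ] B) (opA (E.alice χ a) E.state)) := by
  have h : (opA (E.alice χ a) E.state : Joint A B) =
      TensorProduct.map (E.alice χ a : A →ₗ[ℂ] A) LinearMap.id E.ψ := by
    refine Eq.trans ?_ (opA_opB (E.alice χ a) (1 : B →L[ℂ] B) E.ψ)
    rw [map_one]; rfl
  rw [ρB, h]
  exact map_smul (partialTrace A B) _ _

theorem trace_comp_conjBy_ρB {χ : Question n} (hχ : χ ∈ aliceQuestions S) (a : Signs n)
    (Y : W →ₗ[ℂ] W) (J : Branch n → B →ₗ[ℂ] W) :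
    LinearMap.trace ℂ W (Y ∘ₗ conjBy
      (∑ x, J x ∘ₗ (circuitElt E.paulis x.1 x.2 : B →L[ℂ] B).toLinearMap) (E.ρB χ a)) =
    (E.prob χ a : ℂ)⁻¹ * ∑ x, ∑ y, E.measuredElt χ a (block Y (J x) (J y)) x y := by
  rw [trace_comp_conjBy, ρB_eq, LinearMap.comp_smul, map_smul, ← trace_comp_conjBy,
    trace_comp_conjBy_sum, smul_eq_mul]
  simp only [E.measuredElt_eq hχ]

end Traces

variable {E}

theorem norm_branchElt_le {Z : B →L[ℂ] B} (hZ : ‖Z‖ ≤ 1) (x y : Branch n) :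
    ‖E.branchElt Z x y‖ ≤ 1 := by
  refine (norm_inner_le_norm _ _).trans (mul_le_one₀ (E.norm_branch_le x) (norm_nonneg _) ?_)
  exact ((opB Z).le_of_opNorm_le_of_le ((norm_opB_le _).trans hZ) (E.norm_branch_le y)).trans_eq
    (one_mul 1)

variable {χ : Question n} {a : Signs n} {e : ℝ}
  (h : ∀ Z : B →L[ℂ] B, ‖Z‖ ≤ 1 → IsNearIdeal (idealCoeff χ a) e (E.measuredElt χ a Z)
    (E.branchElt Z))
include h

theorem norm_two_pow_mul_prob_sub_one_le (hn : 0 < n) (hχ : χ ∈ aliceQuestions S) :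
    ‖(2 ^ n * E.prob χ a - 1 : ℂ)‖ ≤ (8 ^ n * (1 + 2 ^ n) + 2 * 4 ^ n) * e := by
  have h1 := h 1 ContinuousLinearMap.norm_id_le
  set g : Fin 2 → ℂ := fun f => E.branchElt 1 (0, constString n f) (0, constString n f)
  have hp : (E.prob χ a : ℂ) = ∑ x, E.measuredElt χ a 1 x x := by
    rw [prob_eq hχ, inner_self_eq_norm_sq_to_K]
    have h2 := E.sum_norm_sq_opB_circuitElt (opA (E.alice χ a) E.state)
    have h3 : ((‖opA (E.alice χ a) E.state‖ : ℝ) : ℂ) ^ 2 = _ :=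
      (Complex.ofReal_pow _ _).symm.trans (congrArg Complex.ofReal h2.symm)
    refine h3.trans ?_
    rw [Complex.ofReal_sum]
    refine Finset.sum_congr rfl fun x _ => ?_
    rw [← E.measuredElt_eq hχ a 1 x x, map_one]
    change _ = inner ℂ (opB _ _) (opB _ _)
    rw [inner_self_eq_norm_sq_to_K]; push_cast; rfl
  have hA : ‖(E.prob χ a : ℂ) - ∑ f, g f‖ ≤ 4 ^ n * ((1 + 2 ^ n) * e) := by
    have h4 : ∑ f, g f = ∑ x, ∑ f, conj (branchCoeff (idealCoeff χ a) f x) *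
        branchCoeff (idealCoeff χ a) f x * g f := by
      rw [Finset.sum_comm]
      refine Finset.sum_congr rfl fun f _ => ?_
      rw [← Finset.sum_mul, sum_conj_branchCoeff_mul, one_mul]
    rw [hp, h4, ← Finset.sum_sub_distrib]
    refine (norm_sum_le_of_le _ (n := fun _ => (1 + 2 ^ n) * e)
      fun x _ => h1.norm_q_sub_le hn x x).trans_eq ?_
    rw [Finset.sum_const, nsmul_eq_mul, Finset.card_univ, Fintype.card_prod, Fintype.card_fun,
      Fintype.card_fin, Fintype.card_fin, ← mul_pow]
    norm_num
  have hB : ‖(1 : ℂ) - 2 ^ n * ∑ f, g f‖ ≤ 2 * (4 ^ n * e) := by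
    have h5 : (1 : ℂ) = ∑ f, ∑ z ∈ flagBranches n f, E.branchElt 1 z z := by
      rw [Fin.sum_univ_two, sum_flagBranches]
      have h6 : ∀ z, E.branchElt 1 z z = ((‖E.branch z‖ ^ 2 : ℝ) : ℂ) := fun z => by
        rw [branchElt, map_one]
        change inner ℂ (E.branch z) (E.branch z) = _
        rw [inner_self_eq_norm_sq_to_K]; push_cast; rfl
      rw [Finset.sum_congr rfl fun z _ => h6 z, ← Complex.ofReal_sum, E.sum_norm_sq_branch]
      simp
    rw [h5, Finset.mul_sum, ← Finset.sum_sub_distrib]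
    refine (norm_sum_le_of_le _ (n := fun _ => 4 ^ n * e)
      fun f _ => h1.norm_sum_flagBranches_sub_le hn f).trans_eq ?_
    simp
  have h7 : (2 ^ n * E.prob χ a - 1 : ℂ) = 2 ^ n * (E.prob χ a - ∑ f, g f) -
      (1 - 2 ^ n * ∑ f, g f) := by ring
  rw [h7]
  refine (norm_sub_le _ _).trans ?_
  rw [norm_mul, norm_pow, Complex.norm_ofNat]
  have h8 : (8 : ℝ) ^ n = 2 ^ n * 4 ^ n := by rw [← mul_pow]; norm_num
  rw [h8]
  nlinarith [mul_le_mul_of_nonneg_left hA (pow_nonneg (zero_le_two (α := ℝ)) n)]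

theorem norm_measuredElt_sub_le (hn : 0 < n) (hχ : χ ∈ aliceQuestions S) {e' : ℝ}
    (hp : ‖(2 ^ n * E.prob χ a - 1 : ℂ)‖ ≤ e') {Z : B →L[ℂ] B} (hZ : ‖Z‖ ≤ 1) (x y : Branch n) :
    ‖E.measuredElt χ a Z x y - E.prob χ a * ∑ f, conj (branchCoeff (idealCoeff χ a) f x) *
      branchCoeff (idealCoeff χ a) f y * ∑ z ∈ flagBranches n f, E.branchElt Z z z‖ ≤
      (1 + 2 ^ n) * e + 2 * (e' + 4 ^ n * e) := by
  have hZ' := h Z hZ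
  set g : Fin 2 → ℂ := fun f => E.branchElt Z (0, constString n f) (0, constString n f)
  set c : Fin 2 → ℂ := fun f => conj (branchCoeff (idealCoeff χ a) f x) *
    branchCoeff (idealCoeff χ a) f y
  set s : Fin 2 → ℂ := fun f => ∑ z ∈ flagBranches n f, E.branchElt Z z z
  have hc : ∀ f, ‖c f‖ ≤ 1 := fun f => by
    rw [norm_mul, RCLike.norm_conj]
    exact mul_le_one₀ (norm_branchCoeff_le hZ'.norm_G_le _ _) (norm_nonneg _)
      (norm_branchCoeff_le hZ'.norm_G_le _ _)
  have hp1 : ‖(E.prob χ a : ℂ)‖ ≤ 1 := by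
    rw [Complex.norm_real, Real.norm_of_nonneg (prob_nonneg hχ a)]; exact prob_le_one hχ a
  have hgs : ∀ f, ‖g f - E.prob χ a * s f‖ ≤ e' + 4 ^ n * e := by
    intro f
    have h1 : g f - E.prob χ a * s f = -((2 ^ n * E.prob χ a - 1) * g f +
      E.prob χ a * (s f - 2 ^ n * g f)) := by ring
    rw [h1, norm_neg]
    refine (norm_add_le _ _).trans (add_le_add ?_ ?_)
    · rw [norm_mul]
      exact (mul_le_mul hp (norm_branchElt_le hZ _ _) (norm_nonneg _)
        ((norm_nonneg _).trans hp)).trans_eq (mul_one _)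
    · rw [norm_mul]
      exact (mul_le_mul hp1 (hZ'.norm_sum_flagBranches_sub_le hn f) (norm_nonneg _)
        zero_le_one).trans_eq (one_mul _)
  rw [← sub_add_sub_cancel _ (∑ f, c f * g f)]
  refine (norm_add_le _ _).trans (add_le_add (hZ'.norm_q_sub_le hn x y) ?_)
  have h2 : ∑ f, c f * g f - E.prob χ a * ∑ f, c f * s f =
      ∑ f, c f * (g f - E.prob χ a * s f) := by
    rw [Finset.mul_sum, ← Finset.sum_sub_distrib]
    exact Finset.sum_congr rfl fun f _ => by ring
  refine (congrArg norm h2).trans_le ?_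
  refine (norm_sum_le_of_le _ (n := fun _ => e' + 4 ^ n * e) fun f _ => ?_).trans_eq
    (by simp [mul_add])
  rw [norm_mul]
  exact (mul_le_mul (hc f) (hgs f) (norm_nonneg _) zero_le_one).trans_eq (one_mul _)

variable [FiniteDimensional ℂ A]

theorem traceNorm_conjBy_sub_le (hn : 0 < n) (hχ : χ ∈ aliceQuestions S) {e' : ℝ}
    (hp : ‖(2 ^ n * E.prob χ a - 1 : ℂ)‖ ≤ e') (he' : e' ≤ 1 / 2)
    {W : Type*} [NormedAddCommGroup W] [InnerProductSpace ℂ W] [FiniteDimensional ℂ W]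
    {J : Branch n → B →ₗ[ℂ] W} (hJ : ∀ x w, ‖J x w‖ = ‖w‖) {V : B →ₗ[ℂ] W}
    (hV : V = ∑ x, J x ∘ₗ (circuitElt E.paulis x.1 x.2 : B →L[ℂ] B).toLinearMap)
    {X : Fin 2 → W →ₗ[ℂ] W}
    (hX : ∀ f, X f = conjBy (∑ x, J x ∘ₗ
      ((branchCoeff (idealCoeff χ a) f x • (1 : B →L[ℂ] B) : B →L[ℂ] B) : B →ₗ[ℂ] B))
      (E.flagState f)) :
    traceNorm (conjBy V (E.ρB χ a) - (X 0 + X 1)) ≤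
      2 * 2 ^ n * (16 ^ n * ((1 + 2 ^ n) * e + 2 * (e' + 4 ^ n * e))) := by
  set p := E.prob χ a
  have hp0 : (1 / 2 : ℝ) ≤ 2 ^ n * p := by
    have h1 : ‖(2 ^ n * p - 1 : ℂ)‖ = |2 ^ n * p - 1| := by
      rw [← Real.norm_eq_abs, ← Complex.norm_real]; push_cast; rfl
    have h2 := (abs_le.1 ((h1.symm.trans_le hp).trans he')).1
    linarith
  have hN : (0 : ℝ) < 2 ^ n := by positivity
  have hp_pos : 0 < p := by
    by_contra! hneg
    nlinarith
  have hpinv : p⁻¹ ≤ 2 * 2 ^ n := by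
    rw [inv_le_iff_one_le_mul₀ hp_pos]; linarith
  set K := (1 + 2 ^ n) * e + 2 * (e' + 4 ^ n * e)
  refine traceNorm_le fun Y hY => ?_
  set Z : Branch n → Branch n → B →L[ℂ] B := fun x y => block Y (J x) (J y)
  have hZ : ∀ x y, ‖Z x y‖ ≤ 1 := fun x y => norm_block_le hY (hJ x) (hJ y)
  rw [trace_comp_sub_add, hV, hX, hX, E.trace_comp_conjBy_ρB hχ,
    E.trace_comp_conjBy_flagState, E.trace_comp_conjBy_flagState]
  have hp' : (p : ℂ) ≠ 0 := by exact_mod_cast hp_pos.ne'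
  have heq : (p : ℂ)⁻¹ * ∑ x, ∑ y, E.measuredElt χ a (Z x y) x y -
      (∑ x, ∑ y, conj (branchCoeff (idealCoeff χ a) 0 x) * branchCoeff (idealCoeff χ a) 0 y *
        ∑ z ∈ flagBranches n 0, E.branchElt (Z x y) z z +
      ∑ x, ∑ y, conj (branchCoeff (idealCoeff χ a) 1 x) * branchCoeff (idealCoeff χ a) 1 y *
        ∑ z ∈ flagBranches n 1, E.branchElt (Z x y) z z) =
      (p : ℂ)⁻¹ * ∑ x, ∑ y, (E.measuredElt χ a (Z x y) x y - p * ∑ f,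
        conj (branchCoeff (idealCoeff χ a) f x) * branchCoeff (idealCoeff χ a) f y *
        ∑ z ∈ flagBranches n f, E.branchElt (Z x y) z z) := by
    simp only [Finset.sum_sub_distrib, ← Finset.mul_sum, Fin.sum_univ_two,
      Finset.sum_add_distrib]
    field_simp
  refine (congrArg norm heq).trans_le ?_
  rw [norm_mul, norm_inv, Complex.norm_real, Real.norm_of_nonneg hp_pos.le]
  refine mul_le_mul hpinv ?_ (norm_nonneg _) (by positivity)
  have hcard : (Fintype.card (Branch n) : ℝ) = 4 ^ n := by
    rw [Fintype.card_prod, Fintype.card_fun, Fintype.card_fin, Fintype.card_fin]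
    push_cast
    rw [← mul_pow]
    norm_num
  refine (norm_sum_le_of_le _ (n := fun _ => 4 ^ n * K) fun x _ => ?_).trans_eq ?_
  · refine (norm_sum_le_of_le _ (n := fun _ => K) fun y _ =>
      norm_measuredElt_sub_le h hn hχ hp (hZ x y) x y).trans_eq ?_
    rw [Finset.sum_const, nsmul_eq_mul, Finset.card_univ, hcard]
  · rw [Finset.sum_const, nsmul_eq_mul, Finset.card_univ, hcard, ← mul_assoc, ← mul_pow]
    norm_num

theorem traceDist_le (hn : 0 < n) (hχ : χ ∈ aliceQuestions S) {e' : ℝ}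
    (hp : ‖(2 ^ n * E.prob χ a - 1 : ℂ)‖ ≤ e') (he' : e' ≤ 1 / 2) :
    traceDist (H := BobSpace n B) (conjBy E.VB (E.ρB χ a))
      (idealState χ a (E.flagState 0) (E.flagState 1)) ≤
      2 ^ n * 16 ^ n * ((1 + 2 ^ n) * e + 2 * (e' + 4 ^ n * e)) := by
  have h1 : ∀ f, conjBy (K := BobSpace n B)
      (embed (![idealKet χ a, idealKetConj χ a] f) (ket fun _ => f)) (E.flagState f) =
      conjBy (K := BobSpace n B) (∑ x, branchEmbed x ∘ₗ
        ((branchCoeff (idealCoeff χ a) f x • (1 : B →L[ℂ] B) : B →L[ℂ] B) : B →ₗ[ℂ] B))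
        (E.flagState f) := by
    intro f
    refine congrArg (fun J => conjBy (K := BobSpace n B) J (E.flagState f))
      (embed_eq_sum (idealCoeff χ a) f ?_)
    fin_cases f
    · exact idealCoeff_zero χ a
    · exact idealCoeff_one χ a
  have h2 := traceNorm_conjBy_sub_le h hn hχ hp he' (W := BobSpace n B) norm_branchEmbed
    E.VB_eq h1
  have h3 : idealState χ a (E.flagState 0) (E.flagState 1) =
      (conjBy (K := BobSpace n B) (embed (idealKet χ a) (ket fun _ => 0)) (E.flagState 0) +
      conjBy (K := BobSpace n B) (embed (idealKetConj χ a) (ket fun _ => 1)) (E.flagState 1) :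
      Module.End ℂ (BobSpace n B)) :=
    congrArg₂ (· + ·) (map_ketbra_eq_conjBy _ _ _) (map_ketbra_eq_conjBy _ _ _)
  rw [traceDist, h3]
  refine (mul_le_mul_of_nonneg_left h2 (by norm_num)).trans_eq ?_
  ring

end Experiment

namespace Experiment

theorem exists_isNearIdeal_const (n : ℕ) : ∃ K : ℝ≥0, 0 < n →
    ∀ (A : Type u) [NormedAddCommGroup A] [InnerProductSpace ℂ A] [CompleteSpace A]
      (B : Type v) [NormedAddCommGroup B] [InnerProductSpace ℂ B] [CompleteSpace B]
      [FiniteDimensional ℂ B] (S : Set (Question n)) (E : Experiment S A B)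
      (ε : ℝ≥0) (χ₀ : Question n), χ₀ ∈ S → E.Saturated ε χ₀ → ∀ χ ∈ S, ∀ (a : Signs n)
      (Z : B →L[ℂ] B), ‖Z‖ ≤ 1 →
      IsNearIdeal (idealCoeff χ a) (K * √ε) (E.measuredElt χ a Z) (E.branchElt Z) := by
  rcases Nat.eq_zero_or_pos n with rfl | hn
  · exact ⟨0, fun h => absurd h (lt_irrefl 0)⟩
  choose C hC h using fun x : Question n × Signs n => exists_isNearIdeal.{u, v} hn x.1 x.2
  obtain ⟨K, hK⟩ := (Set.finite_range C).bddAbove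
  refine ⟨K.toNNReal, ?_⟩
  intro _ A _ _ _ B _ _ _ _ S E ε χ₀ h₀ hE χ hχ a Z hZ
  refine (h (χ, a) A B S E ε χ₀ h₀ hχ hE Z hZ).mono ?_
  exact mul_le_mul_of_nonneg_right ((hK ⟨_, rfl⟩).trans (Real.le_coe_toNNReal K))
    (Real.sqrt_nonneg _)

/-- The bound for the error in the probability of an answer. -/
def probConst (n : ℕ) : ℝ≥0 := 8 ^ n * (1 + 2 ^ n) + 2 * 4 ^ n

/-- The bound for the error in the trace distance. -/
def distConst (n : ℕ) : ℝ≥0 :=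
  2 ^ n * 16 ^ n * ((1 + 2 ^ n) + 2 * (probConst n + 4 ^ n)) + probConst n

theorem probOf_traceDist_ge {n : ℕ} (hn : 0 < n) {S : Set (Question n)}
    {A : Type u} [NormedAddCommGroup A] [InnerProductSpace ℂ A] [CompleteSpace A]
    [FiniteDimensional ℂ A]
    {B : Type v} [NormedAddCommGroup B] [InnerProductSpace ℂ B] [CompleteSpace B]
    [FiniteDimensional ℂ B] {E : Experiment S A B} {χ : Question n} (hχ : χ ∈ S) {e : ℝ≥0}
    (h : ∀ (a : Signs n) (Z : B →L[ℂ] B), ‖Z‖ ≤ 1 →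
      IsNearIdeal (idealCoeff χ a) e (E.measuredElt χ a Z) (E.branchElt Z)) :
    1 - 4 * ((distConst n * e : ℝ≥0) : ℝ) ≤ E.probOf χ fun a =>
      traceDist (H := BobSpace n B) (conjBy E.VB (E.ρB χ a))
        (idealState χ a (E.flagState 0) (E.flagState 1)) ≤ (distConst n * e : ℝ≥0) := by
  have hχ' := mem_aliceQuestions hn hχ
  have hle : (probConst n : ℝ) * e ≤ distConst n * e := by
    refine mul_le_mul_of_nonneg_right ?_ e.2
    exact_mod_cast le_add_of_nonneg_left (zero_le (a := _))
  by_cases he : (probConst n : ℝ) * e ≤ 1 / 2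
  · rw [probOf_eq_one hχ']
    · have : (0 : ℝ) ≤ (distConst n * e : ℝ≥0) := NNReal.coe_nonneg _
      linarith
    · intro a
      refine (traceDist_le (h a) hn hχ'
        ((norm_two_pow_mul_prob_sub_one_le (h a) hn hχ').trans_eq ?_) he).trans ?_
      · simp [probConst]
      · have h0 : (0 : ℝ) ≤ probConst n * e := by positivity
        rw [distConst]
        push_cast
        nlinarith
  · refine le_trans ?_ (probOf_nonneg hχ' _)
    push_cast
    linarith

end Experiment

end StatePrep

end

theorem mainTheorem1 :
    ∃ τ : ℝ≥0 → ℕ → ℝ≥0, (∀ n, τ 0 n = 0) ∧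
      ∀ (n : ℕ), 0 < n →
      ∀ (A : Type u) [NormedAddCommGroup A] [InnerProductSpace ℂ A] [CompleteSpace A]
        [FiniteDimensional ℂ A]
        (B : Type v) [NormedAddCommGroup B] [InnerProductSpace ℂ B] [CompleteSpace B]
        [FiniteDimensional ℂ B]
        (S : Set (StatePrep.Question n)) (E : StatePrep.Experiment S A B)
        (ε : ℝ≥0) (χ₀ : StatePrep.Question n), χ₀ ∈ S → E.Saturated ε χ₀ →
        (∀ w : B, ‖E.VB w‖ = ‖w‖) ∧
        ∃ β₀ β₁ : B →ₗ[ℂ] B, β₀.IsPositive ∧ β₁.IsPositive ∧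
          LinearMap.trace ℂ B β₀ + LinearMap.trace ℂ B β₁ = 1 ∧
          ∀ χ ∈ S,
            1 - 4 * (τ ε n : ℝ) ≤ E.probOf χ fun a =>
              StatePrep.traceDist (H := StatePrep.BobSpace n B) (StatePrep.conjBy E.VB (E.ρB χ a))
                (StatePrep.idealState χ a β₀ β₁) ≤ τ ε n := by
  choose K hK using fun n : ℕ => StatePrep.Experiment.exists_isNearIdeal_const.{u, v} n
  refine ⟨fun ε n => StatePrep.Experiment.distConst n * (K n * NNReal.sqrt ε), fun n => by simp, ?_⟩
  intro n hn A _ _ _ _ B _ _ _ _ S E ε χ₀ h₀ hE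
  refine ⟨E.norm_VB, E.flagState 0, E.flagState 1, E.isPositive_flagState 0,
    E.isPositive_flagState 1, E.trace_flagState_add, fun χ hχ => ?_⟩
  refine StatePrep.Experiment.probOf_traceDist_ge hn hχ fun a Z hZ => ?_
  rw [NNReal.coe_mul, Real.coe_sqrt]
  exact hK n hn A B S E ε χ₀ h₀ hE χ hχ a Z hZ
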